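/- Conventions. A min-cost reachability (MCR) game is played by two players, Max and Min, on a finite directed graph $(V,E)$ without deadlocks (every vertex has a successor), with integer edge weights $\omega$, a partition of $V$ into vertices of Max and vertices of Min, and a target set $T\subseteq V$. The owner of the current vertex, knowing the whole history, chooses the next edge. The payoff of a play is the sum of the weights up to its first visit to $T$, and $+\infty$ if $T$ is never visited. Max maximises and Min minimises the payoff. These games are determined, and $\mathrm{Val}(v)\in\mathbb Z\cup\{-\infty,+\infty\}$ is the common lower and upper value of $v$. A strategy is optimal if it guarantees the lower value (for Max), respectively the upper value (for Min), from every vertex. It is memoryless if it depends on the current vertex only, and finite-memory of size $K$ if it is given by a deterministic Moore machine with $K$ states. Let $W=\max_{e\in E}|\omega(e)|$. "Polynomial" refers to the size of the input with weights in binary, "pseudo-polynomial" to weights in unary; the machine is a random access machine in which each evaluation of an operation (addition, subtraction, memory access, comparison) takes one step. The mean payoff of a play $v_0v_1\cdots$ is $\liminf_k \frac1k\sum_{i<k}\omega(v_i,v_{i+1})$. The mean-payoff problem asks, given a weighted graph without target and a vertex $v$, whether the mean-payoff value of $v$ is negative. Theorem. For MCR games: 1. $\mathrm{Val}(v)=+\infty$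 if and only if $v$ is not in the attractor of $T$ (the set of vertices from which Min can force a visit to $T$, obtained after at most $|V|$ steps of the attractor iteration), and deciding whether $\mathrm{Val}(v)=+\infty$ can be done in polynomial time. 2. Deciding whether $\mathrm{Val}(v)=-\infty$ is as hard as the mean-payoff problem (each of the two problems is many-one reducible to the other in polynomial time), is in $\mathrm{NP}\cap\mathrm{coNP}$, and can be done in pseudo-polynomial time. 3. If $\mathrm{Val}(v)\neq-\infty$ for all $v\in V$, then both players have optimal strategies: Max has a memoryless one, and Min has a finite-memory one whose size is bounded by a polynomial in $|V|$ and $W$. Min may need such memory: for every $W\geq1$ there is a game with three vertices, greatest absolute weight $W$ and only finite values in which no memoryless strategy of Min is optimal and every finite-memory optimal strategy of Min has size at least $W+1$. 4. Assume $V\ne\emptyset$. Let $F$ be the operator on $(\mathbb Z\cup\{-\infty,+\infty\})^V$ with $F(x)(v)=0$ for $v\in T$, and, for $v\notin T$, $F(x)(v)=\max_{(v,v')\in E}(\omega(v,v')+x(v'))$ if $v$ belongs to Max and $F(x)(v)=\min_{(v,v')\in E}(\omega(v,v')+x(v'))$ if $v$ belongs to Min. Then $\mathrm{Val}$ is the greatest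 fixed point of $F$. Value iteration starts from the vector that is $0$ on $T$ and $+\infty$ elsewhere, and repeats: apply $F$, then replace the entries of vertices outside $T$ that are less than $-(|V|-1)W$ by $-\infty$; it stops when the vector does not change. It stops after at most $(2|V|-1)W|V|+2|V|$ iterations, with the vector $\mathrm{Val}$. All values, an optimal memoryless strategy of Max, and, if Min has an optimal strategy, an optimal finite-memory strategy of Min (as the tables of a Moore machine) can be computed in time $O(|V|^2|E|\max(1,W))$. -/

import Mathlib

open scoped Classical

universe u

/-! ### Weighted graphs, strategies, values -/

/-- The set `ℤ ∪ {-∞, +∞}`, a complete linear order. -/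
abbrev Zbar : Type := WithBot (WithTop ℤ)

/-- The embedding of the integers in `ℤ ∪ {-∞, +∞}`. -/
abbrev Zbar.ofInt (k : ℤ) : Zbar := ((k : WithTop ℤ) : WithBot (WithTop ℤ))

/-- Deadlock-free weighted graphs on the vertex set `V`. The vertices of Max are those of `maxV`,
the vertices of Min are the other ones. Only the weights of edges matter. -/
structure WeightedGraph (V : Type*) where
  maxV : Finset V
  edges : Finset (V × V)
  weight : V → V → ℤ
  deadlockFree : ∀ v, ∃ u, (v, u) ∈ edges

namespace WeightedGraph

variable {V : Type*}

/-- The greatest absolute value of the weight of an edge. -/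
def maxWeight (G : WeightedGraph V) : ℕ :=
  G.edges.sup fun e => (G.weight e.1 e.2).natAbs

/-- The successors of a vertex. -/
noncomputable def succ [Fintype V] (G : WeightedGraph V) (v : V) : Finset V :=
  Finset.univ.filter fun u => (v, u) ∈ G.edges

/-- The total payoff of the prefix with `k` edges of a play. -/
def totalPayoff (G : WeightedGraph V) (π : ℕ → V) (k : ℕ) : ℤ :=
  ∑ i ∈ Finset.range k, G.weight (π i) (π (i + 1))

/-- The mean payoff of a play (the quotient `0 / 0` is `0`). -/
noncomputable def meanPayoff (G : WeightedGraph V) (π : ℕ → V) : EReal :=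
  Filter.liminf (fun k : ℕ => (((G.totalPayoff π k : ℝ) / (k : ℝ) : ℝ) : EReal)) Filter.atTop

/-- Strategies of the player that owns the vertices satisfying `own`: `next h v` is the move from
the current vertex `v` when the vertices visited before are those of the list `h`, the most recent
one first. The moves at vertices that are not owned are never used. -/
structure Strategy (G : WeightedGraph V) (own : V → Prop) where
  next : List V → V → V
  valid : ∀ h v, own v → (v, next h v) ∈ G.edges

/-- Strategies of Max. -/
abbrev MaxStrategy (G : WeightedGraph V) : Type _ := G.Strategy fun v => v ∈ G.maxV

/-- Strategies of Min. -/
abbrev MinStrategy (G : WeightedGraph V) : Type _ := G.Strategy fun v => v ∉ G.maxV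

/-- The choice of the strategy depends on the current vertex only. -/
def Strategy.Memoryless {G : WeightedGraph V} {own : V → Prop} (σ : G.Strategy own) : Prop :=
  ∀ h h' v, own v → σ.next h v = σ.next h' v

/-- The memoryless strategy that is given by a table. -/
def Strategy.FollowsTable {G : WeightedGraph V} {own : V → Prop} (σ : G.Strategy own)
    (f : V → V) : Prop :=
  ∀ h v, own v → σ.next h v = f v

/-- History (most recent vertex first) and current vertex after `k` moves. -/
noncomputable def outcomeAux (G : WeightedGraph V) (v : V) (σ : G.MaxStrategy)
    (τ : G.MinStrategy) : ℕ → List V × V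
  | 0 => ([], v)
  | k + 1 =>
    let s := G.outcomeAux v σ τ k
    (s.2 :: s.1, if s.2 ∈ G.maxV then σ.next s.1 s.2 else τ.next s.1 s.2)

/-- The play from `v` that conforms to `σ` and `τ`. -/
noncomputable def outcome (G : WeightedGraph V) (v : V) (σ : G.MaxStrategy)
    (τ : G.MinStrategy) : ℕ → V :=
  fun k => (G.outcomeAux v σ τ k).2

section values

variable {R : Type*} [CompleteLattice R]

/-- The payoff that a strategy of Max guarantees. -/
noncomputable def maxGuarantee (G : WeightedGraph V) (payoff : (ℕ → V) → R) (v : V)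
    (σ : G.MaxStrategy) : R :=
  ⨅ τ : G.MinStrategy, payoff (G.outcome v σ τ)

/-- The payoff that a strategy of Min guarantees. -/
noncomputable def minGuarantee (G : WeightedGraph V) (payoff : (ℕ → V) → R) (v : V)
    (τ : G.MinStrategy) : R :=
  ⨆ σ : G.MaxStrategy, payoff (G.outcome v σ τ)

noncomputable def lowerValue (G : WeightedGraph V) (payoff : (ℕ → V) → R) (v : V) : R :=
  ⨆ σ : G.MaxStrategy, G.maxGuarantee payoff v σ

noncomputable def upperValue (G : WeightedGraph V) (payoff : (ℕ → V) → R) (v : V) : R :=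
  ⨅ τ : G.MinStrategy, G.minGuarantee payoff v τ

end values

end WeightedGraph

/-- Deterministic Moore machines with `K` memory states that read and choose vertices. -/
structure Moore (V : Type*) (K : ℕ) where
  start : Fin K
  update : Fin K → V → Fin K
  decision : Fin K → V → V

namespace Moore

variable {V : Type*} {K : ℕ}

/-- The memory content after a sequence of vertices, given by its last vertex and the list of the
former ones, most recent first. The memory is not updated at the first vertex. -/
def memory (M : Moore V K) : List V → V → Fin K
  | [], _ => M.start
  | u :: h, v => M.update (M.memory h u) v

/-- The strategy is the one that the Moore machine encodes. -/
def Encodes (M : Moore V K) {G : WeightedGraph V} {own : V → Prop} (σ : G.Strategy own) : Prop :=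
  ∀ h v, own v → σ.next h v = M.decision (M.memory h v) v

end Moore

/-! ### Min-cost reachability games -/

/-- Min-cost reachability games: weighted graphs with a set of target vertices. -/
structure MCRGame (V : Type*) extends WeightedGraph V where
  target : Finset V

namespace MCRGame

variable {V : Type*}

/-- The payoff of a play: the total payoff up to the first visit of the target, and `+∞` if the
target is avoided. -/
noncomputable def payoff (G : MCRGame V) (π : ℕ → V) : Zbar :=
  if h : ∃ k, π k ∈ G.target then Zbar.ofInt (G.totalPayoff π (Nat.find h)) else ⊤

/-- The lower value of a vertex in the min-cost reachability game. -/
noncomputable def lower (G : MCRGame V) (v : V) : Zbar := G.lowerValue G.payoff v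

/-- The upper value of a vertex in the min-cost reachability game. -/
noncomputable def upper (G : MCRGame V) (v : V) : Zbar := G.upperValue G.payoff v

/-- The value of a vertex. It is defined as the upper value; that the lower value is the same is
part of the theorem. -/
noncomputable def value (G : MCRGame V) : V → Zbar := G.upper

def OptimalMax (G : MCRGame V) (σ : G.MaxStrategy) : Prop :=
  ∀ v, G.maxGuarantee G.payoff v σ = G.lower v

def OptimalMin (G : MCRGame V) (τ : G.MinStrategy) : Prop :=
  ∀ v, G.minGuarantee G.payoff v τ = G.upper v

variable [Fintype V]

/-- The vertices from which Min can force a visit of the target within `i` moves. -/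
noncomputable def attr (G : MCRGame V) : ℕ → Finset V
  | 0 => G.target
  | i + 1 => G.attr i ∪ Finset.univ.filter fun v =>
      (v ∉ G.maxV ∧ ∃ u ∈ G.succ v, u ∈ G.attr i) ∨ (v ∈ G.maxV ∧ G.succ v ⊆ G.attr i)

/-- The one-step operator. Sets of successors are not empty, so that the supremum and the infimum
are a maximum and a minimum. -/
noncomputable def op (G : MCRGame V) (x : V → Zbar) (v : V) : Zbar :=
  if v ∈ G.target then 0
  else if v ∈ G.maxV then (G.succ v).sup fun u => Zbar.ofInt (G.weight v u) + x u
  else (G.succ v).inf fun u => Zbar.ofInt (G.weight v u) + x u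

/-- The body of the loop of the value iteration algorithm: the one-step operator is applied, then
the values below `-(|V| - 1) W` are replaced by `-∞`. -/
noncomputable def iterStep (G : MCRGame V) (x : V → Zbar) (v : V) : Zbar :=
  if v ∉ G.target ∧ G.op x v < Zbar.ofInt (-(((Fintype.card V : ℤ) - 1) * (G.maxWeight : ℤ)))
  then ⊥ else G.op x v

/-- The vector that the value iteration algorithm holds after `i` iterations of its loop. -/
noncomputable def iter (G : MCRGame V) (i : ℕ) : V → Zbar :=
  G.iterStep^[i] fun v => if v ∈ G.target then 0 else ⊤

end MCRGame

/-! ### A random access machine with step counting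

Programs work on integer arrays (finitely many occur in a program), indexed by integers. Every
evaluation of a node of an expression and every execution of a command costs one step. The only
arithmetic operations are addition and subtraction, so that numbers grow by at most one bit in each
step and polynomial time has the same meaning as for Turing machines. -/

namespace RAM

/-- Contents of the memory: `s a i` is the entry with index `i` of the array `a`. -/
abbrev State : Type := ℕ → ℤ → ℤ

inductive Expr : Type
  | const (c : ℤ) : Expr
  | read (a : ℕ) (i : Expr) : Expr
  | plus (e₁ e₂ : Expr) : Expr
  | minus (e₁ e₂ : Expr) : Expr

def Expr.eval (s : State) : Expr → ℤ
  | .const c => c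
  | .read a i => s a (i.eval s)
  | .plus e₁ e₂ => e₁.eval s + e₂.eval s
  | .minus e₁ e₂ => e₁.eval s - e₂.eval s

def Expr.cost : Expr → ℕ
  | .const _ => 1
  | .read _ i => i.cost + 1
  | .plus e₁ e₂ => e₁.cost + e₂.cost + 1
  | .minus e₁ e₂ => e₁.cost + e₂.cost + 1

inductive Cmd : Type
  | skip : Cmd
  /-- `a[i] := e` -/
  | store (a : ℕ) (i e : Expr) : Cmd
  | seq (c₁ c₂ : Cmd) : Cmd
  /-- if `e₁ ≤ e₂` then `c₁` else `c₂` -/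
  | ifLe (e₁ e₂ : Expr) (c₁ c₂ : Cmd) : Cmd
  /-- while `e₁ ≤ e₂` do `c` -/
  | whileLe (e₁ e₂ : Expr) (c : Cmd) : Cmd

/-- The memory after the assignment `a[i] := x`. -/
def State.set (s : State) (a : ℕ) (i x : ℤ) : State :=
  fun b j => if b = a ∧ j = i then x else s b j

/-- `Exec c s t s'`: the program `c`, started in the memory `s`, halts after `t` steps, with the
memory `s'`. -/
inductive Exec : Cmd → State → ℕ → State → Prop
  | skip (s : State) : Exec .skip s 1 s
  | store (s : State) (a : ℕ) (i e : Expr) :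
      Exec (.store a i e) s (i.cost + e.cost + 1) (s.set a (i.eval s) (e.eval s))
  | seq {c₁ c₂ : Cmd} {s s' s'' : State} {t₁ t₂ : ℕ} :
      Exec c₁ s t₁ s' → Exec c₂ s' t₂ s'' → Exec (.seq c₁ c₂) s (t₁ + t₂ + 1) s''
  | ifTrue {e₁ e₂ : Expr} {c₁ c₂ : Cmd} {s s' : State} {t : ℕ} :
      e₁.eval s ≤ e₂.eval s → Exec c₁ s t s' →
      Exec (.ifLe e₁ e₂ c₁ c₂) s (e₁.cost + e₂.cost + t + 1) s'
  | ifFalse {e₁ e₂ : Expr} {c₁ c₂ : Cmd} {s s' : State} {t : ℕ} :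
      ¬ e₁.eval s ≤ e₂.eval s → Exec c₂ s t s' →
      Exec (.ifLe e₁ e₂ c₁ c₂) s (e₁.cost + e₂.cost + t + 1) s'
  | whileTrue {e₁ e₂ : Expr} {c : Cmd} {s s' s'' : State} {t₁ t₂ : ℕ} :
      e₁.eval s ≤ e₂.eval s → Exec c s t₁ s' → Exec (.whileLe e₁ e₂ c) s' t₂ s'' →
      Exec (.whileLe e₁ e₂ c) s (e₁.cost + e₂.cost + t₁ + t₂ + 1) s''
  | whileFalse {e₁ e₂ : Expr} {c : Cmd} {s : State} :
      ¬ e₁.eval s ≤ e₂.eval s →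
      Exec (.whileLe e₁ e₂ c) s (e₁.cost + e₂.cost + 1) s

/-- The array that holds the entries of a list (from index `0` on) and zeros elsewhere. -/
def listArray (x : List ℤ) (i : ℤ) : ℤ := if 0 ≤ i then x.getD i.toNat 0 else 0

/-- The memory at the start: array `0` holds the input `x` and `1[0]` its length; array `2` holds
the auxiliary input `y` (a certificate, otherwise empty) and `3[0]` its length; the rest is `0`. -/
def startState (x y : List ℤ) : State
  | 0 => listArray x
  | 1 => listArray [(x.length : ℤ)]
  | 2 => listArray y
  | 3 => listArray [(y.length : ℤ)]
  | _ => fun _ => 0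

/-- The output of a program is read from array `0`, its length from `1[0]`. -/
def HasOutput (s : State) (z : List ℤ) : Prop :=
  s 1 0 = (z.length : ℤ) ∧ ∀ i : ℕ, i < z.length → s 0 (i : ℤ) = z.getD i 0

/-- On input `x` with auxiliary input `y`, the program halts within `t` steps with output `z`. -/
def OutputsWithin (c : Cmd) (x y : List ℤ) (t : ℕ) (z : List ℤ) : Prop :=
  ∃ t' s, t' ≤ t ∧ Exec c (startState x y) t' s ∧ HasOutput s z

/-! ### Complexity classes

Problems are sets of instances of a type `α` with an encoding of instances as lists of integers. -/

/-- The size of a list of integers written in binary. -/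
def bitSize (x : List ℤ) : ℕ := (x.map fun z => Nat.size z.natAbs + 1).sum

/-- The size of a list of integers written in unary. -/
def unarySize (x : List ℤ) : ℕ := (x.map fun z => z.natAbs + 1).sum

/-- The answer of a decision procedure. -/
noncomputable def answer (P : Prop) : List ℤ := if P then [1] else [0]

variable {α β : Type*}

/-- The class P. -/
def PolyTime (enc : α → List ℤ) (A : Set α) : Prop :=
  ∃ (c : Cmd) (p : Polynomial ℕ), ∀ a,
    OutputsWithin c (enc a) [] (p.eval (bitSize (enc a))) (answer (a ∈ A))

/-- Decidability in pseudo-polynomial time, i.e. in time polynomial in the size of the instance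
when integers are written in unary. -/
def PseudoPolyTime (enc : α → List ℤ) (A : Set α) : Prop :=
  ∃ (c : Cmd) (p : Polynomial ℕ), ∀ a,
    OutputsWithin c (enc a) [] (p.eval (unarySize (enc a))) (answer (a ∈ A))

/-- The class NP: there is a polynomial-time verifier `c` (with relation `R`) of certificates of
polynomial size. -/
def NP (enc : α → List ℤ) (A : Set α) : Prop :=
  ∃ (c : Cmd) (p q : Polynomial ℕ) (R : α → List ℤ → Prop),
    (∀ a y, bitSize y ≤ q.eval (bitSize (enc a)) →
      OutputsWithin c (enc a) y (p.eval (bitSize (enc a))) (answer (R a y))) ∧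
    ∀ a, a ∈ A ↔ ∃ y, bitSize y ≤ q.eval (bitSize (enc a)) ∧ R a y

/-- The class coNP. -/
def CoNP (enc : α → List ℤ) (A : Set α) : Prop := NP enc Aᶜ

/-- Many-one reducibility in polynomial time. -/
def PolyReducible (encα : α → List ℤ) (encβ : β → List ℤ) (A : Set α) (B : Set β) : Prop :=
  ∃ f : α → β, (∀ a, a ∈ A ↔ f a ∈ B) ∧
    ∃ (c : Cmd) (p : Polynomial ℕ), ∀ a,
      OutputsWithin c (encα a) [] (p.eval (bitSize (encα a))) (encβ (f a))

end RAM

/-! ### Games as inputs of programs -/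

/-- The list of the entries of a table. -/
def tableCode {n m : ℕ} (f : Fin n → Fin m) : List ℤ := List.ofFn fun v => ((f v : ℕ) : ℤ)

/-- The characteristic list of a set. -/
def setCode {n : ℕ} (s : Finset (Fin n)) : List ℤ := List.ofFn fun v => if v ∈ s then 1 else 0

/-- Number of edges, then source, destination and weight of each edge. -/
def edgesCode {n : ℕ} (G : WeightedGraph (Fin n)) (l : List (Fin n × Fin n)) : List ℤ :=
  (l.length : ℤ) ::
    l.flatMap fun e => [((e.1 : ℕ) : ℤ), ((e.2 : ℕ) : ℤ), G.weight e.1 e.2]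

/-- A weighted graph on `{0, …, n - 1}`, with a list of its edges in any order. -/
structure GraphInput where
  n : ℕ
  graph : WeightedGraph (Fin n)
  edgeList : List (Fin n × Fin n)
  nodup : edgeList.Nodup
  mem_edgeList : ∀ e, e ∈ edgeList ↔ e ∈ graph.edges

def GraphInput.code (I : GraphInput) : List ℤ :=
  (I.n : ℤ) :: (setCode I.graph.maxV ++ edgesCode I.graph I.edgeList)

/-- A min-cost reachability game on `{0, …, n - 1}`, with a list of its edges in any order. -/
structure MCRInput where
  n : ℕ
  game : MCRGame (Fin n)
  edgeList : List (Fin n × Fin n)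
  nodup : edgeList.Nodup
  mem_edgeList : ∀ e, e ∈ edgeList ↔ e ∈ game.edges

def MCRInput.code (I : MCRInput) : List ℤ :=
  (I.n : ℤ) :: (setCode I.game.maxV ++ setCode I.game.target ++
    edgesCode I.game.toWeightedGraph I.edgeList)

/-- A min-cost reachability game with a vertex. -/
abbrev MCRInstance : Type := Σ I : MCRInput, Fin I.n

def MCRInstance.code (a : MCRInstance) : List ℤ := ((a.2 : ℕ) : ℤ) :: a.1.code

/-- A mean-payoff game with a vertex. -/
abbrev MPInstance : Type := Σ I : GraphInput, Fin I.n

def MPInstance.code (a : MPInstance) : List ℤ := ((a.2 : ℕ) : ℤ) :: a.1.code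

/-- Is the value of the vertex `+∞`? -/
def ValuePosInf : Set MCRInstance := {a | a.1.game.value a.2 = ⊤}

/-- Is the value of the vertex `-∞`? -/
def ValueNegInf : Set MCRInstance := {a | a.1.game.value a.2 = ⊥}

/-- Is the mean-payoff value of the vertex negative? (Mean-payoff games are determined: the upper
value is the value.) -/
def MeanPayoffNeg : Set MPInstance :=
  {a | a.1.graph.upperValue a.1.graph.meanPayoff a.2 < 0}

/-- Codes of values: `(-1, 0)` for `-∞`, `(0, k)` for the integer `k`, and `(1, 0)` for `+∞`. -/
def Zbar.code : Zbar → List ℤ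
  | none => [-1, 0]
  | some none => [1, 0]
  | some (some k) => [0, k]

/-- The number of memory states, the initial one, then the update and the decision table. -/
def Moore.code {n K : ℕ} (M : Moore (Fin n) K) : List ℤ :=
  [(K : ℤ), ((M.start : ℕ) : ℤ)] ++ (List.ofFn fun m => tableCode (M.update m)).flatten ++
    (List.ofFn fun m => tableCode (M.decision m)).flatten

/-- The output of an algorithm that solves a game: the vector of values, a table with a memoryless
strategy of Max, a Moore machine with a strategy of Min. -/
def solutionCode {n K : ℕ} (x : Fin n → Zbar) (f : Fin n → Fin n) (M : Moore (Fin n) K) :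
    List ℤ :=
  (List.ofFn fun v => (x v).code).flatten ++ tableCode f ++ M.code

/-!
Let `F` be the one-step operator `MCRGame.op`. Starting from `0` on the target and `+∞` elsewhere,
its iterates `MCRGame.horizon i` are the values of the games in which the target has to be reached
within `i` moves. They decrease, and as every vertex has finitely many successors, their limit
`MCRGame.limitVec` is a fixed point of `F`, and thus the greatest one. Max guarantees it by best
moves with respect to it, which is a memoryless strategy (`limitVec_le_maxGuarantee`). Min
guarantees `horizon K` by a Moore machine that counts down from `K - 1` and plays best moves for
the remaining horizon (`minGuarantee_countdown_le`). This gives determinacy.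

If the finite entries of a vector `x ≤ F(x)` have a gap larger than `W`, then the entries below
the gap can be increased by one (`WeightedGraph.IsPotential.lift`). As the greatest fixed point
cannot be increased, its entries are `-∞` or at least `-(|V| - 1) W` (`le_limitVec_of_ne_bot`),
which makes clipping harmless. The entries below `+∞` after `i` iterations are those of the
attractor after `i` steps, and once the attractor has been reached, each of them is `-∞` or lies
between `-(|V| - 1) W` and `|V| W`, is `0` on the target, and can only decrease. This bounds the
number of iterations (`exists_iter_stable`). If all values are above `-∞`, nothing is ever
clipped, so that counting down from this number is optimal for Min. In `memoryGame`, Min has to go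
back and forth more than `W` times, in pairwise different memory states.

Values `-∞` and mean payoffs are both described by potentials on a set `A` of vertices: vectors
with `x v ≤ max (ω(v, u) + x u)` or `x v ≤ min (ω(v, u) + x u)`, according to the owner of `v ∈
A`. A potential for Max bounds the payoff from below while the play stays in `A`. A potential for
Min is a potential of the dual graph, where the roles are exchanged and `w` becomes `-(N w + 1)`;
it makes the payoff decrease linearly. At each vertex of `A`, exactly one of the two exists with
an entry above `-∞`: this is proved by induction on the number of edges (`exists_potential`,
`eq_bot_of_potential_dual`) and takes the place of the theory of mean-payoff games. The
mean-payoff value is negative if and only if there is a potential for Min on all vertices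
(`upperValue_meanPayoff_lt_zero_iff`), and the value is `-∞` if and only if there is one on the
active vertices, i.e. the attractor without the target (`value_eq_bot_iff`). Hence the two
problems are reducible to each other by letting Min leave for a new target before every move, and
by replacing the inactive vertices with loops of weight `0`. Potentials for Min with entries of
polynomial size are certificates for the value `-∞`, the values themselves are certificates
against it.

The algorithms are programs for the random access machine. They are verified by the total
correctness statements `RAM.Runs` with time bounds, for which there is one rule for straight-line
programs, which are evaluated symbolically, and one for `for`-loops. The constants in the time
bounds are generous.
-/

/-! ### Arithmetic of `ℤ ∪ {-∞, +∞}` -/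

namespace Zbar

theorem cases' (x : Zbar) : x = ⊥ ∨ x = ⊤ ∨ ∃ k, x = ofInt k := by
  rcases x with _ | _ | k
  · exact Or.inl rfl
  · exact Or.inr (Or.inl rfl)
  · exact Or.inr (Or.inr ⟨k, rfl⟩)

theorem ofInt_le {a b : ℤ} : ofInt a ≤ ofInt b ↔ a ≤ b := by simp

theorem ofInt_lt {a b : ℤ} : ofInt a < ofInt b ↔ a < b := by simp

theorem ofInt_inj {a b : ℤ} : ofInt a = ofInt b ↔ a = b := by simp

theorem ofInt_ne_top (a : ℤ) : ofInt a ≠ ⊤ := by simp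

theorem ofInt_ne_bot (a : ℤ) : ofInt a ≠ ⊥ := by simp

theorem ofInt_lt_top (a : ℤ) : ofInt a < ⊤ := lt_top_iff_ne_top.2 (ofInt_ne_top a)

theorem bot_lt_ofInt (a : ℤ) : ⊥ < ofInt a := bot_lt_iff_ne_bot.2 (ofInt_ne_bot a)

theorem ofInt_zero : ofInt 0 = 0 := rfl

theorem zero_ne_top : (0 : Zbar) ≠ ⊤ := ofInt_ne_top 0

theorem zero_ne_bot : (0 : Zbar) ≠ ⊥ := ofInt_ne_bot 0

theorem top_ne_bot : (⊤ : Zbar) ≠ ⊥ := by simp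

theorem ofInt_add (a b : ℤ) : ofInt a + ofInt b = ofInt (a + b) := rfl

theorem ofInt_add_top (a : ℤ) : ofInt a + ⊤ = ⊤ := rfl

theorem ofInt_add_bot (a : ℤ) : ofInt a + ⊥ = ⊥ := rfl

theorem exists_ofInt {x : Zbar} (h : x ≠ ⊥) (h' : x ≠ ⊤) : ∃ k, x = ofInt k := by
  rcases cases' x with rfl | rfl | h''
  · exact absurd rfl h
  · exact absurd rfl h'
  · exact h''

theorem ofInt_add_mono (a : ℤ) {x y : Zbar} (h : x ≤ y) : ofInt a + x ≤ ofInt a + y :=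
  add_le_add_right h _

theorem ofInt_add_add (a b : ℤ) (x : Zbar) : ofInt a + (ofInt b + x) = ofInt (a + b) + x := by
  rw [← add_assoc, ofInt_add]

theorem ofInt_zero_add (x : Zbar) : ofInt 0 + x = x := zero_add x

theorem neg_add_cancel_ofInt (a : ℤ) (x : Zbar) : ofInt (-a) + (ofInt a + x) = x := by
  rw [ofInt_add_add, neg_add_cancel, ofInt_zero_add]

theorem add_neg_cancel_ofInt (a : ℤ) (x : Zbar) : ofInt a + (ofInt (-a) + x) = x := by
  rw [ofInt_add_add, add_neg_cancel, ofInt_zero_add]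

theorem ofInt_add_le_iff {a : ℤ} {x y : Zbar} : ofInt a + x ≤ y ↔ x ≤ ofInt (-a) + y :=
  ⟨fun h => by simpa only [neg_add_cancel_ofInt] using ofInt_add_mono (-a) h,
   fun h => by simpa only [add_neg_cancel_ofInt] using ofInt_add_mono a h⟩

theorem le_ofInt_add_iff {a : ℤ} {x y : Zbar} : x ≤ ofInt a + y ↔ ofInt (-a) + x ≤ y := by
  rw [ofInt_add_le_iff, neg_neg]

theorem ofInt_add_lt_iff {a : ℤ} {x y : Zbar} : ofInt a + x < y ↔ x < ofInt (-a) + y := by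
  rw [← not_le, ← not_le, le_ofInt_add_iff]

theorem ofInt_add_lt_top_iff {a : ℤ} {x : Zbar} : ofInt a + x < ⊤ ↔ x < ⊤ := by
  rw [ofInt_add_lt_iff, ofInt_add_top]

theorem ofInt_add_ne_bot_iff {a : ℤ} {x : Zbar} : ofInt a + x ≠ ⊥ ↔ x ≠ ⊥ := by
  rcases cases' x with rfl | rfl | ⟨k, rfl⟩ <;> simp [ofInt_add_top, ofInt_add]

/-- The integer that an element represents; `0` for the infinities. -/
def toInt : Zbar → ℤ
  | none => 0
  | some none => 0
  | some (some k) => k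

theorem toInt_ofInt (k : ℤ) : toInt (ofInt k) = k := rfl

theorem ofInt_toInt {x : Zbar} (h : x ≠ ⊥) (h' : x ≠ ⊤) : ofInt (toInt x) = x := by
  obtain ⟨k, rfl⟩ := exists_ofInt h h'
  rfl

end Zbar

open Zbar (ofInt)

/-! ### Plays -/

namespace WeightedGraph

variable {V : Type*}

theorem outcome_succ_max (G : WeightedGraph V) {v : V} {σ : G.MaxStrategy} {τ : G.MinStrategy}
    {k : ℕ} (h : G.outcome v σ τ k ∈ G.maxV) :
    G.outcome v σ τ (k + 1) = σ.next (G.outcomeAux v σ τ k).1 (G.outcome v σ τ k) :=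
  if_pos h

theorem outcome_succ_min (G : WeightedGraph V) {v : V} {σ : G.MaxStrategy} {τ : G.MinStrategy}
    {k : ℕ} (h : G.outcome v σ τ k ∉ G.maxV) :
    G.outcome v σ τ (k + 1) = τ.next (G.outcomeAux v σ τ k).1 (G.outcome v σ τ k) :=
  if_neg h

theorem outcome_edge (G : WeightedGraph V) (v : V) (σ : G.MaxStrategy) (τ : G.MinStrategy)
    (k : ℕ) : (G.outcome v σ τ k, G.outcome v σ τ (k + 1)) ∈ G.edges := by
  by_cases h : G.outcome v σ τ k ∈ G.maxV
  · rw [outcome_succ_max G h]; exact σ.valid _ _ h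
  · rw [outcome_succ_min G h]; exact τ.valid _ _ h

theorem totalPayoff_zero (G : WeightedGraph V) (π : ℕ → V) : G.totalPayoff π 0 = 0 := rfl

theorem totalPayoff_succ (G : WeightedGraph V) (π : ℕ → V) (k : ℕ) :
    G.totalPayoff π (k + 1) = G.totalPayoff π k + G.weight (π k) (π (k + 1)) :=
  Finset.sum_range_succ _ _

theorem natAbs_weight_le (G : WeightedGraph V) {u v : V} (h : (u, v) ∈ G.edges) :
    (G.weight u v).natAbs ≤ G.maxWeight :=
  Finset.le_sup (f := fun e : V × V => (G.weight e.1 e.2).natAbs) h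

theorem weight_le (G : WeightedGraph V) {u v : V} (h : (u, v) ∈ G.edges) :
    G.weight u v ≤ G.maxWeight := by
  have := G.natAbs_weight_le h; omega

theorem neg_le_weight (G : WeightedGraph V) {u v : V} (h : (u, v) ∈ G.edges) :
    -(G.maxWeight : ℤ) ≤ G.weight u v := by
  have := G.natAbs_weight_le h; omega

theorem mem_succ [Fintype V] (G : WeightedGraph V) {u v : V} :
    u ∈ G.succ v ↔ (v, u) ∈ G.edges := by simp [succ]

theorem succ_nonempty [Fintype V] (G : WeightedGraph V) (v : V) : (G.succ v).Nonempty := by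
  obtain ⟨u, hu⟩ := G.deadlockFree v
  exact ⟨u, G.mem_succ.2 hu⟩

/-- The strategy of the owner given by a table of edges. -/
def tableStrategy (G : WeightedGraph V) (own : V → Prop) (f : V → V)
    (hf : ∀ v, own v → (v, f v) ∈ G.edges) : G.Strategy own where
  next _ v := f v
  valid _ v hv := hf v hv

instance (G : WeightedGraph V) (own : V → Prop) : Nonempty (G.Strategy own) :=
  ⟨G.tableStrategy own (fun v => (G.deadlockFree v).choose) fun v _ =>
    (G.deadlockFree v).choose_spec⟩

section best

variable [Fintype V]

/-- The value of the best move at a vertex for its owner, if a play that continues at `u` is worth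
`x u`. -/
noncomputable def best (G : WeightedGraph V) (x : V → Zbar) (v : V) : Zbar :=
  if v ∈ G.maxV then (G.succ v).sup fun u => ofInt (G.weight v u) + x u
  else (G.succ v).inf fun u => ofInt (G.weight v u) + x u

variable (G : WeightedGraph V) {x : V → Zbar} {v : V}

theorem exists_best (x : V → Zbar) (v : V) :
    ∃ u, (v, u) ∈ G.edges ∧ G.best x v = ofInt (G.weight v u) + x u := by
  unfold best
  split_ifs
  · obtain ⟨u, hu, h⟩ := Finset.exists_mem_eq_sup _ (G.succ_nonempty v)
      (fun u => ofInt (G.weight v u) + x u)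
    exact ⟨u, G.mem_succ.1 hu, h⟩
  · obtain ⟨u, hu, h⟩ := Finset.exists_mem_eq_inf _ (G.succ_nonempty v)
      (fun u => ofInt (G.weight v u) + x u)
    exact ⟨u, G.mem_succ.1 hu, h⟩

theorem le_best_of_max {u : V} (hv : v ∈ G.maxV) (h : (v, u) ∈ G.edges) :
    ofInt (G.weight v u) + x u ≤ G.best x v := by
  rw [best, if_pos hv]
  exact Finset.le_sup (f := fun u => ofInt (G.weight v u) + x u) (G.mem_succ.2 h)

theorem best_le_of_min {u : V} (hv : v ∉ G.maxV) (h : (v, u) ∈ G.edges) :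
    G.best x v ≤ ofInt (G.weight v u) + x u := by
  rw [best, if_neg hv]
  exact Finset.inf_le (f := fun u => ofInt (G.weight v u) + x u) (G.mem_succ.2 h)

theorem le_best_of_forall {c : Zbar} (h : ∀ u, (v, u) ∈ G.edges → c ≤ ofInt (G.weight v u) + x u) :
    c ≤ G.best x v := by
  obtain ⟨u, hu, h'⟩ := G.exists_best x v
  rw [h']; exact h u hu

theorem best_le_of_forall {c : Zbar} (h : ∀ u, (v, u) ∈ G.edges → ofInt (G.weight v u) + x u ≤ c) :
    G.best x v ≤ c := by
  obtain ⟨u, hu, h'⟩ := G.exists_best x v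
  rw [h']; exact h u hu

theorem best_mono {x y : V → Zbar} (h : x ≤ y) (v : V) : G.best x v ≤ G.best y v := by
  by_cases hv : v ∈ G.maxV
  · exact G.best_le_of_forall fun u hu =>
      (Zbar.ofInt_add_mono _ (h u)).trans (G.le_best_of_max hv hu)
  · exact G.le_best_of_forall fun u hu =>
      (G.best_le_of_min hv hu).trans (Zbar.ofInt_add_mono _ (h u))

end best

end WeightedGraph

/-! ### Value iteration without clipping and the greatest fixed point -/

namespace MCRGame

section payoffs

variable {V : Type*} (G : MCRGame V)

theorem lower_le_upper (v : V) : G.lower v ≤ G.upper v :=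
  iSup_le fun σ => le_iInf fun τ =>
    (iInf_le (fun τ => G.payoff (G.outcome v σ τ)) τ).trans
      (le_iSup (fun σ => G.payoff (G.outcome v σ τ)) σ)

theorem payoff_ne_bot (π : ℕ → V) : G.payoff π ≠ ⊥ := by
  unfold payoff
  split_ifs
  · exact Zbar.ofInt_ne_bot _
  · exact Zbar.top_ne_bot

/-- A strategy of Min does not guarantee `-∞`, as no payoff is `-∞`. -/
theorem upper_ne_bot_of_optimalMin {τ : G.MinStrategy} (h : G.OptimalMin τ) (v : V) :
    G.upper v ≠ ⊥ := by
  rw [← h v]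
  intro h'
  obtain ⟨σ⟩ := (inferInstance : Nonempty G.MaxStrategy)
  exact G.payoff_ne_bot (G.outcome v σ τ)
    (le_bot_iff.1 ((le_iSup (fun σ => G.payoff (G.outcome v σ τ)) σ).trans h'.le))

end payoffs

variable {V : Type*} [Fintype V] (G : MCRGame V)

theorem op_eq_best (x : V → Zbar) (v : V) :
    G.op x v = if v ∈ G.target then 0 else G.best x v := rfl

theorem op_target {x : V → Zbar} {v : V} (h : v ∈ G.target) : G.op x v = 0 := if_pos h

theorem op_not_target {x : V → Zbar} {v : V} (h : v ∉ G.target) : G.op x v = G.best x v :=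
  if_neg h

theorem op_mono : Monotone G.op := by
  intro x y h v
  by_cases hv : v ∈ G.target
  · rw [G.op_target hv, G.op_target hv]
  · rw [G.op_not_target hv, G.op_not_target hv]; exact G.best_mono h v

/-- The vector from which value iteration starts. -/
noncomputable def initVec (v : V) : Zbar := if v ∈ G.target then 0 else ⊤

theorem op_le_initVec (x : V → Zbar) : G.op x ≤ G.initVec := by
  intro v
  unfold initVec
  split_ifs with h
  · rw [G.op_target h]
  · exact le_top

/-- The vectors of value iteration without clipping: `G.horizon i v` is the value of the game in
which the target has to be reached within `i` moves. -/
noncomputable def horizon (i : ℕ) : V → Zbar := G.op^[i] G.initVec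

theorem horizon_succ (i : ℕ) : G.horizon (i + 1) = G.op (G.horizon i) :=
  Function.iterate_succ_apply' _ _ _

theorem horizon_antitone : Antitone G.horizon := by
  apply antitone_nat_of_succ_le
  intro i
  induction i with
  | zero => rw [horizon_succ]; exact G.op_le_initVec _
  | succ i ih =>
    rw [G.horizon_succ (i + 1)]
    conv_rhs => rw [G.horizon_succ i]
    exact G.op_mono ih

/-- The limit of value iteration without clipping. -/
noncomputable def limitVec (v : V) : Zbar := ⨅ i, G.horizon i v

theorem limitVec_le (i : ℕ) : G.limitVec ≤ G.horizon i := fun _ => iInf_le _ i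

theorem le_horizon {x : V → Zbar} (h : x ≤ G.op x) (i : ℕ) : x ≤ G.horizon i := by
  induction i with
  | zero => exact h.trans (G.op_le_initVec x)
  | succ i ih => rw [horizon_succ]; exact h.trans (G.op_mono ih)

/-- Post-fixed points of the operator are bounds of the limit from below. -/
theorem le_limitVec {x : V → Zbar} (h : x ≤ G.op x) : x ≤ G.limitVec :=
  fun v => le_iInf fun i => G.le_horizon h i v

/-- The operator need not commute with infinite infima in general; here it does, as a vertex has
finitely many successors and the vectors decrease. -/
theorem limitVec_le_op : G.limitVec ≤ G.op G.limitVec := by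
  intro v
  by_cases ht : v ∈ G.target
  · rw [G.op_target ht]
    refine (G.limitVec_le 1 v).trans ?_
    rw [G.horizon_succ, G.op_target ht]
  rw [G.op_not_target ht]
  by_cases hm : v ∈ G.maxV
  · by_contra! hlt
    -- Since the vectors decrease, finitely many strict inequalities hold from some index on.
    have key : ∀ u : V, ∃ i, (v, u) ∈ G.edges →
        ofInt (G.weight v u) + G.horizon i u < G.limitVec v := by
      intro u
      by_cases hu : (v, u) ∈ G.edges
      · have h1 := (G.le_best_of_max (x := G.limitVec) hm hu).trans_lt hlt
        rw [Zbar.ofInt_add_lt_iff] at h1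
        obtain ⟨i, hi⟩ := iInf_lt_iff.1 h1
        exact ⟨i, fun _ => Zbar.ofInt_add_lt_iff.2 hi⟩
      · exact ⟨0, fun h => absurd h hu⟩
    choose f hf using key
    have : G.horizon (Finset.univ.sup f + 1) v < G.limitVec v := by
      rw [G.horizon_succ, G.op_not_target ht]
      obtain ⟨u, hu, h⟩ := G.exists_best (G.horizon (Finset.univ.sup f)) v
      rw [h]
      exact (Zbar.ofInt_add_mono _ (G.horizon_antitone
        (Finset.le_sup (Finset.mem_univ u)) u)).trans_lt (hf u hu)
    exact absurd (G.limitVec_le _ v) (not_le.2 this)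
  · refine G.le_best_of_forall fun u hu => ?_
    rw [Zbar.le_ofInt_add_iff]
    refine le_iInf fun i => ?_
    rw [← Zbar.le_ofInt_add_iff]
    refine (G.limitVec_le (i + 1) v).trans ?_
    rw [G.horizon_succ, G.op_not_target ht]
    exact G.best_le_of_min hm hu

theorem op_limitVec : G.op G.limitVec = G.limitVec := by
  refine le_antisymm (G.le_limitVec (G.op_mono G.limitVec_le_op)) G.limitVec_le_op

theorem limitVec_target {v : V} (h : v ∈ G.target) : G.limitVec v = 0 := by
  rw [← G.op_limitVec, G.op_target h]

/-! ### Determinacy and optimal strategies -/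

/-- Moves that are best with respect to the limit vector guarantee it: the sum of the payoff so far
and of the entry of the current vertex never decreases. -/
theorem limitVec_le_maxGuarantee (f : V → V) (σ : G.MaxStrategy) (hσ : σ.FollowsTable f)
    (hf : ∀ v ∈ G.maxV, G.best G.limitVec v = ofInt (G.weight v (f v)) + G.limitVec (f v))
    (v : V) : G.limitVec v ≤ G.maxGuarantee G.payoff v σ := by
  refine le_iInf fun τ => ?_
  set π := G.outcome v σ τ with hπ
  have key : ∀ k, (∀ j < k, π j ∉ G.target) →
      G.limitVec v ≤ ofInt (G.totalPayoff π k) + G.limitVec (π k) := by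
    intro k
    induction k with
    | zero => intro _; rw [WeightedGraph.totalPayoff_zero, Zbar.ofInt_zero_add]; rfl
    | succ k ih =>
      intro h
      refine (ih fun j hj => h j (by omega)).trans ?_
      rw [WeightedGraph.totalPayoff_succ, ← Zbar.ofInt_add_add]
      refine Zbar.ofInt_add_mono _ ?_
      have hk := h k (by omega)
      conv_lhs => rw [← G.op_limitVec, G.op_not_target hk]
      by_cases hm : π k ∈ G.maxV
      · have h2 : π (k + 1) = f (π k) :=
          (G.outcome_succ_max hm).trans (hσ _ _ hm)
        rw [h2, hf _ hm]
      · exact G.best_le_of_min hm (G.outcome_edge v σ τ k)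
  unfold payoff
  split_ifs with h
  · have h1 := key (Nat.find h) fun j hj => Nat.find_min h hj
    rw [G.limitVec_target (Nat.find_spec h), ← Zbar.ofInt_zero, Zbar.ofInt_add, add_zero] at h1
    exact h1
  · exact le_top

/-- The machine counts down; in the memory state `i` it plays a best move with respect to the
horizon `i`, and thus guarantees that `G.horizon (i + 1)` is not exceeded. -/
def countdown (K : ℕ) (hK : 0 < K) (ch : ℕ → V → V) : Moore V K where
  start := ⟨K - 1, by omega⟩
  update m _ := ⟨m - 1, by omega⟩
  decision m v := ch m v

/-- As long as the target is not reached, the sum of the payoff so far and of the entry of the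
current vertex for the remaining horizon never increases. If the target is not reached within `K`
moves, the bound is `+∞`, so that it does not matter how the machine goes on. -/
theorem minGuarantee_countdown_le {K : ℕ} (hK : 0 < K) (ch : ℕ → V → V)
    (hch : ∀ i < K, ∀ v ∉ G.maxV, (v, ch i v) ∈ G.edges ∧
      G.best (G.horizon i) v = ofInt (G.weight v (ch i v)) + G.horizon i (ch i v))
    (τ : G.MinStrategy) (hτ : (countdown K hK ch).Encodes τ) (v : V) :
    G.minGuarantee G.payoff v τ ≤ G.horizon K v := by
  refine iSup_le fun σ => ?_
  set π := G.outcome v σ τ with hπ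
  have hmem : ∀ k, (((countdown K hK ch).memory (G.outcomeAux v σ τ k).1 (π k) : Fin K) : ℕ)
      = K - 1 - k := by
    intro k
    induction k with
    | zero => rfl
    | succ k ih =>
      have : (((countdown K hK ch).memory (G.outcomeAux v σ τ (k + 1)).1 (π (k + 1)) : Fin K) : ℕ)
        = ((countdown K hK ch).memory (G.outcomeAux v σ τ k).1 (π k) : Fin K) - 1 := rfl
      rw [this, ih]; omega
  have key : ∀ k ≤ K, (∀ j < k, π j ∉ G.target) →
      ofInt (G.totalPayoff π k) + G.horizon (K - k) (π k) ≤ G.horizon K v := by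
    intro k
    induction k with
    | zero => intro _ _; rw [WeightedGraph.totalPayoff_zero, Zbar.ofInt_zero_add]; rfl
    | succ k ih =>
      intro hkK h
      refine le_trans ?_ (ih (by omega) fun j hj => h j (by omega))
      rw [WeightedGraph.totalPayoff_succ, ← Zbar.ofInt_add_add]
      refine Zbar.ofInt_add_mono _ ?_
      have hk := h k (by omega)
      obtain ⟨i, hi⟩ : ∃ i, K - k = i + 1 := ⟨K - k - 1, by omega⟩
      have hi' : K - (k + 1) = i := by omega
      rw [hi, hi', G.horizon_succ, G.op_not_target hk]
      by_cases hm : π k ∈ G.maxV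
      · exact G.le_best_of_max hm (G.outcome_edge v σ τ k)
      · have h2 : π (k + 1) = ch i (π k) := by
          refine (G.outcome_succ_min hm).trans ((hτ _ _ hm).trans ?_)
          change ch ((countdown K hK ch).memory (G.outcomeAux v σ τ k).1 (π k) : Fin K) (π k) = _
          rw [hmem k]; congr 1; omega
        rw [h2, (hch i (by omega) _ hm).2]
  unfold payoff
  split_ifs with h
  · by_cases hle : Nat.find h ≤ K
    · have h1 := key (Nat.find h) hle fun j hj => Nat.find_min h hj
      have h2 : G.horizon (K - Nat.find h) (π (Nat.find h)) = 0 := by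
        have ht : π (Nat.find h) ∈ G.target := Nat.find_spec h
        cases K - Nat.find h with
        | zero => exact if_pos ht
        | succ i => rw [G.horizon_succ, G.op_target ht]
      rw [h2, ← Zbar.ofInt_zero, Zbar.ofInt_add, add_zero] at h1
      exact h1
    · have h1 := key K le_rfl fun j hj => Nat.find_min h (by omega)
      have h2 : G.horizon (K - K) (π K) = ⊤ := by
        rw [Nat.sub_self]; exact if_neg (Nat.find_min h (by omega))
      rw [h2, Zbar.ofInt_add_top] at h1
      exact le_top.trans h1
  · push Not at h
    have h1 := key K le_rfl fun j _ => h j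
    have h2 : G.horizon (K - K) (π K) = ⊤ := by
      rw [Nat.sub_self]; exact if_neg (h _)
    rwa [h2, Zbar.ofInt_add_top] at h1

/-- The strategy of Min that a machine with legal decisions encodes. -/
def mooreStrategy (G : WeightedGraph V) {K : ℕ} (M : Moore V K)
    (hM : ∀ m, ∀ v ∉ G.maxV, (v, M.decision m v) ∈ G.edges) : G.MinStrategy where
  next h v := M.decision (M.memory h v) v
  valid _ v hv := hM _ v hv

theorem exists_countdown {K : ℕ} (hK : 0 < K) (ch : ℕ → V → V)
    (hch : ∀ i < K, ∀ v ∉ G.maxV, (v, ch i v) ∈ G.edges ∧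
      G.best (G.horizon i) v = ofInt (G.weight v (ch i v)) + G.horizon i (ch i v)) :
    ∃ τ : G.MinStrategy, (countdown K hK ch).Encodes τ ∧
      ∀ v, G.minGuarantee G.payoff v τ ≤ G.horizon K v :=
  ⟨mooreStrategy _ (countdown K hK ch) fun m v hv => (hch m m.2 v hv).1, fun _ _ _ => rfl,
    G.minGuarantee_countdown_le hK ch hch _ fun _ _ _ => rfl⟩

theorem exists_choice : ∃ ch : ℕ → V → V, ∀ i v, (v, ch i v) ∈ G.edges ∧
    G.best (G.horizon i) v = ofInt (G.weight v (ch i v)) + G.horizon i (ch i v) := by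
  choose ch hch using fun i v => G.exists_best (G.horizon i) v
  exact ⟨ch, hch⟩

theorem upper_le_limitVec (v : V) : G.upper v ≤ G.limitVec v := by
  refine le_iInf fun i => ?_
  obtain ⟨ch, hch⟩ := G.exists_choice
  obtain ⟨τ, -, hτ⟩ := G.exists_countdown i.succ_pos ch fun i _ v _ => hch i v
  exact (iInf_le _ τ).trans ((hτ v).trans (G.horizon_antitone i.le_succ v))

/-- A table of best moves with respect to the limit vector is good enough for Max. -/
theorem exists_table_strategy (f : V → V) (hf : ∀ v, (v, f v) ∈ G.edges ∧
    G.best G.limitVec v = ofInt (G.weight v (f v)) + G.limitVec (f v)) :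
    ∃ σ : G.MaxStrategy, σ.FollowsTable f ∧ σ.Memoryless ∧
      ∀ v, G.limitVec v ≤ G.maxGuarantee G.payoff v σ :=
  ⟨G.tableStrategy _ f fun v _ => (hf v).1, fun _ _ _ => rfl, fun _ _ _ _ => rfl,
    G.limitVec_le_maxGuarantee f _ (fun _ _ _ => rfl) fun v _ => (hf v).2⟩

theorem limitVec_le_lower (v : V) : G.limitVec v ≤ G.lower v := by
  choose f hf using fun v => G.exists_best G.limitVec v
  obtain ⟨σ, -, -, hσ⟩ := G.exists_table_strategy f hf
  exact (hσ v).trans (le_iSup (fun σ => G.maxGuarantee G.payoff v σ) σ)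

theorem upper_eq_limitVec (v : V) : G.upper v = G.limitVec v :=
  le_antisymm (G.upper_le_limitVec v) ((G.limitVec_le_lower v).trans (G.lower_le_upper v))

theorem lower_eq_limitVec (v : V) : G.lower v = G.limitVec v :=
  le_antisymm ((G.lower_le_upper v).trans (G.upper_le_limitVec v)) (G.limitVec_le_lower v)

theorem value_eq_limitVec : G.value = G.limitVec := funext G.upper_eq_limitVec

theorem value_isGreatest : IsGreatest {x | G.op x = x} G.value := by
  rw [value_eq_limitVec]
  exact ⟨G.op_limitVec, fun x hx => G.le_limitVec (le_of_eq (Eq.symm hx))⟩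

theorem optimalMax_of_le {σ : G.MaxStrategy} (h : ∀ v, G.limitVec v ≤ G.maxGuarantee G.payoff v σ) :
    G.OptimalMax σ := fun v =>
  le_antisymm (le_iSup (fun σ => G.maxGuarantee G.payoff v σ) σ)
    ((G.lower_eq_limitVec v).le.trans (h v))

theorem optimalMin_of_le {τ : G.MinStrategy} (h : ∀ v, G.minGuarantee G.payoff v τ ≤ G.limitVec v) :
    G.OptimalMin τ := fun v =>
  le_antisymm ((h v).trans (G.upper_eq_limitVec v).ge) (iInf_le _ τ)

end MCRGame

/-! ### Potentials and gaps between their entries -/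

/-- A finite set of integers that reaches from `b` to `a` in less than `|Z|` steps has a gap. -/
theorem exists_gap (W : ℕ) : ∀ (N : ℕ) (Z : Finset ℤ) (a b : ℤ), Z.card = N → a ∈ Z → b ∈ Z →
    b + ((N : ℤ) - 1) * W < a → ∃ z ∈ Z, b ≤ z ∧ z < a ∧ ∀ z' ∈ Z, z' ≤ z ∨ z + W < z' := by
  intro N
  induction N using Nat.strong_induction_on with
  | _ N ih =>
    intro Z a b hN ha hb hlt
    have hpos : 0 < N := hN ▸ Finset.card_pos.2 ⟨a, ha⟩
    have hba : b < a := by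
      have : (0 : ℤ) ≤ ((N : ℤ) - 1) * W := mul_nonneg (by omega) (by omega)
      omega
    by_cases hgap : ∀ z' ∈ Z, z' ≤ b ∨ b + W < z'
    · exact ⟨b, hb, le_rfl, hba, hgap⟩
    · push Not at hgap
      obtain ⟨c, hc, hbc, hcW⟩ := hgap
      have hcard : (Z.filter (b < ·)).card < N :=
        hN ▸ Finset.card_lt_card (Finset.filter_ssubset.2 ⟨b, hb, lt_irrefl b⟩)
      obtain ⟨z, hz, hz1, hz2, hz3⟩ := ih _ hcard (Z.filter (b < ·)) a c rfl
        (Finset.mem_filter.2 ⟨ha, hba⟩) (Finset.mem_filter.2 ⟨hc, hbc⟩) (by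
          have h1 : (((Z.filter (b < ·)).card : ℤ) - 1) * W ≤ ((N : ℤ) - 2) * W :=
            mul_le_mul_of_nonneg_right (by omega) (by omega)
          have h2 : ((N : ℤ) - 1) * W = ((N : ℤ) - 2) * W + W := by ring
          omega)
      refine ⟨z, (Finset.mem_filter.1 hz).1, by omega, hz2, fun z' hz' => ?_⟩
      by_cases h : b < z'
      · exact hz3 z' (Finset.mem_filter.2 ⟨hz', h⟩)
      · left; omega

namespace WeightedGraph

variable {V : Type*}

/-- The potential in which the entries up to `z` are increased by one. -/
noncomputable def lift (z : ℤ) (x : V → Zbar) (v : V) : Zbar :=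
  if x v ≤ ofInt z then ofInt 1 + x v else x v

theorem le_lift (z : ℤ) (x : V → Zbar) : x ≤ lift z x := by
  intro v
  unfold lift
  split_ifs
  · conv_lhs => rw [← Zbar.ofInt_zero_add (x v)]
    exact add_le_add_left (Zbar.ofInt_le.2 (by norm_num)) _
  · exact le_rfl

variable [Fintype V] (G : WeightedGraph V)

/-- Potentials on the set `A`: as long as the play stays in `A`, Max can keep the sum of the payoff
so far and of the potential of the current vertex from decreasing. -/
def IsPotential (A : Set V) (x : V → Zbar) : Prop := ∀ v ∈ A, x v ≤ G.best x v

variable {G}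

/-- Entries below a gap that is larger than all weights can be lifted. -/
theorem IsPotential.lift {A : Set V} {x : V → Zbar} (h : G.IsPotential A x) {z : ℤ}
    (hz : ∀ v k, x v = ofInt k → k ≤ z ∨ z + G.maxWeight < k) :
    G.IsPotential A (WeightedGraph.lift z x) := by
  have key : ∀ v u, (v, u) ∈ G.edges → x v ≤ ofInt (G.weight v u) + x u →
      WeightedGraph.lift z x v ≤ ofInt (G.weight v u) + WeightedGraph.lift z x u := by
    intro v u hvu hle
    have hW := G.weight_le hvu
    have hW' := G.neg_le_weight hvu
    by_cases hv : x v ≤ ofInt z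
    · by_cases hu : x u ≤ ofInt z
      · simp only [WeightedGraph.lift, if_pos hv, if_pos hu]
        refine (Zbar.ofInt_add_mono 1 hle).trans (le_of_eq ?_)
        rw [Zbar.ofInt_add_add, Zbar.ofInt_add_add, add_comm (1 : ℤ)]
      · simp only [WeightedGraph.lift, if_pos hv, if_neg hu]
        rcases Zbar.cases' (x u) with h' | h' | ⟨k, h'⟩
        · rw [h'] at hu; exact absurd bot_le hu
        · rw [h', Zbar.ofInt_add_top]; exact le_top
        · rw [h'] at hu ⊢
          have hk : z + G.maxWeight < k := (hz u k h').resolve_left fun h => hu (Zbar.ofInt_le.2 h)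
          refine (Zbar.ofInt_add_mono 1 hv).trans ?_
          rw [Zbar.ofInt_add, Zbar.ofInt_add, Zbar.ofInt_le]
          omega
    · have : WeightedGraph.lift z x v = x v := if_neg hv
      rw [this]
      exact hle.trans (Zbar.ofInt_add_mono _ (le_lift z x u))
  intro v hv
  by_cases hm : v ∈ G.maxV
  · obtain ⟨u, hu, h'⟩ := G.exists_best x v
    exact (key v u hu (h' ▸ h v hv)).trans (G.le_best_of_max hm hu)
  · exact G.le_best_of_forall fun u hu =>
      key v u hu ((h v hv).trans (G.best_le_of_min hm hu))

/-- The finite entries of a vector. -/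
noncomputable def finiteEntries (x : V → Zbar) : Finset ℤ :=
  (Finset.univ.filter fun v => x v ≠ ⊥ ∧ x v ≠ ⊤).image fun v => (x v).toInt

theorem mem_finiteEntries {x : V → Zbar} {k : ℤ} :
    k ∈ finiteEntries x ↔ ∃ v, x v = ofInt k := by
  simp only [finiteEntries, Finset.mem_image, Finset.mem_filter, Finset.mem_univ, true_and]
  constructor
  · rintro ⟨v, ⟨h1, h2⟩, rfl⟩
    exact ⟨v, (Zbar.ofInt_toInt h1 h2).symm⟩
  · rintro ⟨v, h⟩
    exact ⟨v, by rw [h]; exact ⟨Zbar.ofInt_ne_bot k, Zbar.ofInt_ne_top k⟩, by rw [h]; rfl⟩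

theorem card_finiteEntries_le (x : V → Zbar) : (finiteEntries x).card ≤ Fintype.card V :=
  Finset.card_image_le.trans (Finset.card_le_univ _)

/-- If the finite entries are spread too far, then there is a gap, below which one can lift. -/
theorem exists_lift_gap (x : V → Zbar) {v t : V} {a b : ℤ} (W : ℕ) (hv : x v = ofInt b)
    (ht : x t = ofInt a) (h : b + ((Fintype.card V : ℤ) - 1) * W < a) :
    ∃ z < a, (∃ u, x u = ofInt z) ∧ ∀ u k, x u = ofInt k → k ≤ z ∨ z + W < k := by
  obtain ⟨z, hz, -, hza, hgap⟩ := exists_gap W _ (finiteEntries x) a b rfl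
    (mem_finiteEntries.2 ⟨t, ht⟩) (mem_finiteEntries.2 ⟨v, hv⟩) (by
      have h1 : (((finiteEntries x).card : ℤ) - 1) * W ≤ ((Fintype.card V : ℤ) - 1) * W :=
        mul_le_mul_of_nonneg_right (by have := card_finiteEntries_le x; omega) (by omega)
      omega)
  exact ⟨z, hza, mem_finiteEntries.1 hz, fun u k hu => hgap k (mem_finiteEntries.2 ⟨u, hu⟩)⟩

end WeightedGraph

namespace MCRGame

variable {V : Type*} [Fintype V] (G : MCRGame V)

theorem le_op_of_isPotential {x : V → Zbar} (hT : ∀ t ∈ G.target, x t ≤ 0)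
    (h : G.IsPotential {v | v ∉ G.target} x) : x ≤ G.op x := by
  intro v
  by_cases hv : v ∈ G.target
  · rw [G.op_target hv]; exact hT v hv
  · rw [G.op_not_target hv]; exact h v hv

theorem isPotential_of_le_op {x : V → Zbar} (h : x ≤ G.op x) :
    G.IsPotential {v | v ∉ G.target} x := fun v hv => by
  have := h v
  rwa [G.op_not_target hv] at this

theorem limitVec_eq_top_of_target_eq_empty (h : ∀ v, v ∉ G.target) (v : V) :
    G.limitVec v = ⊤ := by
  refine top_le_iff.1 (G.le_limitVec (x := fun _ => ⊤) (fun w => ?_) v)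
  rw [G.op_not_target (h w)]
  exact G.le_best_of_forall fun u _ => by rw [Zbar.ofInt_add_top]

/-- Values above `-∞` are at least `-(|V| - 1) W`. Otherwise, the values have a gap below `0` that
is larger than all weights, and the values below the gap could be lifted. -/
theorem le_limitVec_of_ne_bot {v : V} (h : G.limitVec v ≠ ⊥) :
    ofInt (-(((Fintype.card V : ℤ) - 1) * (G.maxWeight : ℤ))) ≤ G.limitVec v := by
  by_contra! hlt
  obtain ⟨b, hb⟩ := Zbar.exists_ofInt h (hlt.trans (Zbar.ofInt_lt_top _)).ne
  by_cases hT : ∀ t, t ∉ G.target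
  · exact Zbar.ofInt_ne_top b (hb.symm.trans (G.limitVec_eq_top_of_target_eq_empty hT v))
  push Not at hT
  obtain ⟨t, ht⟩ := hT
  rw [hb, Zbar.ofInt_lt] at hlt
  obtain ⟨z, hz0, ⟨u, hu⟩, hgap⟩ := WeightedGraph.exists_lift_gap G.limitVec G.maxWeight hb
    (G.limitVec_target ht) (by omega)
  have hpot := (G.isPotential_of_le_op G.limitVec_le_op).lift hgap
  have hle := G.le_limitVec (G.le_op_of_isPotential (fun t ht => by
    have h0 : ¬ G.limitVec t ≤ ofInt z := by
      rw [G.limitVec_target ht, ← Zbar.ofInt_zero, Zbar.ofInt_le]; omega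
    rw [WeightedGraph.lift, if_neg h0, G.limitVec_target ht]) hpot) u
  rw [WeightedGraph.lift, hu, if_pos le_rfl, Zbar.ofInt_add, Zbar.ofInt_le] at hle
  omega

/-! ### The attractor -/

theorem target_subset_attr (i : ℕ) : G.target ⊆ G.attr i := by
  induction i with
  | zero => exact subset_rfl
  | succ i ih => exact ih.trans Finset.subset_union_left

theorem attr_mono : Monotone G.attr :=
  monotone_nat_of_le_succ fun _ => Finset.subset_union_left

theorem mem_attr_succ {i : ℕ} {v : V} : v ∈ G.attr (i + 1) ↔ v ∈ G.target ∨
    (v ∉ G.maxV ∧ ∃ u ∈ G.succ v, u ∈ G.attr i) ∨ (v ∈ G.maxV ∧ G.succ v ⊆ G.attr i) := by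
  have hdef : ∀ i, v ∈ G.attr (i + 1) ↔ v ∈ G.attr i ∨
      ((v ∉ G.maxV ∧ ∃ u ∈ G.succ v, u ∈ G.attr i) ∨ (v ∈ G.maxV ∧ G.succ v ⊆ G.attr i)) := by
    intro i; simp [attr]
  induction i with
  | zero => exact hdef 0
  | succ i ih =>
    refine (hdef (i + 1)).trans ((or_congr_left ih).trans ?_)
    have hm := G.attr_mono i.le_succ
    constructor
    · rintro ((h | ⟨h, u, hu, hu'⟩ | ⟨h, h'⟩) | h)
      · exact Or.inl h
      · exact Or.inr (Or.inl ⟨h, u, hu, hm hu'⟩)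
      · exact Or.inr (Or.inr ⟨h, h'.trans hm⟩)
      · exact Or.inr h
    · rintro (h | h)
      · exact Or.inl (Or.inl h)
      · exact Or.inr h

theorem attr_eq_of_le {i : ℕ} (h : Fintype.card V ≤ i) : G.attr i = G.attr (Fintype.card V) := by
  refine (Finset.eq_of_subset_of_card_le (G.attr_mono h) (le_of_eq ?_)).symm
  refine Nat.stabilises_of_monotone (f := fun i => (G.attr i).card)
    (fun i j hij => Finset.card_le_card (G.attr_mono hij)) (fun i => Finset.card_le_univ _)
    (fun i hi => ?_) h
  have h1 : G.attr i = G.attr (i + 1) :=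
    Finset.eq_of_subset_of_card_le (G.attr_mono i.le_succ) (le_of_eq hi.symm)
  have h2 : G.attr (i + 1) = G.attr (i + 2) := by
    ext v
    rw [G.mem_attr_succ, G.mem_attr_succ, h1]
  simp only [h2]

/-! ### Value iteration with clipping -/

/-- The one-step operator, followed by the replacement of the values below `θ` by `-∞`. -/
noncomputable def clipStep (θ : ℤ) (x : V → Zbar) (v : V) : Zbar :=
  if v ∉ G.target ∧ G.op x v < ofInt θ then ⊥ else G.op x v

theorem clipStep_le_op (θ : ℤ) (x : V → Zbar) : G.clipStep θ x ≤ G.op x := by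
  intro v
  unfold clipStep
  split_ifs
  · exact bot_le
  · exact le_rfl

theorem clipStep_lt_top {θ : ℤ} {x : V → Zbar} {v : V} :
    G.clipStep θ x v < ⊤ ↔ G.op x v < ⊤ := by
  unfold clipStep
  split_ifs with h
  · exact ⟨fun _ => h.2.trans (Zbar.ofInt_lt_top _), fun _ => bot_lt_iff_ne_bot.2 Zbar.top_ne_bot⟩
  · exact Iff.rfl

theorem clipStep_mono (θ : ℤ) : Monotone (G.clipStep θ) := by
  intro x y h v
  have h' := G.op_mono h v
  unfold clipStep
  by_cases hy : v ∉ G.target ∧ G.op y v < ofInt θ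
  · rw [if_pos hy, if_pos ⟨hy.1, h'.trans_lt hy.2⟩]
  · rw [if_neg hy]
    split_ifs
    · exact bot_le
    · exact h'

theorem clipStep_target {θ : ℤ} {x : V → Zbar} {t : V} (ht : t ∈ G.target) :
    G.clipStep θ x t = 0 := by
  rw [clipStep, if_neg (fun h => h.1 ht), G.op_target ht]

theorem op_lt_top_iff {x : V → Zbar} {v : V} : G.op x v < ⊤ ↔ v ∈ G.target ∨
    (v ∉ G.maxV ∧ ∃ u ∈ G.succ v, x u < ⊤) ∨ (v ∈ G.maxV ∧ ∀ u ∈ G.succ v, x u < ⊤) := by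
  by_cases ht : v ∈ G.target
  · simp [G.op_target ht, ht, lt_top_iff_ne_top, Zbar.zero_ne_top]
  rw [G.op_not_target ht]
  obtain ⟨u, hu, hb⟩ := G.exists_best x v
  by_cases hm : v ∈ G.maxV
  · simp only [ht, hm, false_or, not_true, false_and, true_and]
    constructor
    · intro h w hw
      exact Zbar.ofInt_add_lt_top_iff.1 ((G.le_best_of_max hm (G.mem_succ.1 hw)).trans_lt h)
    · intro h
      rw [hb, Zbar.ofInt_add_lt_top_iff]
      exact h u (G.mem_succ.2 hu)
  · simp only [ht, hm, false_or, not_false_iff, false_and, true_and, or_false]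
    constructor
    · intro h
      exact ⟨u, G.mem_succ.2 hu, Zbar.ofInt_add_lt_top_iff.1 (hb ▸ h)⟩
    · rintro ⟨w, hw, h⟩
      exact (G.best_le_of_min hm (G.mem_succ.1 hw)).trans_lt (Zbar.ofInt_add_lt_top_iff.2 h)

/-- After `i` steps, with any clipping, the entries below `+∞` are those of the attractor. -/
theorem clipStep_iterate_lt_top {θ : ℤ} {i : ℕ} {v : V} :
    ((G.clipStep θ)^[i] G.initVec) v < ⊤ ↔ v ∈ G.attr i := by
  induction i generalizing v with
  | zero =>
    by_cases h : v ∈ G.target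
    · simp [initVec, attr, h, lt_top_iff_ne_top, Zbar.zero_ne_top]
    · simp [initVec, attr, h]
  | succ i ih =>
    rw [Function.iterate_succ_apply', G.clipStep_lt_top, op_lt_top_iff, mem_attr_succ]
    simp only [ih, Finset.subset_iff]

/-- The clipping bound of the value iteration algorithm. -/
noncomputable def bound : ℤ := -(((Fintype.card V : ℤ) - 1) * (G.maxWeight : ℤ))

theorem iter_eq (i : ℕ) : G.iter i = (G.clipStep G.bound)^[i] G.initVec := rfl

theorem iter_succ (i : ℕ) : G.iter (i + 1) = G.clipStep G.bound (G.iter i) :=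
  Function.iterate_succ_apply' _ _ _

theorem iter_lt_top {i : ℕ} {v : V} : G.iter i v < ⊤ ↔ v ∈ G.attr i := G.clipStep_iterate_lt_top

theorem iter_antitone : Antitone G.iter := by
  apply antitone_nat_of_succ_le
  intro i
  induction i with
  | zero => rw [iter_succ]; exact (G.clipStep_le_op _ _).trans (G.op_le_initVec _)
  | succ i ih =>
    rw [G.iter_succ (i + 1)]
    conv_rhs => rw [G.iter_succ i]
    exact G.clipStep_mono _ ih

/-- Clipping does not affect the limit vector, as its entries above `-∞` are not below the bound. -/
theorem le_clipStep_limitVec : G.limitVec ≤ G.clipStep G.bound G.limitVec := by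
  intro v
  unfold clipStep
  rw [G.op_limitVec]
  split_ifs with h
  · by_contra h'
    exact absurd (G.le_limitVec_of_ne_bot fun h0 => h' h0.le) (not_le.2 h.2)
  · exact le_rfl

theorem limitVec_le_iter (i : ℕ) : G.limitVec ≤ G.iter i := by
  induction i with
  | zero => exact G.limitVec_le 0
  | succ i ih =>
    rw [G.iter_succ]
    exact G.le_clipStep_limitVec.trans (G.clipStep_mono _ ih)

theorem iter_eq_limitVec {i : ℕ} (h : G.iter (i + 1) = G.iter i) : G.iter i = G.limitVec := by
  refine le_antisymm (G.le_limitVec ?_) (G.limitVec_le_iter i)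
  conv_lhs => rw [← h, G.iter_succ]
  exact G.clipStep_le_op _ _

theorem iter_eq_of_le {i j : ℕ} (h : G.iter (i + 1) = G.iter i) (hij : i ≤ j) :
    G.iter j = G.limitVec :=
  le_antisymm ((G.iter_antitone hij).trans (G.iter_eq_limitVec h).le) (G.limitVec_le_iter j)

theorem iter_le_of_mem_attr {i : ℕ} {v : V} (h : v ∈ G.attr i) :
    G.iter i v ≤ ofInt (i * G.maxWeight) := by
  induction i generalizing v with
  | zero =>
    have h0 : G.iter 0 v = 0 := if_pos h
    rw [h0]; simp
  | succ i ih =>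
    by_cases ht : v ∈ G.target
    · rw [G.iter_succ, G.clipStep_target ht, ← Zbar.ofInt_zero, Zbar.ofInt_le]; positivity
    have hstep : ∀ u, (v, u) ∈ G.edges → u ∈ G.attr i →
        ofInt (G.weight v u) + G.iter i u ≤ ofInt ((i + 1 : ℕ) * G.maxWeight) := by
      intro u hu hu'
      refine (Zbar.ofInt_add_mono _ (ih hu')).trans ?_
      rw [Zbar.ofInt_add, Zbar.ofInt_le]
      have := G.weight_le hu
      push_cast; linarith
    rw [G.iter_succ]
    refine (G.clipStep_le_op _ _ v).trans ?_
    rw [G.op_not_target ht]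
    rcases (G.mem_attr_succ.1 h).resolve_left ht with ⟨hm, u, hu, hu'⟩ | ⟨hm, hs⟩
    · exact (G.best_le_of_min hm (G.mem_succ.1 hu)).trans (hstep u (G.mem_succ.1 hu) hu')
    · exact G.best_le_of_forall fun u hu => hstep u hu (hs (G.mem_succ.2 hu))

theorem bound_le_iter {i : ℕ} {v : V} (hv : v ∉ G.target) (h : G.iter i v ≠ ⊥) :
    ofInt G.bound ≤ G.iter i v := by
  cases i with
  | zero =>
    have h0 : G.iter 0 v = ⊤ := if_neg hv
    rw [h0]; exact le_top
  | succ i =>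
    rw [G.iter_succ] at h ⊢
    unfold clipStep at h ⊢
    split_ifs at h ⊢ with h'
    · exact absurd rfl h
    · exact not_lt.1 fun h'' => h' ⟨hv, h''⟩

/-- The number of times that an entry below `+∞` of a vertex outside the target can still change. -/
noncomputable def rank (x : Zbar) : ℕ := if x = ⊥ then 0 else (x.toInt - G.bound).toNat + 1

/-- The number of iterations after which value iteration has stopped. -/
def iterBound (n W : ℕ) : ℕ := (2 * n - 1) * W * n + 2 * n

/-- After `|V|` iterations, the entries below `+∞` are those of the attractor. From then on, the sum
of the ranks over the attractor without the target decreases until the vector is stable. -/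
theorem exists_iter_stable [Nonempty V] : ∃ i, Fintype.card V ≤ i ∧
    i + 1 ≤ iterBound (Fintype.card V) G.maxWeight ∧ G.iter (i + 1) = G.iter i := by
  set n := Fintype.card V with hn
  set W := G.maxWeight with hW
  have hn0 : 0 < n := Fintype.card_pos
  set D := G.attr n \ G.target with hD
  set Φ : ℕ → ℕ := fun i => ∑ v ∈ D, G.rank (G.iter i v) with hΦ
  by_contra! hne
  have hattr : ∀ i, n ≤ i → ∀ v ∈ D, G.iter i v < ⊤ := fun i hi v hv => by
    rw [G.iter_lt_top, G.attr_eq_of_le hi]; exact (Finset.mem_sdiff.1 hv).1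
  have hrank : ∀ i, n ≤ i → ∀ v ∈ D, G.rank (G.iter (i + 1) v) ≤ G.rank (G.iter i v) ∧
      (G.rank (G.iter (i + 1) v) = G.rank (G.iter i v) → G.iter (i + 1) v = G.iter i v) := by
    intro i hi v hv
    have hle := G.iter_antitone i.le_succ v
    have hvt := (Finset.mem_sdiff.1 hv).2
    by_cases hb1 : G.iter (i + 1) v = ⊥
    · rw [hb1]
      refine ⟨by simp [rank], fun h => ?_⟩
      by_contra hb
      simp [rank, Ne.symm hb] at h
    · have hb0 : G.iter i v ≠ ⊥ := fun h => hb1 (le_bot_iff.1 (h ▸ hle))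
      have h1 := G.bound_le_iter hvt hb1
      obtain ⟨a, ha⟩ := Zbar.exists_ofInt hb1 (hattr (i + 1) (by omega) v hv).ne
      obtain ⟨b, hb⟩ := Zbar.exists_ofInt hb0 (hattr i hi v hv).ne
      rw [Nat.succ_eq_add_one, ha, hb, Zbar.ofInt_le] at hle
      rw [ha, Zbar.ofInt_le] at h1
      simp only [rank, ha, hb, Zbar.ofInt_ne_bot, if_false, Zbar.toInt_ofInt, Zbar.ofInt_inj]
      omega
  have hdec : ∀ i, n ≤ i → i + 1 ≤ iterBound n W → Φ (i + 1) + 1 ≤ Φ i := by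
    intro i hi hi'
    have hne' := hne i hi hi'
    refine Finset.sum_lt_sum (fun v hv => (hrank i hi v hv).1) ?_
    by_contra! hall
    refine hne' (funext fun v => ?_)
    by_cases hvt : v ∈ G.target
    · have h0 : ∀ j, G.iter j v = 0 := fun j => by
        cases j with
        | zero => exact if_pos hvt
        | succ j => rw [G.iter_succ, G.clipStep_target hvt]
      rw [h0, h0]
    by_cases hva : v ∈ G.attr n
    · have hv : v ∈ D := Finset.mem_sdiff.2 ⟨hva, hvt⟩
      exact (hrank i hi v hv).2 (le_antisymm (hrank i hi v hv).1 (hall v hv))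
    · have h0 : ∀ j, n ≤ j → G.iter j v = ⊤ := fun j hj => by
        by_contra h
        rw [← ne_eq, ← lt_top_iff_ne_top, G.iter_lt_top, G.attr_eq_of_le hj] at h
        exact hva h
      rw [h0 _ (by omega), h0 _ hi]
  have hdown : ∀ k, n + k ≤ iterBound n W → Φ (n + k) + k ≤ Φ n := by
    intro k
    induction k with
    | zero => intro _; exact le_rfl
    | succ k ih =>
      intro hk
      have h1 := ih (by omega)
      have h2 := hdec (n + k) (by omega) (by omega)
      rw [show n + (k + 1) = n + k + 1 from rfl]
      omega
  have hΦn : Φ n ≤ D.card * ((2 * n - 1) * W + 1) := by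
    rw [← smul_eq_mul]
    refine Finset.sum_le_card_nsmul _ _ _ fun v hv => ?_
    have hva := (Finset.mem_sdiff.1 hv).1
    have hle := G.iter_le_of_mem_attr hva
    by_cases hb : G.iter n v = ⊥
    · simp [rank, hb]
    obtain ⟨a, ha⟩ := Zbar.exists_ofInt hb (hattr n le_rfl v hv).ne
    rw [ha, Zbar.ofInt_le] at hle
    simp only [rank, ha, Zbar.ofInt_ne_bot, if_false, Zbar.toInt_ofInt, bound]
    rw [← hn, ← hW] at *
    have hsub : ((2 * n - 1 : ℕ) : ℤ) = 2 * n - 1 := by omega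
    zify
    rw [hsub]
    have : ((a - -(((n : ℤ) - 1) * W)).toNat : ℤ) ≤ (2 * n - 1) * W := by
      rw [Int.ofNat_toNat]
      refine max_le (by linarith) (mul_nonneg (by omega) (by omega))
    linarith
  -- At most `n - 1` entries can change: if the target is empty, then so is the attractor.
  have hcard : D.card ≤ n - 1 := by
    by_cases hT : G.target.Nonempty
    · have h1 : D.card = (G.attr n).card - G.target.card :=
        Finset.card_sdiff_of_subset (G.target_subset_attr n)
      have h2 : (G.attr n).card ≤ n := Finset.card_le_univ _
      have h3 := hT.card_pos
      omega
    · rw [Finset.not_nonempty_iff_eq_empty] at hT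
      have hempty : ∀ i, G.attr i = ∅ := by
        intro i
        induction i with
        | zero => exact hT
        | succ i ih =>
          rw [Finset.eq_empty_iff_forall_notMem]
          intro v hv
          rw [G.mem_attr_succ, hT, ih] at hv
          have := G.succ_nonempty v
          rcases hv with h | ⟨-, u, -, h⟩ | ⟨-, h⟩
          · simp at h
          · simp at h
          · exact this.ne_empty (Finset.subset_empty.1 h)
      rw [hD, hempty]; simp
  have hexp : ∀ n W : ℕ, 0 < n → (n - 1) * ((2 * n - 1) * W + 1) + n + 1 ≤ iterBound n W := by
    intro n W hn
    obtain ⟨k, rfl⟩ : ∃ k, n = k + 1 := ⟨n - 1, by omega⟩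
    have h1 : k + 1 - 1 = k := rfl
    unfold iterBound
    rw [h1]
    nlinarith [Nat.zero_le ((2 * (k + 1) - 1) * W)]
  have h0 := hexp n W hn0
  have h1 := hdown (iterBound n W - n) (by omega)
  have h2 : D.card * ((2 * n - 1) * W + 1) ≤ (n - 1) * ((2 * n - 1) * W + 1) :=
    Nat.mul_le_mul_right _ hcard
  omega

theorem iter_iterBound [Nonempty V] {j : ℕ}
    (hj : iterBound (Fintype.card V) G.maxWeight ≤ j + 1) : G.iter j = G.limitVec := by
  obtain ⟨i, -, hi, h⟩ := G.exists_iter_stable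
  exact G.iter_eq_of_le h (by omega)

theorem value_eq_top_iff {v : V} : G.value v = ⊤ ↔ v ∉ G.attr (Fintype.card V) := by
  have : Nonempty V := ⟨v⟩
  obtain ⟨i, hni, -, h⟩ := G.exists_iter_stable
  rw [value_eq_limitVec, ← G.iter_eq_limitVec h, ← not_iff_not, not_not, ← G.attr_eq_of_le hni,
    ← G.iter_lt_top, lt_top_iff_ne_top]

/-- If all values are above `-∞`, then nothing is ever clipped. -/
theorem iter_eq_horizon (h : ∀ v, G.limitVec v ≠ ⊥) (i : ℕ) : G.iter i = G.horizon i := by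
  induction i with
  | zero => rfl
  | succ i ih =>
    rw [G.iter_succ, G.horizon_succ, ih]
    funext v
    unfold clipStep
    refine if_neg fun h' => ?_
    have h1 := G.limitVec_le (i + 1) v
    rw [G.horizon_succ] at h1
    exact absurd ((G.le_limitVec_of_ne_bot (h v)).trans h1) (not_le.2 h'.2)

/-- The machine that counts down from any large enough horizon is optimal for Min. -/
theorem exists_optimal_countdown (h : ∀ v, G.limitVec v ≠ ⊥) {K : ℕ} (hK : 0 < K)
    (hK' : G.iter K = G.limitVec) (ch : ℕ → V → V)
    (hch : ∀ i < K, ∀ v, (v, ch i v) ∈ G.edges ∧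
      G.best (G.iter i) v = ofInt (G.weight v (ch i v)) + G.iter i (ch i v)) :
    ∃ τ : G.MinStrategy, (countdown K hK ch).Encodes τ ∧ G.OptimalMin τ := by
  obtain ⟨τ, h1, h2⟩ := G.exists_countdown hK ch fun i hi v _ => by
    rw [← G.iter_eq_horizon h]; exact hch i hi v
  refine ⟨τ, h1, G.optimalMin_of_le fun v => ?_⟩
  rw [← hK', G.iter_eq_horizon h]
  exact h2 v

theorem exists_optimal_strategies :
    ∃ p : Polynomial ℕ, ∀ (V : Type u) [Fintype V] (G : MCRGame V), (∀ v, G.value v ≠ ⊥) →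
        (∃ σ : G.MaxStrategy, σ.Memoryless ∧ G.OptimalMax σ) ∧
        (∃ K ≤ p.eval (Fintype.card V + G.maxWeight), ∃ (M : Moore V K) (τ : G.MinStrategy),
          M.Encodes τ ∧ G.OptimalMin τ) := by
  refine ⟨2 * Polynomial.X ^ 3 + 2 * Polynomial.X + 1, fun V _ G hv => ⟨?_, ?_⟩⟩
  · choose f hf using fun v => G.exists_best G.limitVec v
    obtain ⟨σ, -, h1, h2⟩ := G.exists_table_strategy f hf
    exact ⟨σ, h1, G.optimalMax_of_le h2⟩
  · obtain ⟨ch, hch⟩ : ∃ ch : ℕ → V → V, ∀ i v, (v, ch i v) ∈ G.edges ∧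
        G.best (G.iter i) v = ofInt (G.weight v (ch i v)) + G.iter i (ch i v) := by
      choose ch hch using fun i v => G.exists_best (G.iter i) v
      exact ⟨ch, hch⟩
    rw [value_eq_limitVec] at hv
    set K := iterBound (Fintype.card V) G.maxWeight + 1 with hK
    have hstable : G.iter K = G.limitVec := by
      rcases isEmpty_or_nonempty V with _ | _
      · exact funext fun v => isEmptyElim v
      · exact G.iter_iterBound (by omega)
    obtain ⟨τ, h1, h2⟩ := G.exists_optimal_countdown hv (Nat.succ_pos _) hstable ch
      fun i _ v => hch i v
    refine ⟨K, ?_, _, τ, h1, h2⟩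
    simp only [hK, iterBound, Polynomial.eval_add, Polynomial.eval_mul, Polynomial.eval_pow,
      Polynomial.eval_X, Polynomial.eval_ofNat, Polynomial.eval_one]
    set n := Fintype.card V
    set W := G.maxWeight
    have h1 : (2 * n - 1) * W * n ≤ 2 * (n + W) * (n + W) * (n + W) :=
      Nat.mul_le_mul (Nat.mul_le_mul (by omega) (by omega)) (by omega)
    nlinarith

end MCRGame

/-! ### Determinacy in terms of potentials -/

namespace WeightedGraph

variable {V : Type*}

theorem bddBelow_of_periodic {f : ℕ → ℤ} {i L : ℕ} (hL : 0 < L)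
    (h : ∀ k, i ≤ k → f k ≤ f (k + L)) : ∃ B, ∀ k, B ≤ f k := by
  obtain ⟨B, hB⟩ := ((Finset.range (i + L)).image f).bddBelow
  refine ⟨B, fun k => ?_⟩
  induction k using Nat.strong_induction_on with
  | _ k ih =>
    by_cases hk : k < i + L
    · exact hB (Finset.mem_image_of_mem _ (Finset.mem_range.2 hk))
    · have h1 := h (k - L) (by omega)
      rw [show k - L + L = k by omega] at h1
      exact (ih (k - L) (by omega)).trans h1

theorem totalPayoff_orbit_succ (G : WeightedGraph V) (s : V → V) (v : V) (k : ℕ) :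
    G.totalPayoff (fun i => s^[i] v) (k + 1) =
      G.weight v (s v) + G.totalPayoff (fun i => s^[i] (s v)) k := by
  rw [totalPayoff, Finset.sum_range_succ', add_comm]
  rfl

variable [Fintype V]

/-- Potentials on `A` that are finite or `-∞` on `A`, and have the constant value `c` elsewhere. -/
structure Potential (G : WeightedGraph V) (A : Set V) (c : Zbar) (x : V → Zbar) : Prop where
  isPotential : G.IsPotential A x
  eq_const : ∀ v, v ∉ A → x v = c
  ne_top : ∀ v ∈ A, x v ≠ ⊤

theorem le_best_iff (G : WeightedGraph V) {x : V → Zbar} {v : V} {c : Zbar} : c ≤ G.best x v ↔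
    (v ∈ G.maxV → ∃ u, (v, u) ∈ G.edges ∧ c ≤ ofInt (G.weight v u) + x u) ∧
    (v ∉ G.maxV → ∀ u, (v, u) ∈ G.edges → c ≤ ofInt (G.weight v u) + x u) := by
  constructor
  · intro h
    refine ⟨fun _ => ?_, fun hm u hu => h.trans (G.best_le_of_min hm hu)⟩
    obtain ⟨u, hu, h'⟩ := G.exists_best x v
    exact ⟨u, hu, h' ▸ h⟩
  · rintro ⟨h1, h2⟩
    by_cases hm : v ∈ G.maxV
    · obtain ⟨u, hu, h⟩ := h1 hm
      exact h.trans (G.le_best_of_max hm hu)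
    · exact G.le_best_of_forall (h2 hm)

theorem _root_.Zbar.shift_le (a b : ℤ) {x y : Zbar} (h : x ≤ ofInt b + y) :
    ofInt a + x ≤ ofInt b + (ofInt a + y) := by
  refine (Zbar.ofInt_add_mono a h).trans (le_of_eq ?_)
  rw [Zbar.ofInt_add_add, Zbar.ofInt_add_add, add_comm a]

theorem Potential.shift {G : WeightedGraph V} {A : Set V} {c : Zbar} {x : V → Zbar}
    (hc : c = ⊥ ∨ c = ⊤) (h : G.Potential A c x) (a : ℤ) :
    G.Potential A c fun v => ofInt a + x v := by
  refine ⟨fun v hv => ?_, fun v hv => ?_, fun v hv => ?_⟩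
  · obtain ⟨h1, h2⟩ := G.le_best_iff.1 (h.isPotential v hv)
    refine G.le_best_iff.2 ⟨fun hm => ?_, fun hm u hu => Zbar.shift_le _ _ (h2 hm u hu)⟩
    obtain ⟨u, hu, h'⟩ := h1 hm
    exact ⟨u, hu, Zbar.shift_le _ _ h'⟩
  · rw [h.eq_const v hv]
    rcases hc with rfl | rfl
    · exact Zbar.ofInt_add_bot a
    · exact Zbar.ofInt_add_top a
  · exact (Zbar.ofInt_add_lt_top_iff.2 (lt_top_iff_ne_top.2 (h.ne_top v hv))).ne

/-- Additional moves for the maximising player do not harm a potential. -/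
theorem Potential.of_subset {G H : WeightedGraph V} {A : Set V} {c : Zbar} {x : V → Zbar}
    (h : H.Potential A c x) (hmax : H.maxV = G.maxV) (hwt : H.weight = G.weight)
    (hsub : H.edges ⊆ G.edges)
    (hmin : ∀ v ∉ G.maxV, ∀ u, (v, u) ∈ G.edges → (v, u) ∈ H.edges) : G.Potential A c x := by
  refine ⟨fun v hv => ?_, h.eq_const, h.ne_top⟩
  obtain ⟨h1, h2⟩ := H.le_best_iff.1 (h.isPotential v hv)
  rw [hmax, hwt] at h1 h2
  refine G.le_best_iff.2 ⟨fun hm => ?_, fun hm u hu => h2 hm u (hmin v hm u hu)⟩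
  obtain ⟨u, hu, h'⟩ := h1 hm
  exact ⟨u, hsub hu, h'⟩

/-- If the minimising player has a choice between two sets of moves at one vertex, and there are
potentials for both restrictions of the choice, then the maximum of the two, made equal at that
vertex by adding constants, is a potential for the unrestricted game. -/
theorem exists_potential_of_split {G H₁ H₂ : WeightedGraph V} {A : Set V} {c : Zbar} {w v : V}
    (hc : c = ⊥ ∨ c = ⊤) (hwA : w ∈ A) (hw : w ∉ G.maxV)
    (hm₁ : H₁.maxV = G.maxV) (hm₂ : H₂.maxV = G.maxV)
    (hwt₁ : H₁.weight = G.weight) (hwt₂ : H₂.weight = G.weight)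
    (he₁ : ∀ v ≠ w, ∀ u, (v, u) ∈ H₁.edges ↔ (v, u) ∈ G.edges)
    (he₂ : ∀ v ≠ w, ∀ u, (v, u) ∈ H₂.edges ↔ (v, u) ∈ G.edges)
    (hew : ∀ u, (w, u) ∈ G.edges → (w, u) ∈ H₁.edges ∨ (w, u) ∈ H₂.edges)
    (h₁ : ∃ x, H₁.Potential A c x ∧ x v ≠ ⊥) (h₂ : ∃ x, H₂.Potential A c x ∧ x v ≠ ⊥) :
    ∃ x, G.Potential A c x ∧ x v ≠ ⊥ := by
  have hbot : ∀ (H : WeightedGraph V) (x : V → Zbar), H.maxV = G.maxV → H.weight = G.weight →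
      (∀ v ≠ w, ∀ u, (v, u) ∈ H.edges ↔ (v, u) ∈ G.edges) → H.Potential A c x → x w = ⊥ →
      G.Potential A c x := by
    intro H x hm hwt he h hx
    refine ⟨fun v hv => ?_, h.eq_const, h.ne_top⟩
    by_cases hvw : v = w
    · rw [hvw, hx]; exact bot_le
    · have := H.le_best_iff.1 (h.isPotential v hv)
      simp only [he v hvw, hm, hwt] at this
      exact G.le_best_iff.2 this
  obtain ⟨x₁, h₁, hv₁⟩ := h₁
  obtain ⟨x₂, h₂, hv₂⟩ := h₂
  by_cases hb₁ : x₁ w = ⊥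
  · exact ⟨x₁, hbot H₁ x₁ hm₁ hwt₁ he₁ h₁ hb₁, hv₁⟩
  by_cases hb₂ : x₂ w = ⊥
  · exact ⟨x₂, hbot H₂ x₂ hm₂ hwt₂ he₂ h₂ hb₂, hv₂⟩
  obtain ⟨a₁, ha₁⟩ := Zbar.exists_ofInt hb₁ (h₁.ne_top w hwA)
  obtain ⟨a₂, ha₂⟩ := Zbar.exists_ofInt hb₂ (h₂.ne_top w hwA)
  set y₁ : V → Zbar := fun v => ofInt (-a₁) + x₁ v with hy₁
  set y₂ : V → Zbar := fun v => ofInt (-a₂) + x₂ v with hy₂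
  have hw₁ : y₁ w = 0 := by
    simp only [hy₁, ha₁, Zbar.ofInt_add, neg_add_cancel]; rfl
  have hw₂ : y₂ w = 0 := by
    simp only [hy₂, ha₂, Zbar.ofInt_add, neg_add_cancel]; rfl
  refine ⟨fun v => max (y₁ v) (y₂ v), ⟨fun v hv => ?_, fun v hv => ?_, fun v hv => ?_⟩, ?_⟩
  · obtain ⟨p₁, q₁⟩ := H₁.le_best_iff.1 (h₁.isPotential v hv)
    obtain ⟨p₂, q₂⟩ := H₂.le_best_iff.1 (h₂.isPotential v hv)
    rw [hm₁, hwt₁] at p₁ q₁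
    rw [hm₂, hwt₂] at p₂ q₂
    have le₁ : ∀ u, x₁ v ≤ ofInt (G.weight v u) + x₁ u →
        y₁ v ≤ ofInt (G.weight v u) + max (y₁ u) (y₂ u) := fun u h =>
      (Zbar.shift_le _ _ h).trans (Zbar.ofInt_add_mono _ (le_max_left _ _))
    have le₂ : ∀ u, x₂ v ≤ ofInt (G.weight v u) + x₂ u →
        y₂ v ≤ ofInt (G.weight v u) + max (y₁ u) (y₂ u) := fun u h =>
      (Zbar.shift_le _ _ h).trans (Zbar.ofInt_add_mono _ (le_max_right _ _))
    refine G.le_best_iff.2 ⟨fun hm => ?_, fun hm u hu => ?_⟩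
    · have hvw : v ≠ w := fun h => hw (h ▸ hm)
      rcases max_choice (y₁ v) (y₂ v) with h | h <;> rw [h]
      · obtain ⟨u, hu, h'⟩ := p₁ hm
        exact ⟨u, (he₁ v hvw u).1 hu, le₁ u h'⟩
      · obtain ⟨u, hu, h'⟩ := p₂ hm
        exact ⟨u, (he₂ v hvw u).1 hu, le₂ u h'⟩
    · by_cases hvw : v = w
      · subst hvw
        have h' : y₁ v = y₂ v := hw₁.trans hw₂.symm
        rcases hew u hu with h | h
        · rw [← h', max_self]
          exact le₁ u (q₁ hm u h)
        · rw [h', max_self]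
          exact le₂ u (q₂ hm u h)
      · exact max_le (le₁ u (q₁ hm u ((he₁ v hvw u).2 hu))) (le₂ u (q₂ hm u ((he₂ v hvw u).2 hu)))
  · simp only [hy₁, hy₂, h₁.eq_const v hv, h₂.eq_const v hv]
    rcases hc with rfl | rfl
    · simp
    · simp [Zbar.ofInt_add_top]
  · have t₁ : y₁ v < ⊤ := Zbar.ofInt_add_lt_top_iff.2 (lt_top_iff_ne_top.2 (h₁.ne_top v hv))
    have t₂ : y₂ v < ⊤ := Zbar.ofInt_add_lt_top_iff.2 (lt_top_iff_ne_top.2 (h₂.ne_top v hv))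
    exact (max_lt t₁ t₂).ne
  · exact ((bot_lt_iff_ne_bot.2 (Zbar.ofInt_add_ne_bot_iff.2 hv₁)).trans_le (le_max_left _ _)).ne'

/-- The game from the point of view of Min: the roles are exchanged, and an edge of weight `w` gets
the weight `-(N w + 1)`. For `N ≥ |V|`, a simple cycle has negative weight in the original game if
and only if it has nonnegative weight in this game. -/
noncomputable def dual (G : WeightedGraph V) (N : ℕ) : WeightedGraph V where
  maxV := Finset.univ.filter fun v => v ∉ G.maxV
  edges := G.edges
  weight u v := -(N * G.weight u v + 1)
  deadlockFree := G.deadlockFree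

theorem mem_dual_maxV {G : WeightedGraph V} {N : ℕ} {v : V} :
    v ∈ (G.dual N).maxV ↔ v ∉ G.maxV := by simp [dual]

theorem dual_totalPayoff (G : WeightedGraph V) (N : ℕ) (π : ℕ → V) (k : ℕ) :
    (G.dual N).totalPayoff π k = -(N * G.totalPayoff π k + k) := by
  induction k with
  | zero => simp [totalPayoff_zero]
  | succ k ih =>
    rw [totalPayoff_succ, totalPayoff_succ, ih]
    simp only [dual]
    push_cast
    ring

/-- Graph with a subset of the edges. -/
def restrictEdges (G : WeightedGraph V) (E : Finset (V × V)) (hE : ∀ v, ∃ u, (v, u) ∈ E) :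
    WeightedGraph V :=
  { G with edges := E, deadlockFree := hE }

/-- On an orbit of a map, either the payoffs are bounded from below or they decrease linearly. -/
theorem orbit_dichotomy (G : WeightedGraph V) (s : V → V) (v : V) {N : ℕ}
    (hN : Fintype.card V ≤ N) :
    (∃ B, ∀ k, B ≤ G.totalPayoff (fun i => s^[i] v) k) ∨
    ∃ B, ∀ k, B ≤ (G.dual N).totalPayoff (fun i => s^[i] v) k := by
  obtain ⟨i, j, hij, hjN, heq⟩ : ∃ i j : ℕ, i < j ∧ j ≤ i + N ∧ s^[i] v = s^[j] v := by
    obtain ⟨a, b, hab, h⟩ := Fintype.exists_ne_map_eq_of_card_lt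
      (fun a : Fin (Fintype.card V + 1) => s^[a] v) (by simp)
    have ha := a.2
    have hb := b.2
    rcases lt_or_gt_of_ne (Fin.val_ne_of_ne hab) with h' | h'
    · exact ⟨a, b, h', by omega, h⟩
    · exact ⟨b, a, h', by omega, h.symm⟩
  obtain ⟨L, hL0, rfl⟩ : ∃ L, 0 < L ∧ j = i + L := ⟨j - i, by omega, by omega⟩
  set f := G.totalPayoff (fun i => s^[i] v) with hf
  have hper : ∀ k, s^[i + k + L] v = s^[i + k] v := by
    intro k
    rw [show i + k + L = k + (i + L) by omega, Function.iterate_add_apply, ← heq,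
      ← Function.iterate_add_apply, add_comm k i]
  have hdiff : ∀ k, f (i + k + L) = f (i + k) + (f (i + L) - f i) := by
    intro k
    induction k with
    | zero => rw [add_zero]; ring
    | succ k ih =>
      have h1 : f (i + k + L + 1) = _ := totalPayoff_succ G _ _
      have h2 : f (i + k + 1) = _ := totalPayoff_succ G _ _
      have h3 : i + (k + 1) + L = i + k + L + 1 := by omega
      rw [h3, h1, show i + (k + 1) = i + k + 1 from rfl, h2]
      change f (i + k + L) + _ = f (i + k) + _ + _
      have h4 : s^[i + k + L + 1] v = s^[i + k + 1] v := by
        rw [show i + k + L + 1 = i + (k + 1) + L by omega]; exact hper (k + 1)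
      simp only [h4, hper, ih]
      ring
  by_cases hc : 0 ≤ f (i + L) - f i
  · left
    refine bddBelow_of_periodic (i := i) hL0 fun k hk => ?_
    have := hdiff (k - i)
    rw [show i + (k - i) = k by omega] at this
    omega
  · right
    refine bddBelow_of_periodic (i := i) hL0 fun k hk => ?_
    have := hdiff (k - i)
    rw [show i + (k - i) = k by omega] at this
    rw [dual_totalPayoff, dual_totalPayoff]
    change -((N : ℤ) * f k + k) ≤ -(N * f (k + L) + (k + L : ℕ))
    rw [this]
    have h5 : (N : ℤ) * (f (i + L) - f i) ≤ N * (-1) :=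
      mul_le_mul_of_nonneg_left (by omega) (by omega)
    push_cast
    rw [mul_add]
    have : (L : ℤ) ≤ N := by omega
    linarith

/-- If every vertex of `A` has one successor only, the infimum of the payoffs of the orbit up to
its exit from `A` is a potential. -/
theorem potential_top_orbit (G : WeightedGraph V) (A : Set V) (s : V → V)
    (huniq : ∀ v ∈ A, ∀ u, (v, u) ∈ G.edges → u = s v) :
    G.Potential A ⊤ (fun v => if v ∈ A then
      ⨅ k, ⨅ _ : ∀ i ≤ k, s^[i] v ∈ A, ofInt (G.totalPayoff (fun i => s^[i] v) k) else ⊤) := by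
  refine ⟨fun v hv => ?_, fun v hv => if_neg hv, fun v hv => ?_⟩
  · obtain ⟨u, hu, h⟩ := G.exists_best (fun v => if v ∈ A then
      ⨅ k, ⨅ _ : ∀ i ≤ k, s^[i] v ∈ A, ofInt (G.totalPayoff (fun i => s^[i] v) k) else ⊤) v
    rw [h, huniq v hv u hu, if_pos hv]
    split_ifs with h'
    · rw [Zbar.le_ofInt_add_iff]
      refine le_iInf₂ fun k hk => ?_
      rw [← Zbar.le_ofInt_add_iff, Zbar.ofInt_add, ← totalPayoff_orbit_succ]
      refine iInf₂_le (k + 1) fun i hi => ?_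
      cases i with
      | zero => exact hv
      | succ i => exact hk i (by omega)
    · rw [Zbar.ofInt_add_top]; exact le_top
  · rw [if_pos hv]
    refine ((iInf₂_le 0 fun i hi => ?_).trans_lt (Zbar.ofInt_lt_top _)).ne
    rw [Nat.le_zero.1 hi]; exact hv

/-- If every vertex of `A` has one successor only, the infimum of the payoffs of the orbits that
stay in `A` is a potential. -/
theorem potential_bot_orbit (G : WeightedGraph V) (A : Set V) (s : V → V)
    (huniq : ∀ v ∈ A, ∀ u, (v, u) ∈ G.edges → u = s v) :
    G.Potential A ⊥ (fun v => if ∀ i, s^[i] v ∈ A then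
      ⨅ k, ofInt (G.totalPayoff (fun i => s^[i] v) k) else ⊥) := by
  refine ⟨fun v hv => ?_, fun v hv => if_neg fun h => hv (h 0), fun v hv => ?_⟩
  · split_ifs with h'
    · obtain ⟨u, hu, h⟩ := G.exists_best (fun v => if ∀ i, s^[i] v ∈ A then
        ⨅ k, ofInt (G.totalPayoff (fun i => s^[i] v) k) else ⊥) v
      have h'' : ∀ i, s^[i] (s v) ∈ A := fun i => h' (i + 1)
      rw [h, huniq v hv u hu, if_pos h'', Zbar.le_ofInt_add_iff]
      refine le_iInf fun k => ?_
      rw [← Zbar.le_ofInt_add_iff, Zbar.ofInt_add, ← totalPayoff_orbit_succ]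
      exact iInf_le _ (k + 1)
    · exact bot_le
  · split_ifs with h'
    · exact ((iInf_le (fun k => ofInt (G.totalPayoff (fun i => s^[i] v) k)) 0).trans_lt
        (Zbar.ofInt_lt_top _)).ne
    · exact Zbar.top_ne_bot.symm

/-- Determinacy: every vertex of `A` has a potential for Max or one for Min. The induction splits
the edges of a vertex with several edges. -/
theorem exists_potential (A : Set V) {N : ℕ} (hN : Fintype.card V ≤ N) (G : WeightedGraph V)
    {v : V} (hv : v ∈ A) :
    (∃ x, G.Potential A ⊤ x ∧ x v ≠ ⊥) ∨ ∃ x, (G.dual N).Potential A ⊥ x ∧ x v ≠ ⊥ := by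
  induction hk : G.edges.card using Nat.strong_induction_on generalizing G with
  | _ k ih =>
    by_cases hch : ∃ w ∈ A, ∃ a b, a ≠ b ∧ (w, a) ∈ G.edges ∧ (w, b) ∈ G.edges
    · obtain ⟨w, hwA, a, b, hab, ha, hb⟩ := hch
      have hE₁ : ∀ v, ∃ u, (v, u) ∈ G.edges.erase (w, a) := by
        intro v
        by_cases hvw : v = w
        · exact ⟨b, by rw [hvw]; simp [hb, hab.symm]⟩
        · obtain ⟨u, hu⟩ := G.deadlockFree v
          exact ⟨u, by simp [hu, hvw]⟩
      have hE₂ : ∀ v, ∃ u, (v, u) ∈ G.edges.filter fun e => e.1 ≠ w ∨ e.2 = a := by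
        intro v
        by_cases hvw : v = w
        · exact ⟨a, by rw [hvw]; simp [ha]⟩
        · obtain ⟨u, hu⟩ := G.deadlockFree v
          exact ⟨u, by simp [hu, hvw]⟩
      have c₁ : (G.edges.erase (w, a)).card < k := hk ▸ Finset.card_erase_lt_of_mem ha
      have c₂ : (G.edges.filter fun e => e.1 ≠ w ∨ e.2 = a).card < k :=
        hk ▸ Finset.card_lt_card (Finset.filter_ssubset.2 ⟨(w, b), hb, by simp [hab.symm]⟩)
      have i₁ := ih _ c₁ (G.restrictEdges _ hE₁) rfl
      have i₂ := ih _ c₂ (G.restrictEdges _ hE₂) rfl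
      have s₁ : G.edges.erase (w, a) ⊆ G.edges := Finset.erase_subset _ _
      have s₂ : (G.edges.filter fun e => e.1 ≠ w ∨ e.2 = a) ⊆ G.edges := Finset.filter_subset _ _
      have e₁ : ∀ v ≠ w, ∀ u, (v, u) ∈ G.edges.erase (w, a) ↔ (v, u) ∈ G.edges := by
        intro v hvw u; simp [hvw]
      have e₂ : ∀ v ≠ w, ∀ u, (v, u) ∈ (G.edges.filter fun e => e.1 ≠ w ∨ e.2 = a) ↔
          (v, u) ∈ G.edges := by
        intro v hvw u; simp [hvw]
      have ew : ∀ u, (w, u) ∈ G.edges → (w, u) ∈ G.edges.erase (w, a) ∨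
          (w, u) ∈ G.edges.filter fun e => e.1 ≠ w ∨ e.2 = a := by
        intro u hu
        by_cases hua : u = a
        · right; simp [ha, hua]
        · left; simp [hu, hua]
      by_cases hm : w ∈ G.maxV
      · have hm' : w ∉ (G.dual N).maxV := fun h => mem_dual_maxV.1 h hm
        rcases i₁ with ⟨x, h, h'⟩ | j₁
        · exact Or.inl ⟨x, h.of_subset rfl rfl s₁ fun v hv u hu =>
            (e₁ v (fun e => hv (e ▸ hm)) u).2 hu, h'⟩
        rcases i₂ with ⟨x, h, h'⟩ | j₂
        · exact Or.inl ⟨x, h.of_subset rfl rfl s₂ fun v hv u hu =>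
            (e₂ v (fun e => hv (e ▸ hm)) u).2 hu, h'⟩
        · exact Or.inr (exists_potential_of_split
            (H₁ := (G.restrictEdges _ hE₁).dual N) (H₂ := (G.restrictEdges _ hE₂).dual N)
            (Or.inl rfl) hwA hm' rfl rfl rfl rfl e₁ e₂ ew
            j₁ j₂)
      · have hm' : w ∈ (G.dual N).maxV := mem_dual_maxV.2 hm
        rcases i₁ with j₁ | ⟨x, h, h'⟩
        · rcases i₂ with j₂ | ⟨x, h, h'⟩
          · exact Or.inl (exists_potential_of_split
              (H₁ := G.restrictEdges _ hE₁) (H₂ := G.restrictEdges _ hE₂)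
              (Or.inr rfl) hwA hm rfl rfl rfl rfl e₁ e₂ ew
              j₁ j₂)
          · exact Or.inr ⟨x, h.of_subset rfl rfl s₂ fun v hv u hu =>
              (e₂ v (fun e => hv (e ▸ hm')) u).2 hu, h'⟩
        · exact Or.inr ⟨x, h.of_subset rfl rfl s₁ fun v hv u hu =>
            (e₁ v (fun e => hv (e ▸ hm')) u).2 hu, h'⟩
    · choose s hs using G.deadlockFree
      have huniq : ∀ v ∈ A, ∀ u, (v, u) ∈ G.edges → u = s v := by
        intro v hv u hu
        by_contra hne
        exact hch ⟨v, hv, u, s v, hne, hu, hs v⟩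
      have hlower : (∃ B, ∀ k, (∀ i ≤ k, s^[i] v ∈ A) →
          B ≤ G.totalPayoff (fun i => s^[i] v) k) →
          ∃ x, G.Potential A ⊤ x ∧ x v ≠ ⊥ := by
        rintro ⟨B, hB⟩
        refine ⟨_, G.potential_top_orbit A s huniq, ?_⟩
        rw [if_pos hv]
        exact ((Zbar.bot_lt_ofInt B).trans_le (le_iInf₂ fun k hk => Zbar.ofInt_le.2 (hB k hk))).ne'
      by_cases hstay : ∀ i, s^[i] v ∈ A
      · rcases G.orbit_dichotomy s v hN with ⟨B, hB⟩ | ⟨B, hB⟩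
        · exact Or.inl (hlower ⟨B, fun k _ => hB k⟩)
        · refine Or.inr ⟨_, (G.dual N).potential_bot_orbit A s huniq, ?_⟩
          rw [if_pos hstay]
          exact ((Zbar.bot_lt_ofInt B).trans_le (le_iInf fun k => Zbar.ofInt_le.2 (hB k))).ne'
      · push Not at hstay
        obtain ⟨j, hj⟩ := hstay
        obtain ⟨B, hB⟩ := ((Finset.range j).image (G.totalPayoff fun i => s^[i] v)).bddBelow
        refine Or.inl (hlower ⟨B, fun k hk => hB (Finset.mem_image_of_mem _ ?_)⟩)
        rw [Finset.mem_range]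
        by_contra hjk
        exact hj (hk j (by omega))

/-- The potentials of the two players exclude each other: at a vertex that maximises
`N * x + p`, a move that respects both would increase that quantity. -/
theorem eq_bot_of_potential_dual {G : WeightedGraph V} {A : Set V} {N : ℕ} {x p : V → Zbar}
    (hx : G.IsPotential A x) (hxtop : ∀ v ∈ A, x v ≠ ⊤) (hp : (G.dual N).Potential A ⊥ p) {v : V}
    (hv : p v ≠ ⊥) : x v = ⊥ := by
  by_contra hxv
  have hA : ∀ u, p u ≠ ⊥ → u ∈ A := fun u hu => by
    by_contra h; exact hu (hp.eq_const u h)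
  set S := Finset.univ.filter fun u => p u ≠ ⊥ ∧ x u ≠ ⊥ with hS
  obtain ⟨w, hw, hmax⟩ := S.exists_max_image (fun u => (N : ℤ) * (x u).toInt + (p u).toInt)
    ⟨v, by simp [hS, hv, hxv]⟩
  obtain ⟨hpw, hxw⟩ : p w ≠ ⊥ ∧ x w ≠ ⊥ := by simpa [hS] using hw
  have hwA := hA w hpw
  obtain ⟨h1, h2⟩ := G.le_best_iff.1 (hx w hwA)
  obtain ⟨h3, h4⟩ := (G.dual N).le_best_iff.1 (hp.isPotential w hwA)
  obtain ⟨u, h5, h6⟩ : ∃ u, x w ≤ ofInt (G.weight w u) + x u ∧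
      p w ≤ ofInt (-(N * G.weight w u + 1)) + p u := by
    by_cases hm : w ∈ G.maxV
    · obtain ⟨u, hu, h⟩ := h1 hm
      exact ⟨u, h, h4 (fun h' => mem_dual_maxV.1 h' hm) u hu⟩
    · obtain ⟨u, hu, h⟩ := h3 (mem_dual_maxV.2 hm)
      exact ⟨u, h2 hm u hu, h⟩
  have hpu : p u ≠ ⊥ := fun h => by
    rw [h, Zbar.ofInt_add_bot] at h6; exact hpw (le_bot_iff.1 h6)
  have hxu : x u ≠ ⊥ := fun h => by
    rw [h, Zbar.ofInt_add_bot] at h5; exact hxw (le_bot_iff.1 h5)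
  have huA := hA u hpu
  have hle := hmax u (by simp [hS, hpu, hxu])
  obtain ⟨a, ha⟩ := Zbar.exists_ofInt hpu (hp.ne_top u huA)
  obtain ⟨b, hb⟩ := Zbar.exists_ofInt hxu (hxtop u huA)
  obtain ⟨c, hc⟩ := Zbar.exists_ofInt hpw (hp.ne_top w hwA)
  obtain ⟨d, hd⟩ := Zbar.exists_ofInt hxw (hxtop w hwA)
  rw [hd, hb, Zbar.ofInt_add, Zbar.ofInt_le] at h5
  rw [hc, ha, Zbar.ofInt_add, Zbar.ofInt_le] at h6
  simp only [ha, hb, hc, hd, Zbar.toInt_ofInt] at hle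
  have h7 : (N : ℤ) * d ≤ N * (G.weight w u + b) := mul_le_mul_of_nonneg_left h5 (by omega)
  rw [mul_add] at h7
  linarith

/-- Min can force the payoff to tend to `-∞` linearly while the play stays in `A`: there is a
potential of the dual game, with some scaling factor `N`, that is above `-∞` at `v`. -/
def Negative (G : WeightedGraph V) (A : Set V) (v : V) : Prop :=
  ∃ N p, (G.dual N).Potential A ⊥ p ∧ p v ≠ ⊥

theorem Negative.mem {G : WeightedGraph V} {A : Set V} {v : V} (h : G.Negative A v) : v ∈ A := by
  obtain ⟨N, p, hp, hv⟩ := h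
  by_contra h'
  exact hv (hp.eq_const v h')

theorem Negative.eq_bot {G : WeightedGraph V} {A : Set V} {v : V} (h : G.Negative A v)
    {x : V → Zbar} (hx : G.IsPotential A x) (hxtop : ∀ v ∈ A, x v ≠ ⊤) : x v = ⊥ := by
  obtain ⟨N, p, hp, hv⟩ := h
  exact eq_bot_of_potential_dual hx hxtop hp hv

theorem not_negative_iff {G : WeightedGraph V} {A : Set V} {v : V} (hv : v ∈ A) :
    ¬ G.Negative A v ↔ ∃ x, G.Potential A ⊤ x ∧ x v ≠ ⊥ := by
  constructor
  · intro h
    exact (exists_potential A le_rfl G hv).resolve_right fun ⟨p, hp⟩ => h ⟨_, p, hp⟩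
  · rintro ⟨x, hx, hx'⟩ h
    exact hx' (h.eq_bot hx.isPotential hx.ne_top)

theorem dual_maxWeight_le (G : WeightedGraph V) (N : ℕ) :
    (G.dual N).maxWeight ≤ N * G.maxWeight + 1 := by
  refine Finset.sup_le fun e he => ?_
  have h := G.natAbs_weight_le (u := e.1) (v := e.2) he
  change (-((N : ℤ) * G.weight e.1 e.2 + 1)).natAbs ≤ _
  rw [Int.natAbs_neg]
  refine (Int.natAbs_add_le _ _).trans ?_
  rw [Int.natAbs_mul, Int.natAbs_natCast, Int.natAbs_one]
  exact Nat.add_le_add_right (Nat.mul_le_mul_left _ h) _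

theorem Potential.ne_top_of_bot {G : WeightedGraph V} {A : Set V} {p : V → Zbar}
    (hp : G.Potential A ⊥ p) (u : V) : p u ≠ ⊤ := by
  intro hu
  by_cases h : u ∈ A
  · exact hp.ne_top u h hu
  · rw [hp.eq_const u h] at hu
    exact Zbar.top_ne_bot hu.symm

/-- A potential of Min can be lifted until its entries are small. -/
theorem Potential.exists_small {G : WeightedGraph V} {A : Set V} {v : V} {p : V → Zbar}
    (hp : G.Potential A ⊥ p) (hv : p v ≠ ⊥) : ∃ p, G.Potential A ⊥ p ∧ p v ≠ ⊥ ∧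
      ∀ u k, p u = ofInt k → k ≤ 0 ∧ -((Fintype.card V : ℤ) * G.maxWeight) ≤ k := by
  obtain ⟨q, hq, hqv, hq0⟩ : ∃ q, G.Potential A ⊥ q ∧ q v ≠ ⊥ ∧ ∀ u k, q u = ofInt k → k ≤ 0 := by
    obtain ⟨B, hB⟩ := (finiteEntries p).exists_le
    refine ⟨_, hp.shift (Or.inl rfl) (-B), Zbar.ofInt_add_ne_bot_iff.2 hv, fun u k hk => ?_⟩
    have hpu : p u = ofInt (B + k) := by
      rw [← Zbar.ofInt_add, ← hk, Zbar.add_neg_cancel_ofInt]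
    have := hB (B + k) (mem_finiteEntries.2 ⟨u, hpu⟩)
    omega
  clear hp hv p
  induction hM : ∑ u, (-(q u).toInt).toNat using Nat.strong_induction_on generalizing q with
  | _ M ih =>
    by_cases hsmall : ∀ u k, q u = ofInt k → -((Fintype.card V : ℤ) * G.maxWeight) ≤ k
    · exact ⟨q, hq, hqv, fun u k h => ⟨hq0 u k h, hsmall u k h⟩⟩
    push Not at hsmall
    obtain ⟨w, b, hw, hb⟩ := hsmall
    have hbmem := mem_finiteEntries.2 ⟨w, hw⟩
    obtain ⟨z, hz, -, hz0, hgap⟩ := exists_gap G.maxWeight _ (insert 0 (finiteEntries q)) 0 b rfl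
      (Finset.mem_insert_self _ _) (Finset.mem_insert_of_mem hbmem) (by
        have h1 : (((insert 0 (finiteEntries q)).card : ℤ) - 1) * G.maxWeight ≤
            (Fintype.card V : ℤ) * G.maxWeight := by
          refine mul_le_mul_of_nonneg_right ?_ (by omega)
          have h2 := Finset.card_insert_le (0 : ℤ) (finiteEntries q)
          have h3 := card_finiteEntries_le q
          omega
        omega)
    obtain ⟨u₀, hu₀⟩ := mem_finiteEntries.1 ((Finset.mem_insert.1 hz).resolve_left (by omega))
    have hentry : ∀ u, q u ≠ ⊥ → ∃ k, q u = ofInt k ∧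
        lift z q u = ofInt (if k ≤ z then 1 + k else k) := by
      intro u hu
      obtain ⟨k, hk⟩ := Zbar.exists_ofInt hu (hq.ne_top_of_bot u)
      refine ⟨k, hk, ?_⟩
      simp only [lift, hk, Zbar.ofInt_le]
      split_ifs
      · rfl
      · rfl
    have hbot : ∀ u, q u = ⊥ → lift z q u = ⊥ := by
      intro u hu
      simp only [lift, hu, Zbar.ofInt_add_bot, ite_self]
    have hlift : G.Potential A ⊥ (lift z q) := by
      refine ⟨hq.isPotential.lift fun u k hu =>
        hgap k (Finset.mem_insert_of_mem (mem_finiteEntries.2 ⟨u, hu⟩)), fun u hu =>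
        hbot u (hq.eq_const u hu), fun u _ => ?_⟩
      by_cases hu : q u = ⊥
      · rw [hbot u hu]; exact Zbar.top_ne_bot.symm
      · obtain ⟨k, -, h⟩ := hentry u hu
        rw [h]; exact Zbar.ofInt_ne_top _
    refine ih _ ?_ (lift z q) hlift ?_ ?_ rfl
    · rw [← hM]
      refine Finset.sum_lt_sum (fun u _ => ?_) ⟨u₀, Finset.mem_univ _, ?_⟩
      · by_cases hu : q u = ⊥
        · rw [hbot u hu, hu]
        · obtain ⟨k, hk, h⟩ := hentry u hu
          rw [h, hk, Zbar.toInt_ofInt, Zbar.toInt_ofInt]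
          split_ifs <;> omega
      · rw [lift, hu₀, if_pos le_rfl, Zbar.ofInt_add, Zbar.toInt_ofInt, Zbar.toInt_ofInt]
        omega
    · obtain ⟨k, -, h⟩ := hentry v hqv
      rw [h]; exact Zbar.ofInt_ne_bot _
    · intro u k hk
      by_cases hu : q u = ⊥
      · rw [hbot u hu] at hk; exact absurd hk.symm (Zbar.ofInt_ne_bot k)
      · obtain ⟨j, hj, h⟩ := hentry u hu
        rw [h, Zbar.ofInt_inj] at hk
        have := hq0 u j hj
        split_ifs at hk <;> omega

/-- The scaling factor can be chosen as `|V|`, and the entries of the potential can be bounded. -/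
theorem negative_iff {G : WeightedGraph V} {A : Set V} {v : V} : G.Negative A v ↔
    ∃ p, (G.dual (Fintype.card V)).Potential A ⊥ p ∧ p v ≠ ⊥ ∧ ∀ u k, p u = ofInt k → k ≤ 0 ∧
      -((Fintype.card V : ℤ) * (G.dual (Fintype.card V)).maxWeight) ≤ k := by
  constructor
  · intro h
    rcases exists_potential A le_rfl G h.mem with ⟨x, hx, hx'⟩ | ⟨p, hp, hp'⟩
    · exact absurd (h.eq_bot hx.isPotential hx.ne_top) hx'
    · exact hp.exists_small hp'
  · rintro ⟨p, hp, hp', -⟩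
    exact ⟨_, p, hp, hp'⟩

/-! ### Mean-payoff games -/

/-- A potential yields a table of moves that bounds the payoffs from below. -/
theorem Potential.exists_table {G : WeightedGraph V} {c : Zbar} {x : V → Zbar} {v : V}
    (hx : G.Potential Set.univ c x) (hv : x v ≠ ⊥) :
    ∃ f : V → V, (∀ u, (u, f u) ∈ G.edges) ∧ ∃ B : ℤ, ∀ π : ℕ → V, π 0 = v →
      (∀ k, (π k, π (k + 1)) ∈ G.edges) → (∀ k, π k ∈ G.maxV → π (k + 1) = f (π k)) →
      ∀ k, -B ≤ G.totalPayoff π k := by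
  choose f hf hb using G.exists_best x
  obtain ⟨a, ha⟩ := Zbar.exists_ofInt hv (hx.ne_top v trivial)
  obtain ⟨C, hC⟩ := (finiteEntries x).exists_le
  refine ⟨f, hf, C - a, fun π h0 hedge hfol k => ?_⟩
  have key : x v ≤ ofInt (G.totalPayoff π k) + x (π k) := by
    induction k with
    | zero => rw [totalPayoff_zero, Zbar.ofInt_zero_add, h0]
    | succ k ih =>
      refine ih.trans ?_
      rw [totalPayoff_succ, ← Zbar.ofInt_add_add]
      refine Zbar.ofInt_add_mono _ ((hx.isPotential _ trivial).trans ?_)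
      by_cases hm : π k ∈ G.maxV
      · rw [hfol k hm, hb]
      · exact G.best_le_of_min hm (hedge k)
  have hk : x (π k) ≠ ⊥ := fun h => by
    rw [h, Zbar.ofInt_add_bot] at key; exact hv (le_bot_iff.1 key)
  obtain ⟨b, hb⟩ := Zbar.exists_ofInt hk (hx.ne_top _ trivial)
  have := hC b (mem_finiteEntries.2 ⟨_, hb⟩)
  rw [ha, hb, Zbar.ofInt_add, Zbar.ofInt_le] at key
  omega

theorem tendsto_meanPayoff_bound (a b : ℝ) :
    Filter.Tendsto (fun k : ℕ => ((a / (k : ℝ) + b : ℝ) : EReal)) Filter.atTop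
      (nhds (b : EReal)) := by
  refine EReal.tendsto_coe.2 ?_
  simpa using (tendsto_const_div_atTop_nhds_zero_nat a).add_const b

/-- The mean-payoff value of a vertex is negative if and only if Min has a potential there. -/
theorem upperValue_meanPayoff_lt_zero_iff (G : WeightedGraph V) (v : V) :
    G.upperValue G.meanPayoff v < 0 ↔ G.Negative Set.univ v := by
  constructor
  · intro h
    by_contra hneg
    obtain ⟨x, hx, hx'⟩ := (not_negative_iff (Set.mem_univ v)).1 hneg
    obtain ⟨f, hf, B, hB⟩ := hx.exists_table hx'
    refine absurd h (not_lt.2 (le_iInf fun τ => ?_))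
    refine le_trans ?_ (le_iSup _ (G.tableStrategy _ f fun u _ => hf u))
    set π := G.outcome v (G.tableStrategy _ f fun u _ => hf u) τ
    have hk := hB π rfl (G.outcome_edge v _ τ) fun k hm => G.outcome_succ_max hm
    rw [← EReal.coe_zero, ← (tendsto_meanPayoff_bound (-B) 0).liminf_eq]
    refine Filter.liminf_le_liminf (Filter.Eventually.of_forall fun k => ?_)
    rw [EReal.coe_le_coe_iff, add_zero]
    refine div_le_div_of_nonneg_right ?_ (Nat.cast_nonneg k)
    exact_mod_cast hk k
  · rintro ⟨N, p, hp, hpv⟩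
    obtain ⟨f, hf, B, hB⟩ := hp.exists_table hpv
    have hN : (0 : ℝ) < (N : ℝ) + 1 := by positivity
    refine (iInf_le _ (G.tableStrategy _ f fun u _ => hf u)).trans_lt ?_
    have h0 : ((-(1 / ((N : ℝ) + 1)) : ℝ) : EReal) < 0 := by
      rw [← EReal.coe_zero, EReal.coe_lt_coe_iff, neg_lt_zero]
      positivity
    refine lt_of_le_of_lt (iSup_le fun σ => ?_) h0
    set π := G.outcome v σ (G.tableStrategy _ f fun u _ => hf u)
    have hk := hB π rfl (G.outcome_edge v σ _) fun k hm =>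
      G.outcome_succ_min (mem_dual_maxV.1 hm)
    simp only [dual_totalPayoff, neg_le_neg_iff] at hk
    have hNpos : 0 < (N : ℝ) := by
      rcases Nat.eq_zero_or_pos N with rfl | h
      · have := hk (B.toNat + 1)
        push_cast at this
        omega
      · exact_mod_cast h
    refine le_trans ?_ (EReal.coe_le_coe_iff.2 (neg_le_neg (one_div_le_one_div_of_le hNpos
      (by linarith : (N : ℝ) ≤ N + 1))))
    rw [← (tendsto_meanPayoff_bound (B / N) (-(1 / N))).liminf_eq]
    refine Filter.liminf_le_liminf ?_
    filter_upwards [Filter.eventually_gt_atTop 0] with k hkpos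
    have hkpos' : (0 : ℝ) < k := by exact_mod_cast hkpos
    have h1 : (N : ℝ) * G.totalPayoff π k + k ≤ B := by exact_mod_cast hk k
    rw [EReal.coe_le_coe_iff, div_le_iff₀ hkpos']
    field_simp
    linarith

end WeightedGraph

namespace MCRGame

variable {V : Type*} [Fintype V] (G : MCRGame V)

/-- The vertices outside the target from which Min can force a visit to the target. -/
def activeSet : Set V := {v | v ∈ G.attr (Fintype.card V) ∧ v ∉ G.target}

theorem limitVec_ne_top_iff {v : V} : G.limitVec v ≠ ⊤ ↔ v ∈ G.attr (Fintype.card V) := by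
  rw [← value_eq_limitVec, ne_eq, G.value_eq_top_iff, not_not]

/-- The value is `-∞` if and only if Min can force arbitrarily low payoffs without leaving the
vertices from which the target can be reached. -/
theorem value_eq_bot_iff {v : V} : G.value v = ⊥ ↔ G.Negative G.activeSet v := by
  rw [value_eq_limitVec]
  constructor
  · intro h
    have hv : v ∈ G.activeSet := by
      constructor
      · rw [← limitVec_ne_top_iff, h]; exact Zbar.top_ne_bot.symm
      · intro ht
        rw [G.limitVec_target ht] at h
        exact Zbar.zero_ne_bot h
    by_contra hneg
    obtain ⟨x, hx, hx'⟩ := (WeightedGraph.not_negative_iff hv).1 hneg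
    obtain ⟨B, hB⟩ := (WeightedGraph.finiteEntries x).exists_le
    -- The potential is moved below the entries `0` of the target and extended by `+∞`.
    have hy := hx.shift (Or.inr rfl) (-(max B 0) - G.maxWeight)
    set y : V → Zbar := fun v => ofInt (-(max B 0) - G.maxWeight) + x v with hydef
    have hysmall : ∀ u ∈ G.activeSet, y u ≤ ofInt (-(G.maxWeight : ℤ)) := by
      intro u hu
      simp only [hydef]
      rcases Zbar.cases' (x u) with h' | h' | ⟨k, h'⟩
      · rw [h', Zbar.ofInt_add_bot]; exact bot_le
      · exact absurd h' (hx.ne_top u hu)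
      · have := hB k (WeightedGraph.mem_finiteEntries.2 ⟨u, h'⟩)
        rw [h', Zbar.ofInt_add, Zbar.ofInt_le]
        omega
    set w : V → Zbar := fun u => if u ∈ G.target then 0 else y u with hw
    have hpot : G.IsPotential {u | u ∉ G.target} w := by
      intro u hu
      have hwu : w u = y u := if_neg hu
      rw [hwu]
      by_cases hua : u ∈ G.activeSet
      · have hstep : ∀ u', (u, u') ∈ G.edges → y u ≤ ofInt (G.weight u u') + y u' →
            y u ≤ ofInt (G.weight u u') + w u' := by
          intro u' hu' hle
          simp only [hw]
          split_ifs
          · refine (hysmall u hua).trans ?_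
            rw [← Zbar.ofInt_zero, Zbar.ofInt_add, Zbar.ofInt_le, add_zero]
            exact G.neg_le_weight hu'
          · exact hle
        obtain ⟨h1, h2⟩ := G.le_best_iff.1 (hy.isPotential u hua)
        refine G.le_best_iff.2 ⟨fun hm => ?_, fun hm u' hu' => hstep u' hu' (h2 hm u' hu')⟩
        obtain ⟨u', hu', h'⟩ := h1 hm
        exact ⟨u', hu', hstep u' hu' h'⟩
      · have hout : u ∉ G.attr (Fintype.card V) := fun h' => hua ⟨h', hu⟩
        rw [← G.attr_eq_of_le (Nat.le_succ _), mem_attr_succ] at hout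
        have htop : ∀ u' ∉ G.attr (Fintype.card V), w u' = ⊤ := fun u' hu' => by
          have h1 : u' ∉ G.target := fun h => hu' (G.target_subset_attr _ h)
          exact (if_neg h1).trans (hy.eq_const u' fun h => hu' h.1)
        refine G.le_best_iff.2 ⟨fun hm => ?_, fun hm u' hu' => ?_⟩
        · obtain ⟨u', hu', h'⟩ := Finset.not_subset.1 fun h => hout (Or.inr (Or.inr ⟨hm, h⟩))
          refine ⟨u', G.mem_succ.1 hu', ?_⟩
          rw [htop u' h', Zbar.ofInt_add_top]; exact le_top
        · rw [htop u' fun h => hout (Or.inr (Or.inl ⟨hm, u', G.mem_succ.2 hu', h⟩)),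
            Zbar.ofInt_add_top]
          exact le_top
    have hle := G.le_limitVec (G.le_op_of_isPotential (fun t ht => (if_pos ht).le) hpot) v
    rw [h] at hle
    have hwv : w v = y v := if_neg hv.2
    change w v ≤ ⊥ at hle
    rw [hwv] at hle
    exact Zbar.ofInt_add_ne_bot_iff.2 hx' (le_bot_iff.1 hle)
  · intro h
    refine h.eq_bot (fun u hu => G.isPotential_of_le_op G.limitVec_le_op u hu.2) fun u hu => ?_
    exact G.limitVec_ne_top_iff.2 hu.1

end MCRGame

/-! ### A game in which Min needs memory -/

namespace MCRGame

theorem payoff_eq {V : Type*} (G : MCRGame V) {π : ℕ → V} {k : ℕ} (hk : π k ∈ G.target)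
    (h : ∀ j < k, π j ∉ G.target) : G.payoff π = ofInt (G.totalPayoff π k) := by
  have hex : ∃ k, π k ∈ G.target := ⟨k, hk⟩
  have hfind : Nat.find hex = k := (Nat.find_eq_iff hex).2 ⟨hk, fun j hj => h j hj⟩
  rw [payoff, dif_pos hex, hfind]

theorem payoff_eq_top {V : Type*} (G : MCRGame V) {π : ℕ → V} (h : ∀ j, π j ∉ G.target) :
    G.payoff π = ⊤ :=
  dif_neg fun ⟨j, hj⟩ => h j hj

/-- Max (at `0`) may stop with weight `-W` or move to Min (at `1`), who may stop with weight `0` or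
move back with weight `-1`. The target is `2`. Min has to move back until the payoff is lower than
what Max gets for stopping. -/
def memoryGame (W : ℕ) : MCRGame (Fin 3) where
  maxV := {0}
  edges := {(0, 1), (0, 2), (1, 0), (1, 2), (2, 2)}
  weight u v := if u = 0 ∧ v = 2 then -W else if u = 1 ∧ v = 0 then -1 else 0
  deadlockFree v := by
    refine ⟨2, ?_⟩
    fin_cases v <;> simp
  target := {2}

theorem memoryGame_maxWeight {W : ℕ} (hW : 1 ≤ W) : (memoryGame W).maxWeight = W := by
  simp [WeightedGraph.maxWeight, memoryGame, hW]

theorem memoryGame_succ_one {W : ℕ} {u : Fin 3} (h : (1, u) ∈ (memoryGame W).edges) :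
    u = 0 ∨ u = 2 := by
  simpa [memoryGame] using h

theorem memoryGame_limitVec {W : ℕ} : (memoryGame W).limitVec 0 = ofInt (-W) ∧
    (memoryGame W).limitVec 1 = ofInt (-W - 1) := by
  set G := memoryGame W with hG
  have g2 : G.limitVec 2 = ofInt 0 := G.limitVec_target (by simp [hG, memoryGame])
  have h0 : G.limitVec 0 = G.best G.limitVec 0 := by
    conv_lhs => rw [← G.op_limitVec]
    exact G.op_not_target (by simp [hG, memoryGame])
  have h1 : G.limitVec 1 = G.best G.limitVec 1 := by
    conv_lhs => rw [← G.op_limitVec]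
    exact G.op_not_target (by simp [hG, memoryGame])
  have w02 : G.weight 0 2 = -W := by simp [hG, memoryGame]
  have w01 : G.weight 0 1 = 0 := by simp [hG, memoryGame]
  have w10 : G.weight 1 0 = -1 := by simp [hG, memoryGame]
  have w12 : G.weight 1 2 = 0 := by simp [hG, memoryGame]
  have m0 : (0 : Fin 3) ∈ G.maxV := by simp [hG, memoryGame]
  have m1 : (1 : Fin 3) ∉ G.maxV := by simp [hG, memoryGame]
  have a1 : ofInt (-W) ≤ G.limitVec 0 := by
    have := G.le_best_of_max (x := G.limitVec) m0 (u := 2) (by simp [hG, memoryGame])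
    rwa [g2, w02, Zbar.ofInt_add, add_zero, ← h0] at this
  have a2 : G.limitVec 1 ≤ ofInt 0 := by
    have := G.best_le_of_min (x := G.limitVec) m1 (u := 2) (by simp [hG, memoryGame])
    rwa [g2, w12, Zbar.ofInt_add, add_zero, ← h1] at this
  have a3 : G.limitVec 1 ≤ ofInt (-1) + G.limitVec 0 := by
    have := G.best_le_of_min (x := G.limitVec) m1 (u := 0) (by simp [hG, memoryGame])
    rwa [w10, ← h1] at this
  have a4 : G.limitVec 0 = ofInt (-W) ∨ G.limitVec 0 = G.limitVec 1 := by
    obtain ⟨u, hu, h⟩ := G.exists_best G.limitVec 0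
    rw [← h0] at h
    have : u = 1 ∨ u = 2 := by simpa [hG, memoryGame] using hu
    rcases this with rfl | rfl
    · right; rwa [w01, Zbar.ofInt_zero_add] at h
    · left; rwa [w02, g2, Zbar.ofInt_add, add_zero] at h
  have a5 : G.limitVec 0 = ofInt (-W) := by
    rcases a4 with h | h
    · exact h
    · rw [← h] at a2 a3
      obtain ⟨k, hk⟩ := Zbar.exists_ofInt ((Zbar.bot_lt_ofInt _).trans_le a1).ne'
        (a2.trans_lt (Zbar.ofInt_lt_top 0)).ne
      rw [hk, Zbar.ofInt_add, Zbar.ofInt_le] at a3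
      omega
  refine ⟨a5, le_antisymm ?_ ?_⟩
  · rw [a5, Zbar.ofInt_add] at a3
    exact a3.trans (Zbar.ofInt_le.2 (by omega))
  · rw [h1]
    refine G.le_best_of_forall fun u hu => ?_
    rcases memoryGame_succ_one hu with rfl | rfl
    · rw [w10, a5, Zbar.ofInt_add, Zbar.ofInt_le]; omega
    · rw [w12, g2, Zbar.ofInt_add, Zbar.ofInt_le]; omega

/-- While Max and Min move back and forth, the memory states are all different, as otherwise Min
would go on forever. -/
theorem memoryGame_lt_size {W K : ℕ} {G : MCRGame (Fin 3)} (hG : G = memoryGame W)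
    (M : Moore (Fin 3) K) (τ : G.MinStrategy) (hM : M.Encodes τ) (hτ : G.OptimalMin τ) :
    W + 1 < K := by
  have hlim : G.limitVec 1 = ofInt (-W - 1) := by rw [hG]; exact memoryGame_limitVec.2
  set F : Fin K → Fin K := fun m => M.update (M.update m 0) 1 with hF
  set σ : G.MaxStrategy := G.tableStrategy _ (fun _ => 1) (by
    intro v hv
    have : v = 0 := by simpa [hG, memoryGame] using hv
    rw [this]; simp [hG, memoryGame])
  set π := G.outcome 1 σ τ with hπ
  have m0 : (0 : Fin 3) ∈ G.maxV := by simp [hG, memoryGame]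
  have m1 : (1 : Fin 3) ∉ G.maxV := by simp [hG, memoryGame]
  have hpay : G.payoff π ≤ ofInt (-W - 1) := by
    have h1 : G.payoff π ≤ G.minGuarantee G.payoff 1 τ :=
      le_iSup (fun σ => G.payoff (G.outcome 1 σ τ)) σ
    rwa [hτ 1, G.upper_eq_limitVec, hlim] at h1
  set d : ℕ → Fin 3 := fun j => M.decision (F^[j] M.start) 1 with hd
  have hrun : ∀ j, (∀ i < j, d i = 0) → π (2 * j) = 1 ∧
      M.memory (G.outcomeAux 1 σ τ (2 * j)).1 1 = F^[j] M.start ∧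
      G.totalPayoff π (2 * j) = -j ∧ ∀ i < 2 * j, π i ∉ G.target := by
    intro j
    induction j with
    | zero => exact fun _ => ⟨rfl, rfl, rfl, fun i hi => by omega⟩
    | succ j ih =>
      intro h
      obtain ⟨h1, h2, h3, h4⟩ := ih fun i hi => h i (by omega)
      have h5 : π (2 * j + 1) = 0 := by
        refine (G.outcome_succ_min (k := 2 * j) (by rw [← hπ, h1]; exact m1)).trans ?_
        rw [← hπ, h1, hM _ _ m1, h2]
        exact h j (by omega)
      have h6 : π (2 * j + 1 + 1) = 1 := G.outcome_succ_max (k := 2 * j + 1) (by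
        rw [← hπ, h5]; exact m0)
      refine ⟨h6, ?_, ?_, fun i hi => ?_⟩
      · have : M.memory (G.outcomeAux 1 σ τ (2 * j + 1 + 1)).1 1 =
            M.update (M.update (M.memory (G.outcomeAux 1 σ τ (2 * j)).1 (π (2 * j)))
              (π (2 * j + 1))) 1 := rfl
        rw [Function.iterate_succ_apply']
        change M.memory (G.outcomeAux 1 σ τ (2 * j + 1 + 1)).1 1 = _
        rw [this, h1, h5, h2]
      · change G.totalPayoff π (2 * j + 1 + 1) = _
        rw [WeightedGraph.totalPayoff_succ, WeightedGraph.totalPayoff_succ, h3, h1, h5, h6]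
        have w10 : G.weight 1 0 = -1 := by simp [hG, memoryGame]
        have w01 : G.weight 0 1 = 0 := by simp [hG, memoryGame]
        rw [w10, w01]; push_cast; ring
      · by_cases hi' : i < 2 * j
        · exact h4 i hi'
        · rcases (by omega : i = 2 * j ∨ i = 2 * j + 1) with rfl | rfl
          · rw [h1]; simp [hG, memoryGame]
          · rw [h5]; simp [hG, memoryGame]
  by_cases hex : ∃ j, d j ≠ 0
  · set J := Nat.find hex with hJ
    obtain ⟨h1, h2, h3, h4⟩ := hrun J fun i hi => not_not.1 (Nat.find_min hex hi)
    have hnext : π (2 * J + 1) = d J := by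
      refine (G.outcome_succ_min (k := 2 * J) (by rw [← hπ, h1]; exact m1)).trans ?_
      rw [← hπ, h1, hM _ _ m1, h2]
    have h5 : π (2 * J + 1) = 2 := by
      have he : (π (2 * J), π (2 * J + 1)) ∈ G.edges := G.outcome_edge 1 σ τ (2 * J)
      rw [h1] at he
      refine (memoryGame_succ_one (hG ▸ he)).resolve_left fun h => ?_
      exact Nat.find_spec hex (hnext ▸ h)
    have hp := G.payoff_eq (π := π) (k := 2 * J + 1) (by rw [h5]; simp [hG, memoryGame]) (by
      intro i hi
      by_cases hi' : i < 2 * J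
      · exact h4 i hi'
      · rw [(by omega : i = 2 * J), h1]; simp [hG, memoryGame])
    have w12 : G.weight 1 2 = 0 := by simp [hG, memoryGame]
    rw [hp, WeightedGraph.totalPayoff_succ, h3, h1, h5, w12, Zbar.ofInt_le] at hpay
    have hinj : Function.Injective fun i : Fin (J + 1) => F^[i] M.start := by
      have key : ∀ i j, i < j → j ≤ J → F^[i] M.start ≠ F^[j] M.start := by
        intro i j hij hjJ heq
        have h6 : d (J - j + i) = d J := by
          simp only [hd]
          rw [Function.iterate_add_apply, heq, ← Function.iterate_add_apply,
            Nat.sub_add_cancel hjJ]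
        exact Nat.find_spec hex (h6 ▸ not_not.1 (Nat.find_min hex (m := J - j + i) (by omega)))
      intro a b hab
      rcases lt_trichotomy (a : ℕ) b with h | h | h
      · exact absurd hab (key a b h (by omega))
      · exact Fin.ext h
      · exact absurd hab.symm (key b a h (by omega))
    have := Fintype.card_le_of_injective _ hinj
    simp only [Fintype.card_fin] at this
    omega
  · push Not at hex
    have : G.payoff π = ⊤ := G.payoff_eq_top fun i =>
      (hrun (i + 1) fun j _ => hex j).2.2.2 i (by omega)
    rw [this] at hpay
    exact absurd hpay (not_le.2 (Zbar.ofInt_lt_top _))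

theorem exists_memory_lower_bound (W : ℕ) (hW : 1 ≤ W) :
    ∃ G : MCRGame (Fin 3), G.maxWeight = W ∧ (∀ v, G.value v ≠ ⊥ ∧ G.value v ≠ ⊤) ∧
      (∀ τ : G.MinStrategy, G.OptimalMin τ → ¬ τ.Memoryless) ∧
      (∀ (K : ℕ) (M : Moore (Fin 3) K) (τ : G.MinStrategy),
        M.Encodes τ → G.OptimalMin τ → W + 1 ≤ K) := by
  refine ⟨memoryGame W, memoryGame_maxWeight hW, fun v => ?_, fun τ hτ hmem => ?_,
    fun K M τ hM hτ => (memoryGame_lt_size rfl M τ hM hτ).le⟩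
  · rw [value_eq_limitVec]
    obtain ⟨h0, h1⟩ := memoryGame_limitVec (W := W)
    have h2 : (memoryGame W).limitVec 2 = ofInt 0 :=
      (memoryGame W).limitVec_target (by simp [memoryGame])
    fin_cases v
    · change (memoryGame W).limitVec 0 ≠ ⊥ ∧ (memoryGame W).limitVec 0 ≠ ⊤
      rw [h0]; exact ⟨Zbar.ofInt_ne_bot _, Zbar.ofInt_ne_top _⟩
    · change (memoryGame W).limitVec 1 ≠ ⊥ ∧ (memoryGame W).limitVec 1 ≠ ⊤
      rw [h1]; exact ⟨Zbar.ofInt_ne_bot _, Zbar.ofInt_ne_top _⟩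
    · change (memoryGame W).limitVec 2 ≠ ⊥ ∧ (memoryGame W).limitVec 2 ≠ ⊤
      rw [h2]; exact ⟨Zbar.ofInt_ne_bot _, Zbar.ofInt_ne_top _⟩
  · -- A memoryless strategy is given by a machine with one memory state.
    have := memoryGame_lt_size rfl (K := 1) ⟨0, fun _ _ => 0, fun _ v => τ.next [] v⟩ τ
      (fun h v hv => hmem h [] v hv) hτ
    omega

end MCRGame

/-! ### Verification of programs with time bounds -/

namespace RAM

/-- Started in the memory `s`, the program halts within `t` steps with a memory that has the
property `Q`. -/
def Runs (c : Cmd) (s : State) (t : ℕ) (Q : State → Prop) : Prop :=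
  ∃ t' s', t' ≤ t ∧ Exec c s t' s' ∧ Q s'

/-- The arrays that a program may change. All other arrays are the frame, which is preserved. -/
def Cmd.writes : Cmd → List ℕ
  | .skip => []
  | .store a _ _ => [a]
  | .seq c₁ c₂ => c₁.writes ++ c₂.writes
  | .ifLe _ _ c₁ c₂ => c₁.writes ++ c₂.writes
  | .whileLe _ _ c => c.writes

@[simp] theorem State.set_of_ne {s : State} {a b : ℕ} {i x : ℤ} (h : b ≠ a) :
    s.set a i x b = s b := by
  funext j
  exact if_neg fun h' => h h'.1

@[simp] theorem State.set_apply {s : State} {a : ℕ} {i x j : ℤ} :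
    s.set a i x a j = if j = i then x else s a j := by
  unfold State.set
  by_cases h : j = i <;> simp [h]

theorem Exec.eq_of_notMem_writes {c : Cmd} {s s' : State} {t : ℕ} (h : Exec c s t s') :
    ∀ a ∉ c.writes, s' a = s a := by
  induction h with
  | skip s => exact fun _ _ => rfl
  | store s a i e =>
    intro b hb
    exact State.set_of_ne fun h => hb (by simp [Cmd.writes, h])
  | seq _ _ h₁ h₂ =>
    intro a ha
    simp only [Cmd.writes, List.mem_append, not_or] at ha
    exact (h₂ a ha.2).trans (h₁ a ha.1)
  | ifTrue _ _ h =>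
    intro a ha
    simp only [Cmd.writes, List.mem_append, not_or] at ha
    exact h a ha.1
  | ifFalse _ _ h =>
    intro a ha
    simp only [Cmd.writes, List.mem_append, not_or] at ha
    exact h a ha.2
  | whileTrue _ _ _ h₁ h₂ => exact fun a ha => (h₂ a ha).trans (h₁ a ha)
  | whileFalse _ => exact fun _ _ => rfl

namespace Runs

variable {c c₁ c₂ : Cmd} {s : State} {t t₁ t₂ : ℕ} {P Q : State → Prop}

theorem mono (h : Runs c s t₁ P) (ht : t₁ ≤ t₂) (hPQ : ∀ s', P s' → Q s') : Runs c s t₂ Q := by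
  obtain ⟨t', s', h1, h2, h3⟩ := h
  exact ⟨t', s', h1.trans ht, h2, hPQ s' h3⟩

theorem frame (h : Runs c s t P) : Runs c s t fun s' => P s' ∧ ∀ a ∉ c.writes, s' a = s a := by
  obtain ⟨t', s', h1, h2, h3⟩ := h
  exact ⟨t', s', h1, h2, h3, h2.eq_of_notMem_writes⟩

theorem seq (h₁ : Runs c₁ s t₁ P)
    (h₂ : ∀ s', P s' → (∀ a ∉ c₁.writes, s' a = s a) → Runs c₂ s' t₂ Q)
    (ht : t₁ + t₂ + 1 ≤ t) : Runs (.seq c₁ c₂) s t Q := by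
  obtain ⟨t', s', a1, a2, a3, a4⟩ := h₁.frame
  obtain ⟨t'', s'', b1, b2, b3⟩ := h₂ s' a3 a4
  exact ⟨_, s'', by omega, .seq a2 b2, b3⟩

end Runs

/-- Programs without loops. -/
def Cmd.straight : Cmd → Bool
  | .skip => true
  | .store _ _ _ => true
  | .seq c₁ c₂ => c₁.straight && c₂.straight
  | .ifLe _ _ c₁ c₂ => c₁.straight && c₂.straight
  | .whileLe _ _ _ => false

/-- The memory after the execution of a program without loops; the value at loops is junk. -/
def Cmd.run : Cmd → State → State
  | .skip, s => s
  | .store a i e, s => s.set a (i.eval s) (e.eval s)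
  | .seq c₁ c₂, s => c₂.run (c₁.run s)
  | .ifLe e₁ e₂ c₁ c₂, s => if e₁.eval s ≤ e₂.eval s then c₁.run s else c₂.run s
  | .whileLe _ _ _, s => s

/-- The number of steps that a program without loops needs at most; the value at loops is junk. -/
def Cmd.cost : Cmd → ℕ
  | .skip => 1
  | .store _ i e => i.cost + e.cost + 1
  | .seq c₁ c₂ => c₁.cost + c₂.cost + 1
  | .ifLe e₁ e₂ c₁ c₂ => e₁.cost + e₂.cost + max c₁.cost c₂.cost + 1
  | .whileLe _ _ _ => 0

theorem Cmd.exists_exec (c : Cmd) (h : c.straight = true) (s : State) :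
    ∃ t ≤ c.cost, Exec c s t (c.run s) := by
  induction c generalizing s with
  | skip => exact ⟨1, le_rfl, .skip s⟩
  | store a i e => exact ⟨_, le_rfl, .store s a i e⟩
  | seq c₁ c₂ ih₁ ih₂ =>
    simp only [straight, Bool.and_eq_true] at h
    obtain ⟨t₁, h₁, e₁⟩ := ih₁ h.1 s
    obtain ⟨t₂, h₂, e₂⟩ := ih₂ h.2 (c₁.run s)
    exact ⟨_, by simp only [cost]; omega, .seq e₁ e₂⟩
  | ifLe e₁ e₂ c₁ c₂ ih₁ ih₂ =>
    simp only [straight, Bool.and_eq_true] at h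
    by_cases hc : e₁.eval s ≤ e₂.eval s
    · obtain ⟨t₁, h₁, x₁⟩ := ih₁ h.1 s
      refine ⟨e₁.cost + e₂.cost + t₁ + 1, by simp only [cost]; omega, ?_⟩
      rw [run, if_pos hc]
      exact .ifTrue hc x₁
    · obtain ⟨t₂, h₂, x₂⟩ := ih₂ h.2 s
      refine ⟨e₁.cost + e₂.cost + t₂ + 1, by simp only [cost]; omega, ?_⟩
      rw [run, if_neg hc]
      exact .ifFalse hc x₂
  | whileLe => simp [straight] at h

theorem Cmd.run_eq_of_notMem_writes {c : Cmd} (h : c.straight = true) (s : State) {a : ℕ}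
    (ha : a ∉ c.writes) : c.run s a = s a := by
  obtain ⟨_, _, he⟩ := c.exists_exec h s
  exact he.eq_of_notMem_writes a ha

theorem Runs.straight {c : Cmd} {s : State} {t : ℕ} {Q : State → Prop} (h : c.straight = true)
    (ht : c.cost ≤ t) (hQ : Q (c.run s)) : Runs c s t Q := by
  obtain ⟨t', h', he⟩ := c.exists_exec h s
  exact ⟨t', _, h'.trans ht, he, hQ⟩

/-- The content of a variable, i.e. the entry `0` of an array. -/
abbrev var (a : ℕ) : Expr := .read a (.const 0)

/-- Assignment to a variable. -/
abbrev setVar (a : ℕ) (e : Expr) : Cmd := .store a (.const 0) e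

/-- The body is executed for the values of the variable `i` from `0` up to, but not including, that
of the variable `b`. -/
def forLoop (i b : ℕ) (c : Cmd) : Cmd :=
  .seq (setVar i (.const 0)) (.whileLe (.plus (var i) (.const 1)) (var b)
    (.seq c (setVar i (.plus (var i) (.const 1)))))

theorem forLoop_writes (i b : ℕ) (c : Cmd) : (forLoop i b c).writes = i :: (c.writes ++ [i]) := rfl

/-- The rule for loops, with the invariant `Inv`. As neither the loop variable nor the bound is
changed by the body, an iteration costs `14` steps besides those of the body. -/
theorem Runs.forLoop {i b N t T : ℕ} {c : Cmd} {s : State} {Q : State → Prop}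
    (Inv : ℕ → State → Prop) (hib : i ≠ b) (hi : i ∉ c.writes) (hb : b ∉ c.writes)
    (hN : s b 0 = N) (h0 : Inv 0 (s.set i 0 0))
    (hstep : ∀ k < N, ∀ s' : State, (∀ a ∉ c.writes, a ≠ i → s' a = s a) → s' i 0 = k → Inv k s' →
      Runs c s' t fun s'' => Inv (k + 1) (s''.set i 0 (k + 1)))
    (hQ : ∀ s' : State, (∀ a ∉ c.writes, a ≠ i → s' a = s a) → Inv N s' → Q s')
    (hT : N * (t + 14) + 11 ≤ T) :
    Runs (forLoop i b c) s T Q := by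
  have key : ∀ j k, k + j = N → ∀ s' : State, (∀ a ∉ c.writes, a ≠ i → s' a = s a) → s' i 0 = k →
      Inv k s' → Runs (.whileLe (.plus (var i) (.const 1)) (var b)
        (.seq c (setVar i (.plus (var i) (.const 1))))) s' (j * (t + 14) + 7) Q := by
    intro j
    induction j with
    | zero =>
      intro k hk s' hs hki hInv
      refine ⟨_, s', ?_, .whileFalse ?_, hQ s' hs (by rwa [show N = k by omega])⟩
      · simp [Expr.cost]
      · simp only [Expr.eval, hki, hs b hb hib.symm, hN]
        omega
    | succ j ih =>
      intro k hk s' hs hki hInv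
      obtain ⟨t₁, s₁, h1, h2, h3, h4⟩ := (hstep k (by omega) s' hs hki hInv).frame
      have hki₁ : s₁ i 0 = k := by rw [h4 i hi, hki]
      obtain ⟨t₂, s₂, g1, g2, g3⟩ := ih (k + 1) (by omega) (s₁.set i 0 (k + 1))
        (fun a ha hai => by rw [State.set_of_ne hai, h4 a ha, hs a ha hai])
        (by simp) h3
      have hst : Exec (setVar i (.plus (var i) (.const 1))) s₁ 6 (s₁.set i 0 (k + 1)) := by
        have := Exec.store s₁ i (.const 0) (.plus (var i) (.const 1))
        simpa only [Expr.eval, Expr.cost, hki₁] using this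
      refine ⟨_, s₂, ?_, .whileTrue ?_ (.seq h2 hst) g2, g3⟩
      · simp only [Expr.cost]
        rw [Nat.succ_mul]
        omega
      · simp only [Expr.eval, hki, hs b hb hib.symm, hN]
        omega
  have hst : Exec (setVar i (.const 0)) s 3 (s.set i 0 0) := Exec.store s i (.const 0) (.const 0)
  obtain ⟨t', s', h1, h2, h3⟩ := key N 0 (by omega) (s.set i 0 0)
    (fun a _ hai => State.set_of_ne hai) (by simp) h0
  exact ⟨_, s', by omega, .seq hst h2, h3⟩

/-! ### Lists in the memory -/

theorem listArray_natCast (x : List ℤ) (i : ℕ) : listArray x i = x.getD i 0 := by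
  simp [listArray]

theorem getD_append_left {x y : List ℤ} {i : ℕ} (h : i < x.length) :
    (x ++ y).getD i 0 = x.getD i 0 := by
  simp [List.getD_eq_getElem?_getD, List.getElem?_append_left h]

theorem getD_append_add (x y : List ℤ) (i : ℕ) :
    (x ++ y).getD (x.length + i) 0 = y.getD i 0 := by
  simp [List.getD_eq_getElem?_getD, List.getElem?_append_right]

/-- The array `a` holds the list `z`, and the variable `p` its length. -/
def Holds (a p : ℕ) (z : List ℤ) (s : State) : Prop :=
  s p 0 = (z.length : ℤ) ∧ ∀ i : ℕ, i < z.length → s a (i : ℤ) = z.getD i 0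

theorem Holds.congr {a p : ℕ} {z : List ℤ} {s s' : State} (h : Holds a p z s)
    (ha : s' a = s a) (hp : s' p = s p) : Holds a p z s' := by
  unfold Holds
  rw [ha, hp]
  exact h

/-- Appends the value of an expression to the list that the array `a` holds. -/
def push (a p : ℕ) (e : Expr) : Cmd :=
  .seq (.store a (var p) e) (setVar p (.plus (var p) (.const 1)))

theorem Runs.push {a p : ℕ} (hap : a ≠ p) {e : Expr} {z : List ℤ} {s : State} {t : ℕ}
    (h : Holds a p z s) (ht : e.cost + 10 ≤ t) :
    Runs (push a p e) s t fun s' => Holds a p (z ++ [e.eval s]) s' := by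
  refine Runs.straight rfl ?_ ⟨?_, fun i hi => ?_⟩
  · simp only [RAM.push, Cmd.cost, Expr.cost]; omega
  · simp [RAM.push, Cmd.run, Expr.eval, hap.symm, h.1]
  · simp only [RAM.push, Cmd.run, Expr.eval, State.set_of_ne hap, State.set_apply, h.1]
    rw [List.length_append, List.length_singleton] at hi
    by_cases hi' : i = z.length
    · subst hi'
      simp
    · rw [if_neg (by omega), h.2 i (by omega), getD_append_left (by omega)]

/-- A loop whose body appends a list that depends on the value of the loop variable. -/
theorem Runs.pushLoop {α : Type*} (l : List α) (f : α → List ℤ) {a p i b t T : ℕ} {c : Cmd}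
    {s : State} {z : List ℤ} {Q : State → Prop}
    (hia : i ≠ a) (hip : i ≠ p) (hib : i ≠ b) (hi : i ∉ c.writes) (hb : b ∉ c.writes)
    (hN : s b 0 = l.length) (hz : Holds a p z s)
    (hbody : ∀ (k : ℕ) (hk : k < l.length) (s' : State), (∀ a ∉ c.writes, a ≠ i → s' a = s a) →
      s' i 0 = k → ∀ z', Holds a p z' s' → Runs c s' t fun s'' => Holds a p (z' ++ f l[k]) s'')
    (hQ : ∀ s' : State, (∀ a ∉ c.writes, a ≠ i → s' a = s a) → Holds a p (z ++ l.flatMap f) s' →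
      Q s')
    (hT : l.length * (t + 14) + 11 ≤ T) :
    Runs (RAM.forLoop i b c) s T Q := by
  refine Runs.forLoop (fun k s' => Holds a p (z ++ (l.take k).flatMap f) s') hib hi hb hN ?_ ?_ ?_
    hT
  · simp only [List.take_zero, List.flatMap_nil, List.append_nil]
    exact hz.congr (State.set_of_ne hia.symm) (State.set_of_ne hip.symm)
  · intro k hk s' hs hki hInv
    refine (hbody k hk s' hs hki _ hInv).mono le_rfl fun s'' h => ?_
    rw [List.take_add_one, List.getElem?_eq_getElem hk, Option.toList_some, List.flatMap_append,
      List.flatMap_singleton, ← List.append_assoc]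
    exact h.congr (State.set_of_ne hia.symm) (State.set_of_ne hip.symm)
  · intro s' hs h
    rw [List.take_length] at h
    exact hQ s' hs h

theorem Runs.outputsWithin {c : Cmd} {x y z : List ℤ} {t T : ℕ}
    (h : Runs c (startState x y) t fun s => Holds 0 1 z s) (ht : t ≤ T) :
    OutputsWithin c x y T z := by
  obtain ⟨t', s, h1, h2, h3⟩ := h
  exact ⟨t', s, h1.trans ht, h2, h3⟩

end RAM

/-! ### Games and vectors in the memory

All programs use the memory in the same way. The arrays `0` and `1` contain first the input and then
the output, the array `2` the certificate. A game occupies the arrays `4` (owners), `5` (target),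
`6` to `8` (sources, targets and weights of the edges), `9` and `10` (numbers of vertices and
edges), and the vertex of an instance the array `11`. Vectors over `ℤ ∪ {-∞, +∞}` are pairs of
arrays: tags and integers. The current vector is in `12` and `13`, the next one is built in `14` and
`15`, with the best moves in `16`. The clipping bound is in `17`, the number of iterations in `24`;
`18` and `19` are loop variables, `20` and `21` auxiliary variables, and `22` and `23` a list of
tables of moves. -/

/-- The first component of the code of a value: its sign if it is infinite, and `0` otherwise. The
second component is `Zbar.toInt`, so that the order is the lexicographic one. -/
def Zbar.tag : Zbar → ℤ
  | none => -1
  | some none => 1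
  | some (some _) => 0

theorem Zbar.code_eq (x : Zbar) : x.code = [x.tag, x.toInt] := by
  rcases x with _ | _ | k <;> rfl

theorem Zbar.le_iff_tag {x y : Zbar} :
    x ≤ y ↔ x.tag + 1 ≤ y.tag ∨ x.tag ≤ y.tag ∧ x.toInt ≤ y.toInt := by
  rcases cases' x with rfl | rfl | ⟨k, rfl⟩ <;> rcases cases' y with rfl | rfl | ⟨j, rfl⟩ <;>
    simp [Zbar.tag, Zbar.toInt]

theorem Zbar.tag_eq (x : Zbar) : x.tag = if x = ⊥ then -1 else if x = ⊤ then 1 else 0 := by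
  rcases cases' x with rfl | rfl | ⟨k, rfl⟩ <;> simp [Zbar.tag]

namespace RAM

/-- The game with the edges `es` is stored in the arrays `4` to `10`. -/
structure HoldsGame {n : ℕ} (G : MCRGame (Fin n)) (es : List (Fin n × Fin n)) (s : State) :
    Prop where
  own : ∀ v : Fin n, s 4 ((v : ℕ) : ℤ) = if v ∈ G.maxV then 1 else 0
  tgt : ∀ v : Fin n, s 5 ((v : ℕ) : ℤ) = if v ∈ G.target then 1 else 0
  src : ∀ (k : ℕ) (h : k < es.length), s 6 (k : ℤ) = ((es[k].1 : ℕ) : ℤ)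
  dst : ∀ (k : ℕ) (h : k < es.length), s 7 (k : ℤ) = ((es[k].2 : ℕ) : ℤ)
  wt : ∀ (k : ℕ) (h : k < es.length), s 8 (k : ℤ) = G.weight es[k].1 es[k].2
  card : s 9 0 = (n : ℤ)
  size : s 10 0 = (es.length : ℤ)

theorem HoldsGame.congr {n : ℕ} {G : MCRGame (Fin n)} {es : List (Fin n × Fin n)} {s s' : State}
    (h : HoldsGame G es s) (hs : ∀ a ∈ [4, 5, 6, 7, 8, 9, 10], s' a = s a) :
    HoldsGame G es s' := by
  have h4 := hs 4 (by decide)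
  have h5 := hs 5 (by decide)
  have h6 := hs 6 (by decide)
  have h7 := hs 7 (by decide)
  have h8 := hs 8 (by decide)
  have h9 := hs 9 (by decide)
  have h10 := hs 10 (by decide)
  constructor
  · rw [h4]; exact h.own
  · rw [h5]; exact h.tgt
  · rw [h6]; exact h.src
  · rw [h7]; exact h.dst
  · rw [h8]; exact h.wt
  · rw [h9]; exact h.card
  · rw [h10]; exact h.size

/-- A vector is stored in the arrays `a` (for the tags) and `b` (for the integers). -/
def HoldsVec {n : ℕ} (a b : ℕ) (x : Fin n → Zbar) (s : State) : Prop :=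
  ∀ v : Fin n, s a ((v : ℕ) : ℤ) = (x v).tag ∧ s b ((v : ℕ) : ℤ) = (x v).toInt

theorem HoldsVec.congr {n a b : ℕ} {x : Fin n → Zbar} {s s' : State} (h : HoldsVec a b x s)
    (ha : s' a = s a) (hb : s' b = s b) : HoldsVec a b x s' := by
  unfold HoldsVec
  rw [ha, hb]
  exact h

theorem natCast_val_eq_iff {n : ℕ} {v w : Fin n} : ((v : ℕ) : ℤ) = ((w : ℕ) : ℤ) ↔ v = w := by
  rw [Nat.cast_inj, Fin.val_inj]

/-- If the first pair is at most the second one in the lexicographic order, then `c₁`, else `c₂`. -/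
def ifLexLe (t₁ i₁ t₂ i₂ : Expr) (c₁ c₂ : Cmd) : Cmd :=
  .ifLe (.plus t₁ (.const 1)) t₂ c₁ (.ifLe t₁ t₂ (.ifLe i₁ i₂ c₁ c₂) c₂)

theorem run_ifLexLe {t₁ i₁ t₂ i₂ : Expr} {c₁ c₂ : Cmd} {s : State} {x y : Zbar}
    (h₁ : t₁.eval s = x.tag) (h₂ : i₁.eval s = x.toInt) (h₃ : t₂.eval s = y.tag)
    (h₄ : i₂.eval s = y.toInt) :
    (ifLexLe t₁ i₁ t₂ i₂ c₁ c₂).run s = if x ≤ y then c₁.run s else c₂.run s := by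
  simp only [ifLexLe, Cmd.run, Expr.eval, h₁, h₂, h₃, h₄, Zbar.le_iff_tag]
  by_cases a : x.tag + 1 ≤ y.tag <;> by_cases b : x.tag ≤ y.tag <;>
    by_cases c : x.toInt ≤ y.toInt <;> simp [a, b, c]

/-! ### One iteration of value iteration -/

/-- The loop variable of the inner loops. -/
abbrev idx : Expr := var 18

/-- Sets the entries of the new vector (arrays `14` and `15`) to the worst values. -/
def worstBody : Cmd :=
  .seq (.ifLe (.const 1) (.read 4 idx) (.store 14 idx (.const (-1))) (.store 14 idx (.const 1)))
    (.store 15 idx (.const 0))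

/-- Computes the value of a move (variables `20` and `21`). -/
def moveValue : Cmd :=
  .seq (setVar 20 (.read 12 (.read 7 idx)))
    (.ifLe (var 20) (.const 0)
      (.ifLe (.const 0) (var 20) (setVar 21 (.plus (.read 13 (.read 7 idx)) (.read 8 idx)))
        (setVar 21 (.const 0)))
      (setVar 21 (.const 0)))

/-- Replaces the entry of the source of an edge. -/
def useMove : Cmd :=
  .seq (.store 14 (.read 6 idx) (var 20)) (.seq (.store 15 (.read 6 idx) (var 21))
    (.store 16 (.read 6 idx) (.read 7 idx)))

/-- Replaces the entry of the source of an edge if the edge is a better move for the owner. -/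
def compareMove : Cmd :=
  .ifLe (.const 1) (.read 4 (.read 6 idx))
    (ifLexLe (.read 14 (.read 6 idx)) (.read 15 (.read 6 idx)) (var 20) (var 21) useMove .skip)
    (ifLexLe (var 20) (var 21) (.read 14 (.read 6 idx)) (.read 15 (.read 6 idx)) useMove .skip)

/-- Clips an entry of the new vector and moves it to the arrays `12` and `13`. -/
def clipBody : Cmd :=
  .ifLe (.const 1) (.read 5 idx) (.seq (.store 12 idx (.const 0)) (.store 13 idx (.const 0)))
    (ifLexLe (.const 0) (var 17) (.read 14 idx) (.read 15 idx)
      (.seq (.store 12 idx (.read 14 idx)) (.store 13 idx (.read 15 idx)))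
      (.seq (.store 12 idx (.const (-1))) (.store 13 idx (.const 0))))

/-- One step of value iteration on the vector in the arrays `12` and `13`, with the clipping bound
in the variable `17`. The best moves are stored in the array `16`. -/
def iteration : Cmd :=
  .seq (forLoop 18 9 worstBody) (.seq (forLoop 18 10 (.seq moveValue compareMove))
    (forLoop 18 9 clipBody))

variable {n : ℕ} {G : MCRGame (Fin n)} {es : List (Fin n × Fin n)} {x : Fin n → Zbar} {s : State}

theorem run_moveValue (hG : HoldsGame G es s) (hx : HoldsVec 12 13 x s) {k : ℕ}
    (hk : k < es.length) (hi : s 18 0 = k) :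
    moveValue.run s 20 0 = (ofInt (G.weight es[k].1 es[k].2) + x es[k].2).tag ∧
    moveValue.run s 21 0 = (ofInt (G.weight es[k].1 es[k].2) + x es[k].2).toInt := by
  obtain ⟨h1, h2⟩ := hx es[k].2
  rcases Zbar.cases' (x es[k].2) with h | h | ⟨j, h⟩
  · rw [h] at h1 h2 ⊢
    rw [Zbar.ofInt_add_bot]
    simp [moveValue, Cmd.run, Expr.eval, hi, hG.dst k hk, h1, Zbar.tag, Zbar.toInt]
  · rw [h] at h1 h2 ⊢
    rw [Zbar.ofInt_add_top]
    simp [moveValue, Cmd.run, Expr.eval, hi, hG.dst k hk, h1, Zbar.tag, Zbar.toInt]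
  · rw [h] at h1 h2 ⊢
    rw [Zbar.ofInt_add]
    simp [moveValue, Cmd.run, Expr.eval, hi, hG.dst k hk, hG.wt k hk, h1, h2, Zbar.tag, Zbar.toInt,
      add_comm]

/-- The second value is at least as good as the first one for the owner of a vertex. -/
def Better (G : MCRGame (Fin n)) (v : Fin n) (a b : Zbar) : Prop :=
  if v ∈ G.maxV then a ≤ b else b ≤ a

theorem Better.trans {v : Fin n} {a b c : Zbar} (h : Better G v a b) (h' : Better G v b c) :
    Better G v a c := by
  unfold Better at *
  split_ifs at * <;> exact le_trans (by assumption) (by assumption)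

theorem Better.refl (v : Fin n) (a : Zbar) : Better G v a a := by
  unfold Better
  split_ifs <;> exact le_rfl

theorem Better.of_not {v : Fin n} {a b : Zbar} (h : ¬ Better G v a b) : Better G v b a := by
  unfold Better at *
  split_ifs at * <;> exact (not_le.1 h).le

/-- The value `y` is the best value of a move from `v` along an edge of the list `L`, and `c` is the
successor that this move leads to. -/
def BestMove (G : MCRGame (Fin n)) (x : Fin n → Zbar) (L : List (Fin n × Fin n)) (v : Fin n)
    (y : Zbar) (c : ℤ) : Prop :=
  (∀ u, (v, u) ∈ L → Better G v (ofInt (G.weight v u) + x u) y) ∧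
  ((y = (if v ∈ G.maxV then ⊥ else ⊤) ∧ ∀ u, (v, u) ∉ L) ∨
    ∃ u, (v, u) ∈ L ∧ c = ((u : ℕ) : ℤ) ∧ y = ofInt (G.weight v u) + x u)

theorem BestMove.of_ne {L : List (Fin n × Fin n)} {v : Fin n} {y : Zbar} {c : ℤ} {e : Fin n × Fin n}
    (h : BestMove G x L v y c) (hv : v ≠ e.1) : BestMove G x (L ++ [e]) v y c := by
  have hmem : ∀ u, (v, u) ∈ L ++ [e] ↔ (v, u) ∈ L := by
    intro u
    rw [List.mem_append, List.mem_singleton, or_iff_left]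
    exact fun h' => hv (by rw [← h'])
  unfold BestMove
  simp only [hmem]
  exact h

theorem BestMove.keep {L : List (Fin n × Fin n)} {y : Zbar} {c : ℤ} {e : Fin n × Fin n}
    (h : BestMove G x L e.1 y c) (hb : ¬ Better G e.1 y (ofInt (G.weight e.1 e.2) + x e.2)) :
    BestMove G x (L ++ [e]) e.1 y c := by
  refine ⟨fun u hu => ?_, ?_⟩
  · rcases List.mem_append.1 hu with hu | hu
    · exact h.1 u hu
    · obtain rfl : u = e.2 := by rw [← List.mem_singleton.1 hu]
      exact Better.of_not hb
  · right
    rcases h.2 with ⟨hy, -⟩ | ⟨u, hu, hc, hy⟩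
    · exfalso
      apply hb
      unfold Better
      rw [hy]
      split_ifs
      · exact bot_le
      · exact le_top
    · exact ⟨u, List.mem_append_left _ hu, hc, hy⟩

theorem BestMove.replace {L : List (Fin n × Fin n)} {y : Zbar} {c : ℤ} {e : Fin n × Fin n}
    (h : BestMove G x L e.1 y c) (hb : Better G e.1 y (ofInt (G.weight e.1 e.2) + x e.2)) :
    BestMove G x (L ++ [e]) e.1 (ofInt (G.weight e.1 e.2) + x e.2) ((e.2 : ℕ) : ℤ) := by
  refine ⟨fun u hu => ?_, Or.inr ⟨e.2, by simp, rfl, rfl⟩⟩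
  rcases List.mem_append.1 hu with hu | hu
  · exact (h.1 u hu).trans hb
  · obtain rfl : u = e.2 := by rw [← List.mem_singleton.1 hu]
    exact Better.refl _ _

theorem BestMove.eq_best (hes : ∀ e, e ∈ es ↔ e ∈ G.edges) {v : Fin n} {y : Zbar} {c : ℤ}
    (h : BestMove G x es v y c) : y = G.best x v ∧ ∃ u, c = ((u : Fin n) : ℕ) ∧ (v, u) ∈ G.edges ∧
      G.best x v = ofInt (G.weight v u) + x u := by
  obtain ⟨h1, h2⟩ := h
  obtain ⟨w, hw, hbest⟩ := G.exists_best x v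
  rcases h2 with ⟨-, h2⟩ | ⟨u, hu, hc, hy⟩
  · exact absurd ((hes _).2 hw) (h2 w)
  · have hub := (hes _).1 hu
    have h3 := h1 w ((hes _).2 hw)
    have hyb : y = G.best x v := by
      unfold Better at h3
      split_ifs at h3 with hm
      · exact le_antisymm (hy ▸ G.le_best_of_max hm hub) (hbest ▸ h3)
      · exact le_antisymm (hbest ▸ h3) (hy ▸ G.best_le_of_min hm hub)
    exact ⟨hyb, u, hc, hub, hyb ▸ hy⟩

theorem iteration_runs (hes : ∀ e, e ∈ es ↔ e ∈ G.edges) {θ : ℤ} (hG : HoldsGame G es s)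
    (hx : HoldsVec 12 13 x s) (hθ : s 17 0 = θ) :
    Runs iteration s (200 * (n + es.length + 1)) fun s' => HoldsVec 12 13 (G.clipStep θ x) s' ∧
      ∀ v : Fin n, ∃ u : Fin n, s' 16 ((v : ℕ) : ℤ) = ((u : ℕ) : ℤ) ∧ (v, u) ∈ G.edges ∧
        G.best x v = ofInt (G.weight v u) + x u := by
  -- The new vector is worst for the owners, before any edge is considered.
  refine Runs.seq (t₁ := n * (30 + 14) + 11) (t₂ := (es.length * (100 + 14) + 11) +
    (n * (40 + 14) + 11) + 1) (P := HoldsVec 14 15 fun v => if v ∈ G.maxV then ⊥ else ⊤)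
    (Runs.forLoop (fun k s' => ∀ v : Fin n, (v : ℕ) < k →
      s' 14 ((v : ℕ) : ℤ) = (if v ∈ G.maxV then (⊥ : Zbar) else ⊤).tag ∧
      s' 15 ((v : ℕ) : ℤ) = (if v ∈ G.maxV then (⊥ : Zbar) else ⊤).toInt)
      (by decide) (by decide) (by decide) hG.card (fun v hv => by omega) ?_
      (fun s' _ h v => h v v.2) le_rfl) ?_ (by omega)
  · intro k hk s' hs hki hInv
    refine Runs.straight rfl (by decide) fun v hv => ?_
    have h4 : s' 4 = s 4 := hs 4 (by decide) (by decide)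
    by_cases hvk : (v : ℕ) = k
    · have hown := hG.own v
      rw [hvk] at hown
      by_cases hm : v ∈ G.maxV
      · simp [worstBody, Cmd.run, Expr.eval, hki, h4, hown, hm, hvk, Zbar.tag, Zbar.toInt]
      · simp [worstBody, Cmd.run, Expr.eval, hki, h4, hown, hm, hvk, Zbar.tag, Zbar.toInt]
    · have hvk' : ((v : ℕ) : ℤ) ≠ (k : ℤ) := by exact_mod_cast hvk
      have := hInv v (by omega)
      by_cases h : (1 : ℤ) ≤ s' 4 k <;>
        simpa [worstBody, Cmd.run, Expr.eval, hki, hvk', h] using this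
  intro s₁ hy hs₁
  have hG₁ : HoldsGame G es s₁ := hG.congr fun a ha => hs₁ a (by revert ha; revert a; decide)
  have hx₁ : HoldsVec 12 13 x s₁ := hx.congr (hs₁ 12 (by decide)) (hs₁ 13 (by decide))
  -- After the first `k` edges, the new vector is best among these edges, or still the worst.
  refine Runs.seq (t₁ := es.length * (100 + 14) + 11) (t₂ := n * (40 + 14) + 11)
    (P := fun s' => ∀ v : Fin n, ∃ y : Zbar, s' 14 ((v : ℕ) : ℤ) = y.tag ∧
      s' 15 ((v : ℕ) : ℤ) = y.toInt ∧ BestMove G x es v y (s' 16 ((v : ℕ) : ℤ)))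
    (Runs.forLoop (fun k s' => ∀ v : Fin n, ∃ y : Zbar, s' 14 ((v : ℕ) : ℤ) = y.tag ∧
      s' 15 ((v : ℕ) : ℤ) = y.toInt ∧ BestMove G x (es.take k) v y (s' 16 ((v : ℕ) : ℤ)))
      (by decide) (by decide) (by decide) hG₁.size ?_ ?_ ?_ le_rfl) ?_ (by omega)
  · intro v
    refine ⟨_, (hy v).1, (hy v).2, by simp, Or.inl ⟨rfl, by simp⟩⟩
  · intro k hk s' hs hki hInv
    have hG' : HoldsGame G es s' :=
      hG₁.congr fun a ha => hs a (by revert ha; revert a; decide) (by revert ha; revert a; decide)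
    have hx' : HoldsVec 12 13 x s' :=
      hx₁.congr (hs 12 (by decide) (by decide)) (hs 13 (by decide) (by decide))
    obtain ⟨m₁, m₂⟩ := run_moveValue hG' hx' hk hki
    have hfr : ∀ a, a ≠ 20 → a ≠ 21 → moveValue.run s' a = s' a := by
      intro a h20 h21
      exact Cmd.run_eq_of_notMem_writes rfl s' (by simp [moveValue, Cmd.writes, h20, h21])
    rw [List.take_add_one, List.getElem?_eq_getElem hk, Option.toList_some]
    refine Runs.straight rfl (by decide) ?_
    rw [Cmd.run]
    obtain ⟨y, y₁, y₂, hbest⟩ := hInv es[k].1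
    have hG'' : HoldsGame G es (moveValue.run s') := hG'.congr fun a ha =>
      hfr a (by revert ha; revert a; decide) (by revert ha; revert a; decide)
    set r := moveValue.run s' with hr
    have hki' : r 18 0 = k := by rw [hfr 18 (by decide) (by decide), hki]
    have hsrc := hG''.src k hk
    have e14 : (Expr.read 14 (.read 6 idx)).eval r = y.tag := by
      simp only [Expr.eval, hki', hsrc, hfr 14 (by decide) (by decide), y₁]
    have e15 : (Expr.read 15 (.read 6 idx)).eval r = y.toInt := by
      simp only [Expr.eval, hki', hsrc, hfr 15 (by decide) (by decide), y₂]
    have e20 : (var 20).eval r = _ := m₁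
    have e21 : (var 21).eval r = _ := m₂
    have hcmp : compareMove.run r = if Better G es[k].1 y
        (ofInt (G.weight es[k].1 es[k].2) + x es[k].2) then useMove.run r else r := by
      unfold compareMove
      rw [Cmd.run, run_ifLexLe e14 e15 e20 e21, run_ifLexLe e20 e21 e14 e15]
      simp only [Expr.eval, hki', hsrc, hG''.own, Better, Cmd.run]
      by_cases hm : es[k].1 ∈ G.maxV <;> simp [hm]
    rw [hcmp]
    intro v
    by_cases hv : v = es[k].1
    · subst hv
      by_cases hb : Better G es[k].1 y (ofInt (G.weight es[k].1 es[k].2) + x es[k].2)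
      · rw [if_pos hb]
        refine ⟨ofInt (G.weight es[k].1 es[k].2) + x es[k].2, ?_, ?_, ?_⟩
        rotate_left 2
        · have : ((useMove.run r).set 18 0 (k + 1)) 16 ((es[k].1 : ℕ) : ℤ) =
              ((es[k].2 : ℕ) : ℤ) := by
            simp [useMove, Cmd.run, Expr.eval, hki', hsrc, hG''.dst k hk]
          rw [this]
          exact hbest.replace hb
        · simp [useMove, Cmd.run, Expr.eval, hki', hsrc, m₁]
        · simp [useMove, Cmd.run, Expr.eval, hki', hsrc, m₂]
      · rw [if_neg hb]
        refine ⟨y, ?_, ?_, ?_⟩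
        · simpa [hfr] using y₁
        · simpa [hfr] using y₂
        · have : (r.set 18 0 (k + 1)) 16 ((es[k].1 : ℕ) : ℤ) = s' 16 ((es[k].1 : ℕ) : ℤ) := by
            simp [hfr]
          rw [this]
          exact hbest.keep hb
    · obtain ⟨z, z₁, z₂, hz⟩ := hInv v
      have hvs : ((v : ℕ) : ℤ) ≠ ((es[k].1 : ℕ) : ℤ) := fun h => hv (natCast_val_eq_iff.1 h)
      have huse : ∀ a, a = 14 ∨ a = 15 ∨ a = 16 →
          ((if Better G es[k].1 y (ofInt (G.weight es[k].1 es[k].2) + x es[k].2)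
            then useMove.run r else r).set 18 0 (k + 1)) a ((v : ℕ) : ℤ) = s' a ((v : ℕ) : ℤ) := by
        intro a ha
        rcases ha with rfl | rfl | rfl <;> split_ifs <;>
          simp [useMove, Cmd.run, Expr.eval, hki', hsrc, hvs, hfr]
      refine ⟨z, ?_, ?_, ?_⟩
      · rw [huse 14 (by simp), z₁]
      · rw [huse 15 (by simp), z₂]
      · rw [huse 16 (by simp)]
        exact hz.of_ne hv
  · intro s' _ h
    rwa [List.take_length] at h
  intro s₂ hy₂ hs₂
  have hG₂ : HoldsGame G es s₂ := hG₁.congr fun a ha => hs₂ a (by revert ha; revert a; decide)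
  have hθ₂ : s₂ 17 0 = θ := by rw [hs₂ 17 (by decide), hs₁ 17 (by decide), hθ]
  -- The entries of the target are set to `0` and the small ones to `-∞`.
  refine Runs.forLoop (fun k s' => ∀ v : Fin n, (v : ℕ) < k →
      s' 12 ((v : ℕ) : ℤ) = (G.clipStep θ x v).tag ∧
      s' 13 ((v : ℕ) : ℤ) = (G.clipStep θ x v).toInt)
      (by decide) (by decide) (by decide) hG₂.card (fun v hv => by omega) ?_ ?_ le_rfl
  · intro k hk s' hs hki hInv
    refine Runs.straight rfl (by decide) fun v hv => ?_
    have f5 : s' 5 = s₂ 5 := hs 5 (by decide) (by decide)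
    have f14 : s' 14 = s₂ 14 := hs 14 (by decide) (by decide)
    have f15 : s' 15 = s₂ 15 := hs 15 (by decide) (by decide)
    have f17 : s' 17 = s₂ 17 := hs 17 (by decide) (by decide)
    by_cases hvk : (v : ℕ) = k
    · have htgt := hG₂.tgt v
      obtain ⟨y, y₁, y₂, hbest⟩ := hy₂ v
      obtain ⟨rfl, -⟩ := hbest.eq_best hes
      have hop := G.op_eq_best x v
      rw [hvk] at htgt y₁ y₂
      have hlex := run_ifLexLe (t₁ := .const 0) (i₁ := var 17) (t₂ := .read 14 idx)
        (i₂ := .read 15 idx)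
        (c₁ := .seq (.store 12 idx (.read 14 idx)) (.store 13 idx (.read 15 idx)))
        (c₂ := .seq (.store 12 idx (.const (-1))) (.store 13 idx (.const 0)))
        (s := s') (x := ofInt θ) (y := G.best x v) rfl
        (by simp [Expr.eval, f17, hθ₂, Zbar.toInt])
        (by simp [Expr.eval, f14, hki, y₁]) (by simp [Expr.eval, f15, hki, y₂])
      unfold clipBody
      rw [Cmd.run, hlex, hvk]
      simp only [Expr.eval, hki, f5, htgt, MCRGame.clipStep, hop]
      by_cases ht : v ∈ G.target
      · simp [ht, Cmd.run, Expr.eval, hki]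
        exact ⟨rfl, rfl⟩
      · by_cases hlt : ofInt θ ≤ G.best x v
        · simp [ht, hlt, not_lt.2 hlt, Cmd.run, Expr.eval, hki, f14, f15, y₁, y₂]
        · have hlt' : G.best x v < ofInt θ := not_le.1 hlt
          simp [ht, hlt, hlt', Cmd.run, Expr.eval, hki]
          exact ⟨rfl, rfl⟩
    · have hvk' : ((v : ℕ) : ℤ) ≠ (k : ℤ) := by exact_mod_cast hvk
      have := hInv v (by omega)
      simp only [clipBody, ifLexLe, Cmd.run, Expr.eval, hki]
      split_ifs <;> simpa [hki, hvk'] using this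
  · intro s' hs h
    refine ⟨fun v => h v v.2, fun v => ?_⟩
    obtain ⟨y, -, -, hbest⟩ := hy₂ v
    rw [hs 16 (by decide) (by decide)]
    exact (hbest.eq_best hes).2

end RAM

/-! ### The loop of value iteration -/

namespace RAM

/-- Writes an entry of the initial vector. -/
def initBody : Cmd :=
  .seq (.ifLe (.const 1) (.read 5 idx) (.store 12 idx (.const 0)) (.store 12 idx (.const 1)))
    (.store 13 idx (.const 0))

/-- Value iteration, where the variable `24` contains the number of iterations. The best moves of
all iterations are appended to the list in the array `22`. -/
def valueIteration : Cmd :=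
  .seq (forLoop 18 9 initBody)
    (forLoop 19 24 (.seq iteration (forLoop 18 9 (push 22 23 (.read 16 idx)))))

variable {n : ℕ} {G : MCRGame (Fin n)} {es : List (Fin n × Fin n)} {s : State}

theorem tableCode_eq {n m : ℕ} (f : Fin n → Fin m) :
    tableCode f = (List.finRange n).flatMap fun v => [((f v : ℕ) : ℤ)] := by
  rw [tableCode, List.ofFn_eq_map, List.map_eq_flatMap]

theorem initBody_runs (hG : HoldsGame G es s) :
    Runs (forLoop 18 9 initBody) s (n * 44 + 11) (HoldsVec 12 13 G.initVec) := by
  refine Runs.forLoop (t := 30) (fun k s' => ∀ v : Fin n, (v : ℕ) < k →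
      s' 12 ((v : ℕ) : ℤ) = (G.initVec v).tag ∧ s' 13 ((v : ℕ) : ℤ) = (G.initVec v).toInt)
      (by decide) (by decide) (by decide) hG.card (fun v hv => by omega) ?_
      (fun s' _ h v => h v v.2) le_rfl
  intro k hk s' hs hki hInv
  refine Runs.straight rfl (by decide) fun v hv => ?_
  have h5 : s' 5 = s 5 := hs 5 (by decide) (by decide)
  by_cases hvk : (v : ℕ) = k
  · have htgt := hG.tgt v
    rw [hvk] at htgt
    by_cases hm : v ∈ G.target
    · simp [initBody, Cmd.run, Expr.eval, hki, h5, htgt, hm, hvk, MCRGame.initVec]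
      exact ⟨rfl, rfl⟩
    · simp [initBody, Cmd.run, Expr.eval, hki, h5, htgt, hm, hvk, MCRGame.initVec]
      exact ⟨rfl, rfl⟩
  · have hvk' : ((v : ℕ) : ℤ) ≠ (k : ℤ) := by exact_mod_cast hvk
    have := hInv v (by omega)
    by_cases h : (1 : ℤ) ≤ s' 5 k <;>
      simpa [initBody, Cmd.run, Expr.eval, hki, hvk', h] using this

/-- The tables of best moves that belong to the vectors of value iteration. -/
def IsLog (G : MCRGame (Fin n)) (θ : ℤ) (log : List (Fin n → Fin n)) : Prop :=
  ∀ (j : ℕ) (h : j < log.length) (v : Fin n), (v, log[j] v) ∈ G.edges ∧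
    G.best ((G.clipStep θ)^[j] G.initVec) v =
      ofInt (G.weight v (log[j] v)) + ((G.clipStep θ)^[j] G.initVec) (log[j] v)

theorem valueIteration_runs (hes : ∀ e, e ∈ es ↔ e ∈ G.edges) {θ : ℤ} {N : ℕ}
    (hG : HoldsGame G es s) (hθ : s 17 0 = θ) (hN : s 24 0 = N) (hlog : Holds 22 23 [] s) :
    Runs valueIteration s (400 * ((N + 1) * (n + es.length + 1))) fun s' =>
      HoldsVec 12 13 ((G.clipStep θ)^[N] G.initVec) s' ∧
      ∃ log : List (Fin n → Fin n), log.length = N ∧ IsLog G θ log ∧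
        Holds 22 23 (log.flatMap tableCode) s' ∧
        ∀ f ∈ log.getLast?, ∀ v : Fin n, s' 16 ((v : ℕ) : ℤ) = ((f v : ℕ) : ℤ) := by
  refine Runs.seq (t₁ := n * 44 + 11)
    (t₂ := N * ((200 * (n + es.length + 1) + (n * (20 + 14) + 11) + 1) + 14) + 11)
    (initBody_runs hG) ?_ (by nlinarith)
  intro s₁ hx hs₁
  have hG₁ : HoldsGame G es s₁ := hG.congr fun a ha => hs₁ a (by revert ha; revert a; decide)
  have hN₁ : s₁ 24 0 = N := by rw [hs₁ 24 (by decide), hN]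
  refine Runs.forLoop (fun k s' => HoldsVec 12 13 ((G.clipStep θ)^[k] G.initVec) s' ∧
      ∃ log : List (Fin n → Fin n), log.length = k ∧ IsLog G θ log ∧
        Holds 22 23 (log.flatMap tableCode) s' ∧
        ∀ f ∈ log.getLast?, ∀ v : Fin n, s' 16 ((v : ℕ) : ℤ) = ((f v : ℕ) : ℤ))
    (by decide) (by decide) (by decide) hN₁ ?_ ?_ (fun _ _ h => h) le_rfl
  · refine ⟨hx, [], rfl, fun j h => by simp at h, ?_, by simp⟩
    exact hlog.congr (hs₁ 22 (by decide)) (hs₁ 23 (by decide))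
  · rintro k hk s₂ hs₂ - ⟨hx₂, log, hlen, hlog₂, hz, -⟩
    have hG₂ : HoldsGame G es s₂ := hG₁.congr fun a ha =>
      hs₂ a (by revert ha; revert a; decide) (by revert ha; revert a; decide)
    have hθ₂ : s₂ 17 0 = θ := by
      rw [hs₂ 17 (by decide) (by decide), hs₁ 17 (by decide), hθ]
    refine Runs.seq (iteration_runs hes hG₂ hx₂ hθ₂) ?_ le_rfl
    rintro s₃ ⟨hx₃, hch⟩ hs₃
    choose f hf using hch
    have hz₃ := hz.congr (hs₃ 22 (by decide)) (hs₃ 23 (by decide))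
    have hn₃ : s₃ 9 0 = (List.finRange n).length := by
      rw [List.length_finRange, hs₃ 9 (by decide), hG₂.card]
    refine Runs.pushLoop (List.finRange n) (fun v => [((f v : ℕ) : ℤ)]) (t := 20)
      (by decide) (by decide) (by decide) (by decide) (by decide) hn₃ hz₃ ?_ ?_ (by simp)
    · intro j hj s₄ hs₄ hi z' hz'
      have he : (Expr.read 16 idx).eval s₄ = ((f (List.finRange n)[j] : ℕ) : ℤ) := by
        rw [Expr.eval, Expr.eval, Expr.eval, hi, hs₄ 16 (by decide) (by decide),
          ← (hf (List.finRange n)[j]).1]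
        simp
      have := Runs.push (e := .read 16 idx) (t := 20) (by decide) hz' (by decide)
      rwa [he] at this
    · intro s₄ hs₄ hz₄
      have hfr : ∀ a ∈ [12, 13, 16], (s₄.set 19 0 (k + 1)) a = s₃ a := by
        intro a ha
        rw [State.set_of_ne (by revert ha; revert a; decide)]
        exact hs₄ a (by revert ha; revert a; decide) (by revert ha; revert a; decide)
      refine ⟨?_, log ++ [f], by simp [hlen], ?_, ?_, ?_⟩
      · rw [Function.iterate_succ_apply']
        exact hx₃.congr (hfr 12 (by decide)) (hfr 13 (by decide))
      · intro j hj v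
        rw [List.length_append, List.length_singleton] at hj
        by_cases hj' : j < log.length
        · rw [List.getElem_append_left hj']
          exact hlog₂ j hj' v
        · obtain rfl : j = log.length := by omega
          have e : (log ++ [f])[log.length]'(by simp) = f := by simp
          rw [e, hlen]
          exact (hf v).2
      · rw [List.flatMap_append, List.flatMap_singleton, tableCode_eq f]
        exact hz₄.congr (State.set_of_ne (by decide)) (State.set_of_ne (by decide))
      · intro g hg v
        have hg' : f = g := by simpa using hg
        rw [hfr 16 (by decide), (hf v).1, hg']

/-! ### Reading the input -/

/-- Copies `n` entries of the input from the position in the variable `20` on. -/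
def copyFlags (a : ℕ) : Cmd :=
  .seq (forLoop 18 9 (.store a idx (.read 0 (.plus (var 20) idx))))
    (setVar 20 (.plus (var 20) (var 9)))

/-- Reads the number of vertices and the vertices of Max, from the position `o` on. -/
def parseHead (o : ℕ) : Cmd :=
  .seq (.seq (setVar 9 (.read 0 (.const o))) (setVar 20 (.const (o + 1)))) (copyFlags 4)

/-- Reads an edge; the variable `20` contains the position before it. -/
def parseEdgeBody : Cmd :=
  .seq (.seq (.store 6 idx (.read 0 (.plus (var 20) (.const 1))))
    (.store 7 idx (.read 0 (.plus (var 20) (.const 2)))))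
    (.seq (.store 8 idx (.read 0 (.plus (var 20) (.const 3))))
      (setVar 20 (.plus (var 20) (.const 3))))

/-- Reads the edges. -/
def parseEdges : Cmd :=
  .seq (setVar 10 (.read 0 (var 20))) (forLoop 18 10 parseEdgeBody)

/-- Reads a min-cost reachability game, from the position `o` on. -/
def parseMCR (o : ℕ) : Cmd := .seq (parseHead o) (.seq (copyFlags 5) parseEdges)

/-- Reads a mean-payoff game, from the position `o` on. -/
def parseMP (o : ℕ) : Cmd := .seq (parseHead o) parseEdges

theorem length_setCode {n : ℕ} (S : Finset (Fin n)) : (setCode S).length = n := by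
  simp [setCode]

theorem setCode_getD {n : ℕ} (S : Finset (Fin n)) (v : Fin n) :
    (setCode S).getD v 0 = if v ∈ S then 1 else 0 := by
  simp [setCode, List.getD_eq_getElem?_getD]

theorem copyFlags_runs {a : ℕ} (ha : a ∈ [4, 5]) {S : Finset (Fin n)} {pre post : List ℤ}
    (h0 : s 0 = listArray (pre ++ (setCode S ++ post))) (h9 : s 9 0 = n)
    (h20 : s 20 0 = pre.length) :
    Runs (copyFlags a) s (n * 34 + 30) fun s' =>
      (∀ v : Fin n, s' a ((v : ℕ) : ℤ) = if v ∈ S then 1 else 0) ∧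
        s' 20 0 = (pre ++ setCode S).length := by
  have ha18 : a ≠ 18 ∧ a ≠ 9 ∧ a ≠ 20 ∧ a ≠ 0 := by revert ha; revert a; decide
  obtain ⟨a18, a9, a20, a0⟩ := ha18
  refine Runs.seq (t₁ := n * 34 + 11) (t₂ := 10)
    (P := fun s' => ∀ v : Fin n, s' a ((v : ℕ) : ℤ) = if v ∈ S then 1 else 0)
    (Runs.forLoop (t := 20) (fun k s' => ∀ v : Fin n, (v : ℕ) < k →
      s' a ((v : ℕ) : ℤ) = if v ∈ S then 1 else 0) (by decide)
      (by simp [Cmd.writes, a18.symm]) (by simp [Cmd.writes, a9.symm]) h9 (fun v hv => by omega) ?_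
      (fun s' _ h v => h v v.2) le_rfl) ?_ (by omega)
  · intro k hk s' hs hki hInv
    have f0 : s' 0 = s 0 := hs 0 (by simp [Cmd.writes, a0.symm]) (by decide)
    have f20 : s' 20 = s 20 := hs 20 (by simp [Cmd.writes, a20.symm]) (by decide)
    refine Runs.straight rfl (by simp [Cmd.cost, Expr.cost]) fun v hv => ?_
    by_cases hvk : (v : ℕ) = k
    · have : s 0 ((pre.length : ℤ) + k) = if v ∈ S then 1 else 0 := by
        rw [h0, ← Nat.cast_add, listArray_natCast, getD_append_add,
          getD_append_left (by rw [length_setCode]; exact hk), ← hvk, setCode_getD]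
      simp [Cmd.run, Expr.eval, hki, hvk, f0, f20, h20, this, a18]
    · have hvk' : ((v : ℕ) : ℤ) ≠ (k : ℤ) := by exact_mod_cast hvk
      have := hInv v (by omega)
      simpa [Cmd.run, Expr.eval, hki, hvk', a18] using this
  · intro s' hs hfr
    have f9 : s' 9 = s 9 := hfr 9 (by simp [forLoop_writes, Cmd.writes, a9.symm])
    have f20 : s' 20 = s 20 := hfr 20 (by simp [forLoop_writes, Cmd.writes, a20.symm])
    refine Runs.straight rfl (by decide) ⟨?_, ?_⟩
    · simpa [Cmd.run, a20] using hs
    · simp [Cmd.run, Expr.eval, f9, f20, h9, h20, length_setCode]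

theorem parseHead_runs {o : ℕ} {S : Finset (Fin n)} {pre post : List ℤ} (ho : pre.length = o)
    (h0 : s 0 = listArray (pre ++ (n : ℤ) :: (setCode S ++ post))) :
    Runs (parseHead o) s (n * 34 + 50) fun s' => s' 9 0 = n ∧
      (∀ v : Fin n, s' 4 ((v : ℕ) : ℤ) = if v ∈ S then 1 else 0) ∧
        s' 20 0 = (pre ++ (n : ℤ) :: setCode S).length := by
  have hn : s 0 o = n := by
    rw [h0, listArray_natCast, ← ho]
    simp
  refine Runs.seq (t₁ := 10) (t₂ := n * 34 + 30)
    (P := fun s' => s' 0 = s 0 ∧ s' 9 0 = n ∧ s' 20 0 = (pre ++ [(n : ℤ)]).length)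
    (Runs.straight rfl ?_ ?_) ?_ (by omega)
  · simp [Cmd.cost, Expr.cost]
  · simp [Cmd.run, Expr.eval, hn, ho]
  · rintro s' ⟨f0, f9, f20⟩ -
    refine (copyFlags_runs (S := S) (post := post) (by decide) ?_ f9 f20).frame.mono le_rfl ?_
    · rw [f0, h0]; simp
    · rintro s'' ⟨⟨h1, h2⟩, h3⟩
      refine ⟨by rw [h3 9 (by decide), f9], h1, ?_⟩
      rw [h2]; simp

theorem flatMap_getD {α : Type*} {f : α → List ℤ} {c : ℕ} (hf : ∀ a, (f a).length = c) :
    ∀ (l : List α) (k : ℕ) (h : k < l.length) (j : ℕ), j < c →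
      (l.flatMap f).getD (c * k + j) 0 = (f l[k]).getD j 0 := by
  intro l
  induction l with
  | nil => intro k h; simp at h
  | cons a l ih =>
    intro k h j hj
    rw [List.flatMap_cons]
    cases k with
    | zero =>
      rw [Nat.mul_zero, Nat.zero_add, getD_append_left (by rw [hf]; exact hj)]
      rfl
    | succ k =>
      have : c * (k + 1) + j = (f a).length + (c * k + j) := by rw [hf]; ring
      rw [this, getD_append_add, ih k (by simpa using h) j hj]
      rfl

theorem parseEdges_runs {W : WeightedGraph (Fin n)} {pre : List ℤ}
    (h0 : s 0 = listArray (pre ++ edgesCode W es)) (h20 : s 20 0 = pre.length) :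
    Runs parseEdges s (es.length * 74 + 30) fun s' => s' 10 0 = es.length ∧
      ∀ (k : ℕ) (h : k < es.length), s' 6 (k : ℤ) = ((es[k].1 : ℕ) : ℤ) ∧
        s' 7 (k : ℤ) = ((es[k].2 : ℕ) : ℤ) ∧ s' 8 (k : ℤ) = W.weight es[k].1 es[k].2 := by
  have hlen : s 0 (pre.length) = es.length := by
    rw [h0, listArray_natCast]
    simp [edgesCode]
  have hedge : ∀ (k : ℕ) (h : k < es.length) (j : ℕ), j < 3 →
      s 0 ((pre.length : ℤ) + 3 * k + (j + 1 : ℕ)) =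
        [((es[k].1 : ℕ) : ℤ), ((es[k].2 : ℕ) : ℤ), W.weight es[k].1 es[k].2].getD j 0 := by
    intro k h j hj
    have hidx : (pre.length : ℤ) + 3 * k + (j + 1 : ℕ) =
        ((pre.length + (1 + (3 * k + j)) : ℕ) : ℤ) := by push_cast; ring
    rw [hidx, h0, listArray_natCast, getD_append_add, edgesCode]
    have h1 := getD_append_add [(es.length : ℤ)] (es.flatMap fun e =>
      [((e.1 : ℕ) : ℤ), ((e.2 : ℕ) : ℤ), W.weight e.1 e.2]) (3 * k + j)
    have h2 := flatMap_getD (f := fun e : Fin n × Fin n =>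
      [((e.1 : ℕ) : ℤ), ((e.2 : ℕ) : ℤ), W.weight e.1 e.2]) (c := 3) (fun _ => rfl) es k h j hj
    exact h1.trans h2
  refine Runs.seq (t₁ := 10) (t₂ := es.length * 74 + 11)
    (P := fun s' => s' 10 0 = es.length) (Runs.straight rfl (by decide) ?_) ?_ (by omega)
  · simp [Cmd.run, Expr.eval, h20, hlen]
  intro s₁ h10 hs₁
  have f0 : s₁ 0 = s 0 := hs₁ 0 (by decide)
  have f20 : s₁ 20 = s 20 := hs₁ 20 (by decide)
  refine Runs.forLoop (t := 60) (fun k s' => s' 20 0 = (pre.length : ℤ) + 3 * k ∧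
    ∀ (j : ℕ) (h : j < es.length), j < k → s' 6 (j : ℤ) = ((es[j].1 : ℕ) : ℤ) ∧
      s' 7 (j : ℤ) = ((es[j].2 : ℕ) : ℤ) ∧ s' 8 (j : ℤ) = W.weight es[j].1 es[j].2)
    (by decide) (by decide) (by decide) h10 ?_ ?_ ?_ le_rfl
  · refine ⟨?_, fun j _ h => by omega⟩
    simp [f20, h20]
  · rintro k hk s' hs hki ⟨h20', hInv⟩
    have g0 : s' 0 = s 0 := (hs 0 (by decide) (by decide)).trans f0
    have e1 := hedge k hk 0 (by omega)
    have e2 := hedge k hk 1 (by omega)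
    have e3 := hedge k hk 2 (by omega)
    norm_num at e1 e2 e3
    refine Runs.straight rfl (by decide) ⟨?_, fun j hj hjk => ?_⟩
    · simp [parseEdgeBody, Cmd.run, Expr.eval, h20']
      ring
    · by_cases hjk' : j = k
      · subst hjk'
        simp [parseEdgeBody, Cmd.run, Expr.eval, h20', hki, g0, e1, e2, e3]
      · have hjk'' : (j : ℤ) ≠ (k : ℤ) := by exact_mod_cast hjk'
        have := hInv j hj (by omega)
        simpa [parseEdgeBody, Cmd.run, Expr.eval, hki, hjk''] using this
  · rintro s' hs ⟨-, h⟩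
    exact ⟨by rw [hs 10 (by decide) (by decide), h10], fun k hk => h k hk hk⟩

theorem parseMCR_runs {o : ℕ} {pre : List ℤ} (ho : pre.length = o)
    (h0 : s 0 = listArray (pre ++ (n : ℤ) :: (setCode G.maxV ++ setCode G.target ++
      edgesCode G.toWeightedGraph es))) :
    Runs (parseMCR o) s (200 * (n + es.length + 1)) (HoldsGame G es) := by
  refine Runs.seq (t₁ := n * 34 + 50) (t₂ := n * 34 + es.length * 74 + 61)
    (parseHead_runs (S := G.maxV) (post := setCode G.target ++ edgesCode G.toWeightedGraph es) ho
      (by rw [h0]; simp)) ?_ (by omega)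
  rintro s₁ ⟨a9, a4, a20⟩ hs₁
  have f0 : s₁ 0 = s 0 := hs₁ 0 (by simp [parseHead, copyFlags, forLoop_writes, Cmd.writes])
  refine Runs.seq (t₁ := n * 34 + 30) (t₂ := es.length * 74 + 30)
    (copyFlags_runs (a := 5) (S := G.target) (post := edgesCode G.toWeightedGraph es) (by decide)
      (by rw [f0, h0]; simp) a9 a20) ?_ (by omega)
  rintro s₂ ⟨b5, b20⟩ hs₂
  have g0 : s₂ 0 = s₁ 0 := hs₂ 0 (by decide)
  refine (parseEdges_runs (es := es) (W := G.toWeightedGraph) (by rw [g0, f0, h0]; simp)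
    b20).frame.mono le_rfl ?_
  rintro s₃ ⟨⟨c10, c⟩, hs₃⟩
  exact {
    own := by rw [hs₃ 4 (by decide), hs₂ 4 (by decide)]; exact a4
    tgt := by rw [hs₃ 5 (by decide)]; exact b5
    src := fun k h => (c k h).1
    dst := fun k h => (c k h).2.1
    wt := fun k h => (c k h).2.2
    card := by rw [hs₃ 9 (by decide), hs₂ 9 (by decide), a9]
    size := c10 }

/-- A weighted graph without target, as a game. -/
def _root_.WeightedGraph.toGame {V : Type*} (G : WeightedGraph V) : MCRGame V :=
  { G with target := ∅ }

theorem parseMP_runs {o : ℕ} {W : WeightedGraph (Fin n)} {pre : List ℤ} (ho : pre.length = o)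
    (h0 : s 0 = listArray (pre ++ (n : ℤ) :: (setCode W.maxV ++ edgesCode W es)))
    (h5 : ∀ i, s 5 i = 0) :
    Runs (parseMP o) s (200 * (n + es.length + 1)) (HoldsGame W.toGame es) := by
  refine Runs.seq (t₁ := n * 34 + 50) (t₂ := es.length * 74 + 30)
    (parseHead_runs (S := W.maxV) (post := edgesCode W es) ho (by rw [h0])) ?_ (by omega)
  rintro s₁ ⟨a9, a4, a20⟩ hs₁
  have f0 : s₁ 0 = s 0 := hs₁ 0 (by simp [parseHead, copyFlags, forLoop_writes, Cmd.writes])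
  have f5 : s₁ 5 = s 5 := hs₁ 5 (by simp [parseHead, copyFlags, forLoop_writes, Cmd.writes])
  refine (parseEdges_runs (es := es) (W := W) (by rw [f0, h0]; simp) a20).frame.mono le_rfl ?_
  rintro s₃ ⟨⟨c10, c⟩, hs₃⟩
  exact {
    own := by rw [hs₃ 4 (by decide)]; exact a4
    tgt := fun v => by rw [hs₃ 5 (by decide), f5, h5, if_neg (by simp [WeightedGraph.toGame])]
    src := fun k h => (c k h).1
    dst := fun k h => (c k h).2.1
    wt := fun k h => (c k h).2.2
    card := by rw [hs₃ 9 (by decide), a9]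
    size := c10 }

end RAM

/-! ### Deciding whether the value is infinite -/

namespace RAM

theorem length_le_bitSize (x : List ℤ) : x.length ≤ bitSize x := by
  induction x with
  | nil => simp [bitSize]
  | cons a x ih =>
    simp only [bitSize, List.map_cons, List.sum_cons, List.length_cons] at *
    omega

theorem length_le_unarySize (x : List ℤ) : x.length ≤ unarySize x := by
  induction x with
  | nil => simp [unarySize]
  | cons a x ih =>
    simp only [unarySize, List.map_cons, List.sum_cons, List.length_cons] at *
    omega

theorem natAbs_le_unarySize {x : List ℤ} {z : ℤ} (h : z ∈ x) : z.natAbs ≤ unarySize x := by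
  have := List.single_le_sum (l := x.map fun z => z.natAbs + 1) (fun _ _ => Nat.zero_le _) _
    (List.mem_map_of_mem h)
  exact (Nat.le_succ _).trans this

theorem size_le_bitSize {x : List ℤ} {z : ℤ} (h : z ∈ x) : Nat.size z.natAbs ≤ bitSize x := by
  have := List.single_le_sum (l := x.map fun z => Nat.size z.natAbs + 1)
    (fun _ _ => Nat.zero_le _) _
    (List.mem_map_of_mem h)
  exact (Nat.le_succ _).trans this

theorem length_edgesCode {n : ℕ} (W : WeightedGraph (Fin n)) (es : List (Fin n × Fin n)) :
    (edgesCode W es).length = 1 + 3 * es.length := by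
  simp [edgesCode, List.length_flatMap]
  ring

theorem length_code (I : MCRInput) : I.code.length = 2 + 2 * I.n + 3 * I.edgeList.length := by
  simp [MCRInput.code, length_setCode, length_edgesCode]
  ring

theorem length_instance_code (a : MCRInstance) :
    a.code.length = 3 + 2 * a.1.n + 3 * a.1.edgeList.length := by
  simp [MCRInstance.code, length_code]
  ring

theorem weight_mem_code (I : MCRInput) {e : Fin I.n × Fin I.n} (h : e ∈ I.game.edges) :
    I.game.weight e.1 e.2 ∈ I.code := by
  simp only [MCRInput.code, edgesCode, List.mem_cons, List.mem_append, List.mem_flatMap]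
  exact Or.inr (Or.inr (Or.inr ⟨e, (I.mem_edgeList e).2 h, by simp⟩))

/-- Stores the answer of a decision procedure: yes if `e₁ ≤ e₂`. -/
def answerIf (e₁ e₂ : Expr) : Cmd :=
  .seq (.ifLe e₁ e₂ (setVar 0 (.const 1)) (setVar 0 (.const 0))) (setVar 1 (.const 1))

theorem answerIf_runs {e₁ e₂ : Expr} {s : State} {P : Prop} {t : ℕ}
    (h : e₁.eval s ≤ e₂.eval s ↔ P) (ht : e₁.cost + e₂.cost + 10 ≤ t) :
    Runs (answerIf e₁ e₂) s t (Holds 0 1 (answer P)) := by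
  refine Runs.straight rfl ?_ ?_
  · simp only [answerIf, Cmd.cost, Expr.cost]; omega
  · by_cases hP : P
    · have hle := h.2 hP
      simp only [answerIf, Cmd.run, if_pos hle, answer, if_pos hP]
      refine ⟨by simp [Expr.eval], fun i hi => ?_⟩
      rw [show i = 0 by simpa using hi]
      simp [Expr.eval]
    · have hle := fun h' => hP (h.1 h')
      simp only [answerIf, Cmd.run, if_neg hle, answer, if_neg hP]
      refine ⟨by simp [Expr.eval], fun i hi => ?_⟩
      rw [show i = 0 by simpa using hi]
      simp [Expr.eval]

/-- Reads a game and a vertex. -/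
def readInstance : Cmd := .seq (setVar 11 (.read 0 (.const 0))) (parseMCR 1)

theorem readInstance_runs (a : MCRInstance) (y : List ℤ) :
    Runs readInstance (startState a.code y) (200 * (a.1.n + a.1.edgeList.length + 1) + 10)
      fun s => HoldsGame a.1.game a.1.edgeList s ∧ s 11 0 = ((a.2 : ℕ) : ℤ) ∧
        s 2 = listArray y ∧ ∀ b, 12 ≤ b → b ≠ 18 → b ≠ 20 → s b = fun _ => 0 := by
  refine Runs.seq (t₁ := 5) (t₂ := 200 * (a.1.n + a.1.edgeList.length + 1))
    (P := fun s => s 11 0 = ((a.2 : ℕ) : ℤ)) (Runs.straight rfl (by decide) ?_) ?_ (by omega)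
  · simp [Cmd.run, Expr.eval, startState, MCRInstance.code, listArray]
  intro s h11 hs
  have hw : ∀ b ∈ [2, 11], b ∉ (parseMCR 1).writes := by decide
  refine (parseMCR_runs (o := 1) (G := a.1.game) (es := a.1.edgeList)
    (pre := [((a.2 : ℕ) : ℤ)]) rfl ?_).frame.mono
    le_rfl ?_
  · rw [hs 0 (by decide)]; rfl
  · rintro s' ⟨h1, h2⟩
    refine ⟨h1, by rw [h2 11 (hw 11 (by decide)), h11], ?_, fun b hb h18 h20 => ?_⟩
    · rw [h2 2 (hw 2 (by decide)), hs 2 (by decide)]; rfl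
    · have hw : b ∉ (parseMCR 1).writes := by
        simp [parseMCR, parseHead, copyFlags, parseEdges, parseEdgeBody, forLoop_writes, Cmd.writes]
        omega
      rw [h2 b hw, hs b (by simp [Cmd.writes]; omega)]
      obtain ⟨c, rfl⟩ : ∃ c, b = c + 4 := ⟨b - 4, by omega⟩
      rfl

theorem holds_nil {a p : ℕ} {s : State} (h : s p = fun _ => 0) : Holds a p [] s :=
  ⟨by rw [h]; rfl, fun i hi => by simp at hi⟩

/-- Computes which vertices belong to the attractor: the entries of the others are `+∞` after `n`
iterations, whatever the clipping bound is. It is `0` here, the initial content of its variable. -/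
def attractorCmd : Cmd := .seq readInstance (.seq (setVar 24 (var 9)) valueIteration)

theorem attractorCmd_runs (a : MCRInstance) (y : List ℤ) :
    Runs attractorCmd (startState a.code y)
      (700 * ((a.1.n + 1) * (a.1.n + a.1.edgeList.length + 1)))
      fun s => HoldsGame a.1.game a.1.edgeList s ∧ s 11 0 = ((a.2 : ℕ) : ℤ) ∧
        s 2 = listArray y ∧ (∀ b, 25 ≤ b → s b = fun _ => 0) ∧
        ∀ v : Fin a.1.n, 1 ≤ s 12 ((v : ℕ) : ℤ) ↔ v ∉ a.1.game.attr a.1.n := by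
  have hmul : a.1.n + a.1.edgeList.length + 1 ≤
      (a.1.n + 1) * (a.1.n + a.1.edgeList.length + 1) := Nat.le_mul_of_pos_left _ (Nat.succ_pos _)
  refine Runs.seq (t₂ := 400 * ((a.1.n + 1) * (a.1.n + a.1.edgeList.length + 1)) + 10)
    (readInstance_runs a y) ?_ (by omega)
  rintro s ⟨hG, h11, h2, hzero⟩ -
  refine Runs.seq (t₁ := 8) (t₂ := 400 * ((a.1.n + 1) * (a.1.n + a.1.edgeList.length + 1)))
    (P := fun s' => s' 24 0 = (a.1.n : ℤ)) (Runs.straight rfl (by decide) ?_) ?_ (by omega)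
  · simp [Cmd.run, Expr.eval, hG.card]
  intro s₁ h24 hs₁
  have hG₁ : HoldsGame a.1.game a.1.edgeList s₁ :=
    hG.congr fun a ha => hs₁ a (by revert ha; revert a; decide)
  refine (valueIteration_runs (θ := 0) a.1.mem_edgeList hG₁ ?_ h24 (holds_nil ?_)).frame.mono
    le_rfl ?_
  · rw [hs₁ 17 (by decide), hzero 17 (by decide) (by decide) (by decide)]
  · rw [hs₁ 23 (by decide), hzero 23 (by decide) (by decide) (by decide)]
  rintro s₂ ⟨⟨hx, -⟩, hs₂⟩
  refine ⟨hG₁.congr fun a ha => hs₂ a (by revert ha; revert a; decide), ?_, ?_, fun b hb => ?_,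
    fun v => ?_⟩
  · rw [hs₂ 11 (by decide), hs₁ 11 (by decide), h11]
  · rw [hs₂ 2 (by decide), hs₁ 2 (by decide), h2]
  · have hw : b ∉ valueIteration.writes := by
      simp [valueIteration, iteration, worstBody, moveValue, compareMove, useMove, clipBody,
        ifLexLe, initBody, push, forLoop_writes, Cmd.writes]
      omega
    rw [hs₂ b hw, hs₁ b (by simp [Cmd.writes]; omega), hzero b (by omega) (by omega) (by omega)]
  · rw [(hx v).1, Zbar.tag_eq, ← a.1.game.clipStep_iterate_lt_top (θ := 0), lt_top_iff_ne_top]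
    split_ifs with h1 h2
    · rw [h1]; simp
    · simp [h2]
    · simp [h2]

theorem polyTime_valuePosInf : PolyTime MCRInstance.code ValuePosInf := by
  refine ⟨.seq attractorCmd (answerIf (.const 1) (.read 12 (var 11))), 1000 * Polynomial.X ^ 2,
    fun a => ?_⟩
  have hlen := length_le_bitSize a.code
  rw [length_instance_code] at hlen
  have hmul : (a.1.n + 1) * (a.1.n + a.1.edgeList.length + 1) ≤ bitSize a.code * bitSize a.code :=
    Nat.mul_le_mul (by omega) (by omega)
  have hpos : 1 ≤ bitSize a.code * bitSize a.code := Nat.mul_pos (by omega) (by omega)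
  refine Runs.outputsWithin (t := 1000 * (bitSize a.code * bitSize a.code))
    (Runs.seq (t₂ := 20) (attractorCmd_runs a []) ?_ (by omega)) ?_
  · rintro s ⟨hG, h11, -, -, hx⟩ -
    refine answerIf_runs ?_ (by decide)
    simp only [Expr.eval, h11, hx]
    change _ ↔ a.1.game.value a.2 = ⊤
    rw [MCRGame.value_eq_top_iff, Fintype.card_fin]
  · simp [pow_two]

/-! ### The parameters of the value iteration algorithm -/

/-- Updates the greatest absolute weight in the variable `25`. -/
def maxWeightBody : Cmd :=
  .seq (.ifLe (var 25) (.read 8 idx) (setVar 25 (.read 8 idx)) .skip)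
    (.ifLe (var 25) (.minus (.const 0) (.read 8 idx))
      (setVar 25 (.minus (.const 0) (.read 8 idx))) .skip)

/-- Computes the greatest absolute weight (variable `25`), its product with `n` (variable `26`), the
clipping bound (variable `17`) and the number of iterations (variable `24`). -/
def setup : Cmd :=
  .seq (forLoop 18 10 maxWeightBody)
    (.seq (forLoop 18 9 (setVar 26 (.plus (var 26) (var 25))))
      (.seq (setVar 17 (.minus (var 25) (var 26)))
        (forLoop 18 9 (setVar 24 (.plus (var 24)
          (.plus (.minus (.plus (var 26) (var 26)) (var 25)) (.const 2)))))))

variable {n : ℕ} {G : MCRGame (Fin n)} {es : List (Fin n × Fin n)} {s : State}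

theorem setup_runs (hn : 0 < n) (hes : ∀ e, e ∈ es ↔ e ∈ G.edges) (hG : HoldsGame G es s)
    (h24 : s 24 0 = 0) (h25 : s 25 0 = 0) (h26 : s 26 0 = 0) :
    Runs setup s (200 * (n + es.length + 1)) fun s' => s' 17 0 = G.bound ∧
      s' 24 0 = MCRGame.iterBound n G.maxWeight := by
  refine Runs.seq (t₁ := es.length * 74 + 11) (t₂ := n * 90 + 100)
    (P := fun s' => s' 25 0 = (G.maxWeight : ℤ))
    (Runs.forLoop (t := 60) (fun k s' => 0 ≤ s' 25 0 ∧
      (∀ (j : ℕ) (h : j < es.length), j < k → |G.weight es[j].1 es[j].2| ≤ s' 25 0) ∧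
      (s' 25 0 = 0 ∨ ∃ (j : ℕ) (h : j < es.length), |G.weight es[j].1 es[j].2| = s' 25 0))
      (by decide) (by decide) (by decide) hG.size ?_ ?_ ?_ le_rfl) ?_ (by omega)
  · exact ⟨by simp [h25], fun j _ h => by omega, Or.inl (by simp [h25])⟩
  · rintro k hk s' hs hki ⟨i1, i2, i3⟩
    have hwt : s' 8 k = G.weight es[k].1 es[k].2 := by
      rw [hs 8 (by decide) (by decide)]; exact hG.wt k hk
    refine Runs.straight rfl (by decide) ?_
    have hval : (maxWeightBody.run s') 25 0 = max (s' 25 0) |G.weight es[k].1 es[k].2| := by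
      rw [abs_eq_max_neg]
      generalize G.weight es[k].1 es[k].2 = w at hwt
      by_cases h1 : s' 25 0 ≤ w
      · by_cases h2 : w ≤ -w
        · simp [maxWeightBody, Cmd.run, Expr.eval, hki, hwt, h1, h2]; omega
        · simp [maxWeightBody, Cmd.run, Expr.eval, hki, hwt, h1, h2]; omega
      · by_cases h2 : s' 25 0 ≤ -w
        · simp [maxWeightBody, Cmd.run, Expr.eval, hki, hwt, h1, h2]; omega
        · simp [maxWeightBody, Cmd.run, Expr.eval, hki, hwt, h1, h2]; omega
    have hval' : ((maxWeightBody.run s').set 18 0 (k + 1)) 25 0 =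
        max (s' 25 0) |G.weight es[k].1 es[k].2| := by
      rw [State.set_of_ne (by decide), hval]
    rw [hval']
    refine ⟨le_max_of_le_left i1, fun j hj hjk => ?_, ?_⟩
    · by_cases hjk' : j = k
      · subst hjk'; exact le_max_right _ _
      · exact (i2 j hj (by omega)).trans (le_max_left _ _)
    · rcases max_choice (s' 25 0) |G.weight es[k].1 es[k].2| with h | h <;> rw [h]
      · exact i3
      · exact Or.inr ⟨k, hk, rfl⟩
  · rintro s' - ⟨i1, i2, i3⟩
    refine le_antisymm ?_ ?_
    · rcases i3 with h | ⟨j, hj, h⟩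
      · rw [h]; omega
      · rw [← h, Int.abs_eq_natAbs]
        exact_mod_cast G.natAbs_weight_le ((hes es[j]).1 (List.getElem_mem hj))
    · have : G.maxWeight ≤ (s' 25 0).toNat := by
        refine Finset.sup_le fun e he => ?_
        obtain ⟨j, hj, rfl⟩ := List.getElem_of_mem ((hes e).2 he)
        have := i2 j hj hj
        rw [Int.abs_eq_natAbs] at this
        omega
      omega
  intro s₁ w25 hs₁
  have w26 : s₁ 26 0 = 0 := by rw [hs₁ 26 (by decide), h26]
  have w24 : s₁ 24 0 = 0 := by rw [hs₁ 24 (by decide), h24]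
  have w9 : s₁ 9 0 = n := by rw [hs₁ 9 (by decide), hG.card]
  refine Runs.seq (t₁ := n * 34 + 11) (t₂ := n * 50 + 50)
    (P := fun s' => s' 26 0 = n * (G.maxWeight : ℤ))
    (Runs.forLoop (t := 20) (fun k s' => s' 26 0 = k * (G.maxWeight : ℤ))
      (by decide) (by decide) (by decide) w9 (by simp [w26]) ?_ (fun _ _ h => h) le_rfl) ?_
      (by omega)
  · intro k hk s' hs hki hInv
    have f25 : s' 25 0 = G.maxWeight := by rw [hs 25 (by decide) (by decide), w25]
    refine Runs.straight rfl (by decide) ?_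
    simp [Cmd.run, Expr.eval, hInv, f25]
    ring
  intro s₂ v26 hs₂
  have v25 : s₂ 25 0 = G.maxWeight := by rw [hs₂ 25 (by decide), w25]
  have v24 : s₂ 24 0 = 0 := by rw [hs₂ 24 (by decide), w24]
  have v9 : s₂ 9 0 = n := by rw [hs₂ 9 (by decide), w9]
  refine Runs.seq (t₁ := 10) (t₂ := n * 44 + 11)
    (P := fun s' => s' 17 0 = G.bound) (Runs.straight rfl (by decide) ?_) ?_ (by omega)
  · simp [Cmd.run, Expr.eval, v25, v26, MCRGame.bound]
    ring
  intro s₃ u17 hs₃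
  have u25 : s₃ 25 0 = G.maxWeight := by rw [hs₃ 25 (by decide), v25]
  have u26 : s₃ 26 0 = n * (G.maxWeight : ℤ) := by rw [hs₃ 26 (by decide), v26]
  have u24 : s₃ 24 0 = 0 := by rw [hs₃ 24 (by decide), v24]
  have u9 : s₃ 9 0 = n := by rw [hs₃ 9 (by decide), v9]
  refine Runs.forLoop (t := 30)
    (fun k s' => s' 24 0 = k * ((2 * n - 1) * (G.maxWeight : ℤ) + 2))
    (by decide) (by decide) (by decide) u9 (by simp [u24]) ?_ ?_ le_rfl
  · intro k hk s' hs hki hInv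
    have f25 : s' 25 0 = G.maxWeight := by rw [hs 25 (by decide) (by decide), u25]
    have f26 : s' 26 0 = n * (G.maxWeight : ℤ) := by rw [hs 26 (by decide) (by decide), u26]
    refine Runs.straight rfl (by decide) ?_
    simp [Cmd.run, Expr.eval, hInv, f25, f26]
    ring
  · intro s' hs h
    refine ⟨by rw [hs 17 (by decide) (by decide), u17], ?_⟩
    rw [h, MCRGame.iterBound]
    have : ((2 * n - 1 : ℕ) : ℤ) = 2 * n - 1 := by omega
    push_cast
    rw [this]
    ring

theorem iterBound_le (n W : ℕ) : MCRGame.iterBound n W ≤ 2 * n * W * n + 2 * n :=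
  Nat.add_le_add_right (Nat.mul_le_mul_right _ (Nat.mul_le_mul_right _ (by omega))) _

theorem iterations_time {n m W U : ℕ} (hlen : 3 + 2 * n + 3 * m ≤ U) (hW : W ≤ U) :
    (MCRGame.iterBound n W + 1) * (n + m + 1) ≤ 5 * (U * U * U * U) ∧
      n + m + 1 ≤ U * U * U * U := by
  constructor
  · have h1 : 2 * n * W * n ≤ 2 * U * U * U :=
      Nat.mul_le_mul (Nat.mul_le_mul (by omega) hW) (by omega)
    have hUU : U ≤ U * U := Nat.le_mul_of_pos_left _ (by omega)
    have hUUU : U * U ≤ U * U * U := Nat.le_mul_of_pos_right _ (by omega)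
    have h2 : MCRGame.iterBound n W + 1 ≤ 5 * (U * U * U) := by
      have := iterBound_le n W
      have h3 : 2 * U * U * U = 2 * (U * U * U) := by ring
      omega
    calc (MCRGame.iterBound n W + 1) * (n + m + 1) ≤ 5 * (U * U * U) * U :=
          Nat.mul_le_mul h2 (by omega)
      _ = 5 * (U * U * U * U) := by ring
  · calc n + m + 1 ≤ U := by omega
      _ ≤ U * (U * U * U) := Nat.le_mul_of_pos_right _
        (Nat.mul_pos (Nat.mul_pos (by omega) (by omega)) (by omega))
      _ = U * U * U * U := by ring

theorem pseudoPolyTime_valueNegInf : PseudoPolyTime MCRInstance.code ValueNegInf := by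
  refine ⟨.seq readInstance (.seq setup (.seq valueIteration
    (answerIf (.read 12 (var 11)) (.const (-1))))), 4000 * Polynomial.X ^ 4, fun a => ?_⟩
  have hlen := length_le_unarySize a.code
  rw [length_instance_code] at hlen
  have hW : a.1.game.maxWeight ≤ unarySize a.code :=
    Finset.sup_le fun e he => natAbs_le_unarySize (List.mem_cons_of_mem _ (weight_mem_code a.1 he))
  have hn0 : 0 < a.1.n := Fin.pos a.2
  obtain ⟨htime, hU4⟩ := iterations_time hlen hW
  set N := MCRGame.iterBound a.1.n a.1.game.maxWeight with hN
  refine Runs.outputsWithin (t := 4000 *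
    (unarySize a.code * unarySize a.code * unarySize a.code * unarySize a.code)) (Runs.seq
    (t₂ := 200 * (a.1.n + a.1.edgeList.length + 1) +
      400 * ((N + 1) * (a.1.n + a.1.edgeList.length + 1)) + 30) (readInstance_runs a []) ?_
    (by omega)) ?_
  · rintro s ⟨hG, h11, -, hzero⟩ -
    have hz : ∀ b, 12 ≤ b → b ≠ 18 → b ≠ 20 → s b 0 = 0 := fun b h1 h2 h3 => by
      rw [hzero b h1 h2 h3]
    refine Runs.seq (t₂ := 400 * ((N + 1) * (a.1.n + a.1.edgeList.length + 1)) + 25)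
      (setup_runs hn0 a.1.mem_edgeList hG (hz 24 (by decide) (by decide) (by decide))
        (hz 25 (by decide) (by decide) (by decide)) (hz 26 (by decide) (by decide) (by decide))) ?_
      (by omega)
    rintro s₁ ⟨h17, h24⟩ hs₁
    rw [← hN] at h24
    have hG₁ : HoldsGame a.1.game a.1.edgeList s₁ :=
      hG.congr fun a ha => hs₁ a (by revert ha; revert a; decide)
    refine Runs.seq (t₂ := 20) (valueIteration_runs a.1.mem_edgeList hG₁ h17 h24 (holds_nil ?_)) ?_
      (by omega)
    · rw [hs₁ 23 (by decide), hzero 23 (by decide) (by decide) (by decide)]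
    rintro s₂ ⟨hx, -⟩ hs₂
    refine answerIf_runs ?_ (by decide)
    have : Nonempty (Fin a.1.n) := ⟨a.2⟩
    have h11' : s₂ 11 0 = ((a.2 : ℕ) : ℤ) := by
      rw [hs₂ 11 (by decide), hs₁ 11 (by decide), h11]
    change _ ↔ a.1.game.value a.2 = ⊥
    simp only [Expr.eval, h11', (hx a.2).1]
    rw [MCRGame.value_eq_limitVec, ← a.1.game.iter_iterBound (j := N) (by
      rw [Fintype.card_fin]; omega), MCRGame.iter_eq, Zbar.tag_eq]
    split_ifs with h1 h2
    · simp [h1]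
    · simp [h1]
    · simp [h1]
  · simp only [Polynomial.eval_mul, Polynomial.eval_pow, Polynomial.eval_X, Polynomial.eval_ofNat]
    exact le_of_eq (by ring)

end RAM

/-! ### Verifying certificates -/

namespace RAM

/-- The rule for loops over the indices of arrays: the iteration `k` of the body sets the entries
with index `k` of the arrays of the list `A`, and depends on no other entries of them. -/
theorem Runs.localLoop {i b N t T : ℕ} {c : Cmd} {s : State} {Q : State → Prop} (A : List ℕ)
    (val : ℕ → ℕ → ℤ) (hc : c.straight = true) (ht : c.cost ≤ t) (hiA : i ∉ A)
    (hib : i ≠ b) (hi : i ∉ c.writes) (hb : b ∉ c.writes) (hN : s b 0 = N)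
    (hstep : ∀ k < N, ∀ s' : State, (∀ a ∉ c.writes, a ≠ i → s' a = s a) → s' i 0 = k →
      (∀ a ∈ A, s' a (k : ℤ) = s a (k : ℤ)) → ∀ a ∈ A, ∀ j : ℕ,
        c.run s' a (j : ℤ) = if j = k then val a k else s' a (j : ℤ))
    (hQ : ∀ s' : State, (∀ a ∉ c.writes, a ≠ i → s' a = s a) →
      (∀ a ∈ A, ∀ j < N, s' a ((j : ℕ) : ℤ) = val a j) → Q s')
    (hT : N * (t + 14) + 11 ≤ T) : Runs (RAM.forLoop i b c) s T Q := by
  refine Runs.forLoop (t := t) (fun k s' => ∀ a ∈ A, ∀ j : ℕ,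
    s' a (j : ℤ) = if j < k then val a j else s a (j : ℤ)) hib hi hb hN ?_ ?_ ?_ hT
  · intro a ha j
    rw [State.set_of_ne (ne_of_mem_of_not_mem ha hiA), if_neg (Nat.not_lt_zero _)]
  · intro k hk s' hs hki hInv
    refine Runs.straight hc ht fun a ha j => ?_
    rw [State.set_of_ne (ne_of_mem_of_not_mem ha hiA),
      hstep k hk s' hs hki (fun a ha => by rw [hInv a ha, if_neg (lt_irrefl _)]) a ha j]
    by_cases hjk : j = k
    · rw [if_pos hjk, if_pos (by omega), hjk]
    · rw [if_neg hjk, hInv a ha j]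
      by_cases hj : j < k
      · rw [if_pos hj, if_pos (by omega)]
      · rw [if_neg hj, if_neg (by omega)]
  · exact fun s' hs h => hQ s' hs fun a ha j hj => by rw [h a ha j, if_pos hj]

variable {n : ℕ} {G : MCRGame (Fin n)} {es : List (Fin n × Fin n)} {s : State}

/-- The vector that a certificate describes. The first entry of the certificate is left for a
clipping bound. -/
noncomputable def decodeVec (y : List ℤ) (u : ℕ) : Zbar :=
  if y.getD (u + u + 1) 0 ≤ -1 then ⊥ else if 1 ≤ y.getD (u + u + 1) 0 then ⊤
    else ofInt (y.getD (u + u + 2) 0)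

/-- The certificate that consists of a clipping bound and a vector. -/
def certificate (θ : ℤ) (x : Fin n → Zbar) : List ℤ :=
  θ :: (List.finRange n).flatMap fun u => (x u).code

theorem decodeVec_certificate (θ : ℤ) (x : Fin n → Zbar) (u : Fin n) :
    decodeVec (certificate θ x) u = x u := by
  have h : ∀ j < 2, (certificate θ x).getD ((u : ℕ) + u + (j + 1)) 0 = (x u).code.getD j 0 := by
    intro j hj
    have h1 := flatMap_getD (f := fun u : Fin n => (x u).code) (c := 2)
      (fun u => by rw [Zbar.code_eq]; rfl) (List.finRange n) u (by simp) j hj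
    have h2 : (u : ℕ) + u + (j + 1) = [θ].length + (2 * u + j) := by
      rw [List.length_singleton]; ring
    rw [h2]
    simp only [List.getElem_finRange] at h1
    exact (getD_append_add [θ] _ _).trans h1
  have h0 := h 0 (by decide)
  have h1 := h 1 (by decide)
  rw [Zbar.code_eq] at h0 h1
  change (certificate θ x).getD ((u : ℕ) + u + 1) 0 = (x u).tag at h0
  change (certificate θ x).getD ((u : ℕ) + u + 2) 0 = (x u).toInt at h1
  rw [decodeVec, h0, h1]
  rcases Zbar.cases' (x u) with h | h | ⟨k, h⟩ <;> rw [h] <;> simp [Zbar.tag, Zbar.toInt]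

theorem bitSize_le {y : List ℤ} {k : ℕ} (h : ∀ z ∈ y, Nat.size z.natAbs ≤ k) :
    bitSize y ≤ y.length * (k + 1) := by
  unfold bitSize
  have := List.sum_le_card_nsmul (y.map fun z => Nat.size z.natAbs + 1) (k + 1) (by
    intro z hz
    obtain ⟨w, hw, rfl⟩ := List.mem_map.1 hz
    exact Nat.succ_le_succ (h w hw))
  simpa using this

theorem bitSize_certificate_le {θ : ℤ} {x : Fin n → Zbar} {B k : ℕ} (hk : 0 < k)
    (hB : B < 2 ^ k) (hθ : θ.natAbs ≤ B) (hx : ∀ u j, x u = ofInt j → j.natAbs ≤ B) :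
    bitSize (certificate θ x) ≤ (1 + 2 * n) * (k + 1) := by
  have hlen : (certificate θ x).length = 1 + 2 * n := by
    simp [certificate, Zbar.code_eq, List.length_flatMap]
    ring
  rw [← hlen]
  refine bitSize_le fun z hz => Nat.size_le.2 ?_
  simp only [certificate, List.mem_cons, List.mem_flatMap, Zbar.code_eq] at hz
  rcases hz with rfl | ⟨u, -, rfl | rfl | hz⟩
  · exact hθ.trans_lt hB
  · refine lt_of_le_of_lt ?_ (Nat.one_lt_two_pow hk.ne')
    rcases Zbar.cases' (x u) with h | h | ⟨j, h⟩ <;> rw [h] <;> simp [Zbar.tag]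
  · refine lt_of_le_of_lt ?_ hB
    rcases Zbar.cases' (x u) with h | h | ⟨j, h⟩
    · rw [h]; simp [Zbar.toInt]
    · rw [h]; simp [Zbar.toInt]
    · rw [h]; exact hx u j h
  · simp at hz

/-- Reads an entry of the vector of a certificate. -/
def loadBody : Cmd :=
  .seq (.ifLe (.read 2 (.plus (.plus idx idx) (.const 1))) (.const (-1))
    (.seq (.store 27 idx (.const (-1))) (.store 28 idx (.const 0)))
    (.ifLe (.const 1) (.read 2 (.plus (.plus idx idx) (.const 1)))
      (.seq (.store 27 idx (.const 1)) (.store 28 idx (.const 0)))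
      (.seq (.store 27 idx (.const 0))
        (.store 28 idx (.read 2 (.plus (.plus idx idx) (.const 2)))))))
    (.seq (.store 12 idx (.read 27 idx)) (.store 13 idx (.read 28 idx)))

theorem loadBody_runs {y : List ℤ} (h2 : s 2 = listArray y) (h9 : s 9 0 = n) :
    Runs (forLoop 18 9 loadBody) s (n * 94 + 11) fun s' =>
      HoldsVec 12 13 (fun u : Fin n => decodeVec y u) s' ∧
        HoldsVec 27 28 (fun u : Fin n => decodeVec y u) s' := by
  refine Runs.localLoop (t := 80) [12, 13, 27, 28] (fun a k => if a = 12 ∨ a = 27 then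
    (decodeVec y k).tag else (decodeVec y k).toInt) rfl (by decide) (by decide) (by decide)
    (by decide) (by decide) h9 ?_ ?_ le_rfl
  · intro k hk s' hs hki _ a ha j
    have e : s' 2 = listArray y := by rw [hs 2 (by decide) (by decide), h2]
    have e1 : s' 2 ((k : ℤ) + k + 1) = y.getD (k + k + 1) 0 := by
      rw [e, ← listArray_natCast]; norm_cast
    have e2 : s' 2 ((k : ℤ) + k + 2) = y.getD (k + k + 2) 0 := by
      rw [e, ← listArray_natCast]; norm_cast
    unfold decodeVec
    generalize y.getD (k + k + 1) 0 = p at *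
    generalize y.getD (k + k + 2) 0 = q at *
    have key : ∀ x : Zbar, ∀ r : State, (∀ j : ℕ, r 12 (j : ℤ) = if j = k then x.tag else s' 12 j) →
        (∀ j : ℕ, r 13 (j : ℤ) = if j = k then x.toInt else s' 13 j) →
        (∀ j : ℕ, r 27 (j : ℤ) = if j = k then x.tag else s' 27 j) →
        (∀ j : ℕ, r 28 (j : ℤ) = if j = k then x.toInt else s' 28 j) →
        r a (j : ℤ) = if j = k then (if a = 12 ∨ a = 27 then x.tag else x.toInt) else s' a j := by
      intro x r h1 h2 h3 h4
      simp only [List.mem_cons, List.not_mem_nil, or_false] at ha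
      rcases ha with rfl | rfl | rfl | rfl
      · simpa using h1 j
      · simpa using h2 j
      · simpa using h3 j
      · simpa using h4 j
    apply key <;> intro j <;> by_cases h1 : p ≤ -1 <;> by_cases h2 : 1 ≤ p <;>
      simp [loadBody, Cmd.run, Expr.eval, hki, e1, e2, h1, h2, Zbar.tag, Zbar.toInt, Nat.cast_inj]
  · intro s' _ h
    have h12 := h 12 (by decide)
    have h13 := h 13 (by decide)
    have h27 := h 27 (by decide)
    have h28 := h 28 (by decide)
    norm_num at h12 h13 h27 h28
    exact ⟨fun u => ⟨h12 u u.2, h13 u u.2⟩, fun u => ⟨h27 u u.2, h28 u u.2⟩⟩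

/-- The verifier of certificates finds that the vector `x` is at most its image under the clipped
one-step operator, that its tags are at most those of `b`, and that its entry at `v` is not `-∞`. -/
def Accepts (G : MCRGame (Fin n)) (b : Fin n → ℤ) (v : Fin n) (θ : ℤ) (x : Fin n → Zbar) : Prop :=
  (∀ u, (x u).tag ≤ b u ∧ x u ≤ G.clipStep θ x u) ∧ x v ≠ ⊥

/-- Checks an entry of a vector (arrays `27` and `28`) for being at most that of the image
(arrays `12` and `13`), and its tag for being at most the bound in the array `30`. -/
def checkBody : Cmd :=
  .seq (.ifLe (.read 27 idx) (.read 30 idx) .skip (setVar 29 (.const 0)))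
    (ifLexLe (.read 27 idx) (.read 28 idx) (.read 12 idx) (.read 13 idx) .skip
      (setVar 29 (.const 0)))

/-- Decides whether the certificate is accepted. -/
def verify : Cmd :=
  .seq (setVar 17 (.read 2 (.const 0))) (.seq (forLoop 18 9 loadBody) (.seq iteration
    (.seq (.ifLe (.const 0) (.read 27 (var 11)) (setVar 29 (.const 1)) (setVar 29 (.const 0)))
      (.seq (forLoop 18 9 checkBody) (answerIf (.const 1) (var 29))))))

theorem verify_runs (hes : ∀ e, e ∈ es ↔ e ∈ G.edges) (hG : HoldsGame G es s) {y : List ℤ}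
    {v : Fin n} {b : Fin n → ℤ} (h2 : s 2 = listArray y) (h11 : s 11 0 = ((v : ℕ) : ℤ))
    (h30 : ∀ u : Fin n, s 30 ((u : ℕ) : ℤ) = b u) :
    Runs verify s (500 * (n + es.length + 1)) (Holds 0 1 (answer
      (Accepts G b v (y.getD 0 0) fun u => decodeVec y u))) := by
  set x : Fin n → Zbar := fun u => decodeVec y u with hx
  obtain ⟨θ, hθ⟩ : ∃ θ, θ = y.getD 0 0 := ⟨_, rfl⟩
  rw [← hθ]
  refine Runs.seq (t₁ := 5) (t₂ := n * 94 + n * 94 + 200 * (n + es.length + 1) + 100)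
    (P := fun s' => s' 17 0 = θ) (Runs.straight rfl (by decide) ?_) ?_ (by omega)
  · simp [Cmd.run, Expr.eval, h2, listArray, hθ]
  intro s₁ a17 hs₁
  have hG₁ : HoldsGame G es s₁ := hG.congr fun a ha => hs₁ a (by revert ha; revert a; decide)
  refine Runs.seq (t₁ := n * 94 + 11) (t₂ := n * 94 + 200 * (n + es.length + 1) + 88)
    (loadBody_runs (by rw [hs₁ 2 (by decide), h2]) hG₁.card) ?_ (by omega)
  rintro s₂ ⟨hx₂, hy₂⟩ hs₂
  have hG₂ : HoldsGame G es s₂ := hG₁.congr fun a ha => hs₂ a (by revert ha; revert a; decide)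
  refine Runs.seq (t₁ := 200 * (n + es.length + 1)) (t₂ := n * 94 + 87)
    (iteration_runs hes hG₂ hx₂ (by rw [hs₂ 17 (by decide), a17])) ?_ (by omega)
  rintro s₃ ⟨hx₃, -⟩ hs₃
  have hy₃ := hy₂.congr (hs₃ 27 (by decide)) (hs₃ 28 (by decide))
  have h11₃ : s₃ 11 0 = ((v : ℕ) : ℤ) := by
    rw [hs₃ 11 (by decide), hs₂ 11 (by decide), hs₁ 11 (by decide), h11]
  refine Runs.seq (t₁ := 12) (t₂ := n * 94 + 74)
    (P := fun s' => s' 29 0 = if x v ≠ ⊥ then 1 else 0) (Runs.straight rfl (by decide) ?_) ?_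
    (by omega)
  · have h27 := (hy₃ v).1
    rw [Zbar.tag_eq] at h27
    by_cases hb : x v = ⊥
    · rw [if_pos hb] at h27
      simp [Cmd.run, Expr.eval, h11₃, h27, hb]
    · rw [if_neg hb] at h27
      have : 0 ≤ s₃ 27 ((v : ℕ) : ℤ) := by rw [h27]; split_ifs <;> decide
      simp [Cmd.run, Expr.eval, h11₃, this, hb]
  intro s₄ h29 hs₄
  have hy₄ := hy₃.congr (hs₄ 27 (by decide)) (hs₄ 28 (by decide))
  have hx₄ := hx₃.congr (hs₄ 12 (by decide)) (hs₄ 13 (by decide))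
  have h9₄ : s₄ 9 0 = n := by rw [hs₄ 9 (by decide), hs₃ 9 (by decide), hG₂.card]
  have h30₄ : ∀ u : Fin n, s₄ 30 ((u : ℕ) : ℤ) = b u := by
    intro u
    rw [hs₄ 30 (by decide), hs₃ 30 (by decide), hs₂ 30 (by decide), hs₁ 30 (by decide), h30]
  refine Runs.seq (t₁ := n * 94 + 11) (t₂ := 30)
    (P := fun s' => s' 29 0 = if (∀ u, (x u).tag ≤ b u ∧ x u ≤ G.clipStep (θ) x u) ∧
      x v ≠ ⊥ then 1 else 0)
    (Runs.forLoop (t := 80) (fun k s' => s' 29 0 = if (∀ u : Fin n, (u : ℕ) < k →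
      (x u).tag ≤ b u ∧ x u ≤ G.clipStep (θ) x u) ∧ x v ≠ ⊥ then 1 else 0)
      (by decide) (by decide) (by decide) h9₄ ?_ ?_ ?_ le_rfl) ?_ (by omega)
  · simp [h29]
  · intro k hk s' hs hki hInv
    refine Runs.straight rfl (by decide) ?_
    have f : s₄ 27 (k : ℤ) = (x ⟨k, hk⟩).tag ∧ s₄ 28 (k : ℤ) = (x ⟨k, hk⟩).toInt := hy₄ ⟨k, hk⟩
    have g : s₄ 12 (k : ℤ) = (G.clipStep (θ) x ⟨k, hk⟩).tag ∧
        s₄ 13 (k : ℤ) = (G.clipStep (θ) x ⟨k, hk⟩).toInt := hx₄ ⟨k, hk⟩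
    have i30 : s₄ 30 (k : ℤ) = b ⟨k, hk⟩ := h30₄ ⟨k, hk⟩
    rw [← hs 27 (by decide) (by decide), ← hs 28 (by decide) (by decide)] at f
    rw [← hs 12 (by decide) (by decide), ← hs 13 (by decide) (by decide)] at g
    rw [← hs 30 (by decide) (by decide)] at i30
    have hsplit : (∀ u : Fin n, (u : ℕ) < k + 1 → (x u).tag ≤ b u ∧
        x u ≤ G.clipStep (θ) x u) ↔ (∀ u : Fin n, (u : ℕ) < k → (x u).tag ≤ b u ∧
        x u ≤ G.clipStep (θ) x u) ∧ (x ⟨k, hk⟩).tag ≤ b ⟨k, hk⟩ ∧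
        x ⟨k, hk⟩ ≤ G.clipStep (θ) x ⟨k, hk⟩ := by
      constructor
      · exact fun h => ⟨fun u hu => h u (by omega), h ⟨k, hk⟩ (Nat.lt_succ_self k)⟩
      · rintro ⟨h1, h2⟩ u hu
        by_cases huk : (u : ℕ) = k
        · obtain rfl : u = ⟨k, hk⟩ := Fin.ext huk
          exact h2
        · exact h1 u (by omega)
    simp only [hsplit]
    rw [checkBody, Cmd.run]
    set r := (Cmd.ifLe (.read 27 idx) (.read 30 idx) .skip (setVar 29 (.const 0))).run s' with hr
    have hr29 : r 29 0 = if (x ⟨k, hk⟩).tag ≤ b ⟨k, hk⟩ then s' 29 0 else 0 := by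
      by_cases c : (x ⟨k, hk⟩).tag ≤ b ⟨k, hk⟩ <;> simp [hr, Cmd.run, Expr.eval, hki, f.1, i30, c]
    have hfr : ∀ a, a ≠ 29 → r a = s' a := fun a ha =>
      Cmd.run_eq_of_notMem_writes rfl s' (by simp [Cmd.writes, ha])
    rw [run_ifLexLe (x := x ⟨k, hk⟩) (y := G.clipStep (θ) x ⟨k, hk⟩)
      (by simp only [Expr.eval, hfr 18 (by decide), hfr 27 (by decide), hki, f.1])
      (by simp only [Expr.eval, hfr 18 (by decide), hfr 28 (by decide), hki, f.2])
      (by simp only [Expr.eval, hfr 18 (by decide), hfr 12 (by decide), hki, g.1])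
      (by simp only [Expr.eval, hfr 18 (by decide), hfr 13 (by decide), hki, g.2])]
    by_cases c1 : (x ⟨k, hk⟩).tag ≤ b ⟨k, hk⟩ <;>
      by_cases c2 : x ⟨k, hk⟩ ≤ G.clipStep (θ) x ⟨k, hk⟩ <;>
      simp [c1, c2, Cmd.run, hr29, hInv, Expr.eval]
  · intro s' _ h
    rw [h]
    simp
  · intro s₅ h29₅ _
    refine answerIf_runs ?_ (by decide)
    simp only [Expr.eval, h29₅, Accepts]
    split_ifs with h <;> simp [h]

theorem maxWeight_lt (a : MCRInstance) : a.1.game.maxWeight < 2 ^ bitSize a.code := by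
  refine (Finset.sup_lt_iff (Nat.two_pow_pos _)).2 fun e he => Nat.size_le.1 ?_
  exact size_le_bitSize (List.mem_cons_of_mem _ (weight_mem_code a.1 he))

/-- A bound on the size of the certificates in terms of the size of the instance. -/
theorem bitSize_certificate_le_of_instance (a : MCRInstance) {θ : ℤ} {x : Fin a.1.n → Zbar} {B : ℕ}
    (hB : B ≤ a.1.n * (a.1.n * a.1.game.maxWeight + 1)) (hθ : θ.natAbs ≤ B)
    (hx : ∀ u j, x u = ofInt j → j.natAbs ≤ B) :
    bitSize (certificate θ x) ≤
      (Polynomial.X * (3 * Polynomial.X + 1) : Polynomial ℕ).eval (bitSize a.code) := by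
  have hlen := length_le_bitSize a.code
  rw [length_instance_code] at hlen
  have hW := maxWeight_lt a
  set L := bitSize a.code with hL
  have hn : a.1.n < 2 ^ L := lt_of_lt_of_le Nat.lt_two_pow_self
    (Nat.pow_le_pow_right (by decide) (by omega))
  have hn0 : 0 < a.1.n := Fin.pos a.2
  have h1 : a.1.n * a.1.game.maxWeight < 2 ^ L * 2 ^ L := Nat.mul_lt_mul'' hn hW
  have h2 : a.1.n * (a.1.n * a.1.game.maxWeight + 1) < 2 ^ L * (2 ^ L * 2 ^ L) :=
    lt_of_le_of_lt (Nat.mul_le_mul_left _ h1) (Nat.mul_lt_mul_of_pos_right hn (by positivity))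
  have h3 : 2 ^ L * (2 ^ L * 2 ^ L) = 2 ^ (3 * L) := by rw [← pow_add, ← pow_add]; congr 1; ring
  have h4 := bitSize_certificate_le (k := 3 * L) (by omega) (h3 ▸ lt_of_le_of_lt hB h2) hθ hx
  simp only [Polynomial.eval_mul, Polynomial.eval_add, Polynomial.eval_X, Polynomial.eval_ofNat,
    Polynomial.eval_one]
  exact h4.trans (Nat.mul_le_mul_right _ (by omega))

/-! ### The problem of values `-∞` is in coNP -/

theorem accepts_iff_of_tags {b : Fin n → ℤ} (hb : ∀ u, b u = 1) {v : Fin n} {θ : ℤ}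
    {x : Fin n → Zbar} : Accepts G b v θ x ↔ x ≤ G.clipStep θ x ∧ x v ≠ ⊥ := by
  refine and_congr_left fun _ => forall_congr' fun u => and_iff_right ?_
  rw [hb, Zbar.tag_eq]
  split_ifs <;> decide

/-- Sets all tag bounds to `1`. -/
def allTags : Cmd := forLoop 18 9 (.store 30 idx (.const 1))

theorem allTags_runs (h9 : s 9 0 = n) : Runs allTags s (n * 34 + 11) fun s' =>
    ∀ u : Fin n, s' 30 ((u : ℕ) : ℤ) = 1 := by
  refine Runs.localLoop (t := 20) [30] (fun _ _ => 1) rfl (by decide) (by decide) (by decide)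
    (by decide) (by decide) h9 ?_ ?_ le_rfl
  · intro k hk s' hs hki _ a ha j
    obtain rfl := List.mem_singleton.1 ha
    simp [Cmd.run, Expr.eval, hki]
  · exact fun s' _ h u => h 30 (by decide) u u.2

/-- The values themselves are a certificate for a value above `-∞`, as every vector `x ≤ F(x)` is a
bound from below for them. The clipping bound of the certificate is that of value iteration. -/
theorem coNP_valueNegInf : CoNP MCRInstance.code ValueNegInf := by
  refine ⟨.seq readInstance (.seq allTags verify), 1000 * Polynomial.X,
    Polynomial.X * (3 * Polynomial.X + 1), fun a y => Accepts a.1.game (fun _ => 1) a.2 (y.getD 0 0)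
      fun u => decodeVec y u, fun a y _ => ?_, fun a => ?_⟩
  · have hlen := length_le_bitSize a.code
    rw [length_instance_code] at hlen
    refine Runs.outputsWithin (t := 1000 * bitSize a.code) (Runs.seq
      (t₂ := a.1.n * 34 + 11 + 500 * (a.1.n + a.1.edgeList.length + 1) + 1)
      (readInstance_runs a y) ?_ (by omega)) (by simp)
    rintro s ⟨hG, h11, h2, -⟩ -
    refine Runs.seq (allTags_runs hG.card) ?_ le_rfl
    intro s₁ h30 hs₁
    refine verify_runs a.1.mem_edgeList
      (hG.congr fun a ha => hs₁ a (by revert ha; revert a; decide)) ?_ ?_ h30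
    · rw [hs₁ 2 (by decide), h2]
    · rw [hs₁ 11 (by decide), h11]
  · simp only [accepts_iff_of_tags (fun _ => rfl)]
    change ¬ a.1.game.value a.2 = ⊥ ↔ _
    rw [MCRGame.value_eq_limitVec]
    constructor
    · intro h
      refine ⟨certificate a.1.game.bound a.1.game.limitVec, ?_, ?_⟩
      · refine bitSize_certificate_le_of_instance a (B := a.1.n * a.1.game.maxWeight)
          (Nat.mul_le_mul_left _ ?_) ?_ ?_
        · exact (Nat.le_mul_of_pos_left _ (Fin.pos a.2)).trans (Nat.le_succ _)
        · rw [MCRGame.bound, Int.natAbs_neg, Int.natAbs_mul, Int.natAbs_natCast, Fintype.card_fin]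
          exact Nat.mul_le_mul_right _ (by have := Fin.pos a.2; omega)
        · intro u j hj
          have h1 := a.1.game.le_limitVec_of_ne_bot (v := u) (by rw [hj]; exact Zbar.ofInt_ne_bot j)
          have h2 : u ∈ a.1.game.attr (Fintype.card (Fin a.1.n)) := by
            rw [← MCRGame.limitVec_ne_top_iff, hj]; exact Zbar.ofInt_ne_top j
          have h3 := (a.1.game.limitVec_le_iter _ u).trans (a.1.game.iter_le_of_mem_attr h2)
          rw [hj, Zbar.ofInt_le, Fintype.card_fin] at h1 h3
          have h4 : ((a.1.n : ℤ) - 1) * a.1.game.maxWeight ≤ a.1.n * a.1.game.maxWeight :=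
            mul_le_mul_of_nonneg_right (by omega) (by omega)
          zify
          rw [abs_le]
          constructor <;> linarith
      · simp only [decodeVec_certificate]
        exact ⟨a.1.game.le_clipStep_limitVec, h⟩
    · rintro ⟨y, -, h1, h2⟩ h
      have := a.1.game.le_limitVec (h1.trans (a.1.game.clipStep_le_op _ _)) a.2
      rw [h] at this
      exact h2 (le_bot_iff.1 this)

end RAM

/-! ### The problem of values `-∞` is in NP -/

/-- The dual game, with the same target. A vector that is a potential of the dual graph on the
active vertices and `-∞` elsewhere is at most its image under the one-step operator of this game. -/
noncomputable def MCRGame.dualGame {n : ℕ} (G : MCRGame (Fin n)) : MCRGame (Fin n) where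
  toWeightedGraph := G.toWeightedGraph.dual n
  target := G.target

/-- The bounds on the tags of a potential: the entries are finite or `-∞` on the active vertices,
and `-∞` elsewhere. -/
noncomputable def MCRGame.activeTag {n : ℕ} (G : MCRGame (Fin n)) (u : Fin n) : ℤ :=
  if u ∈ G.activeSet then 0 else -1

namespace RAM

variable {n : ℕ} {G : MCRGame (Fin n)} {es : List (Fin n × Fin n)} {s : State}

theorem potential_of_accepts {v : Fin n} {θ : ℤ} {x : Fin n → Zbar}
    (h : Accepts G.dualGame G.activeTag v θ x) : G.Negative G.activeSet v := by
  refine ⟨n, x, ⟨fun u hu => ?_, fun u hu => ?_, fun u hu hx => ?_⟩, h.2⟩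
  · have := ((h.1 u).2).trans (G.dualGame.clipStep_le_op θ x u)
    rwa [G.dualGame.op_not_target hu.2] at this
  · have := (h.1 u).1
    rw [MCRGame.activeTag, if_neg hu, Zbar.tag_eq] at this
    by_contra hb
    rw [if_neg hb] at this
    split_ifs at this <;> omega
  · have := (h.1 u).1
    rw [MCRGame.activeTag, if_pos hu, hx] at this
    exact absurd this (by decide)

theorem accepts_of_potential {v : Fin n} {θ : ℤ} {x : Fin n → Zbar}
    (h : (G.toWeightedGraph.dual n).Potential G.activeSet ⊥ x) (hv : x v ≠ ⊥)
    (hθ : ∀ u k, x u = ofInt k → θ ≤ k) : Accepts G.dualGame G.activeTag v θ x := by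
  refine ⟨fun u => ?_, hv⟩
  by_cases hu : u ∈ G.activeSet
  · have htop := h.ne_top u hu
    constructor
    · rw [MCRGame.activeTag, if_pos hu, Zbar.tag_eq, if_neg htop]
      split_ifs <;> decide
    · by_cases hb : x u = ⊥
      · rw [hb]; exact bot_le
      obtain ⟨k, hk⟩ := Zbar.exists_ofInt hb htop
      have h1 : x u ≤ G.dualGame.op x u := by
        rw [G.dualGame.op_not_target hu.2]; exact h.isPotential u hu
      have h2 : ofInt θ ≤ x u := by rw [hk, Zbar.ofInt_le]; exact hθ u k hk
      rw [MCRGame.clipStep, if_neg fun h' => absurd (h2.trans h1) (not_le.2 h'.2)]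
      exact h1
  · rw [h.eq_const u hu, MCRGame.activeTag, if_neg hu]
    exact ⟨le_rfl, bot_le⟩

/-- Sets the bound on a tag and exchanges the owner of a vertex. -/
def dualVertexBody : Cmd :=
  .seq (.ifLe (.read 12 idx) (.const 0)
      (.ifLe (.read 5 idx) (.const 0) (.store 30 idx (.const 0)) (.store 30 idx (.const (-1))))
      (.store 30 idx (.const (-1))))
    (.store 4 idx (.minus (.const 1) (.read 4 idx)))

/-- Replaces a game by its dual, after the computation of the attractor. -/
def dualize : Cmd :=
  .seq (forLoop 18 9 dualVertexBody)
    (.seq (forLoop 19 9 (forLoop 18 10 (.store 31 idx (.plus (.read 31 idx) (.read 8 idx)))))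
      (forLoop 18 10 (.store 8 idx (.minus (.const 0) (.plus (.read 31 idx) (.const 1))))))

theorem dualize_runs (hG : HoldsGame G es s)
    (hattr : ∀ v : Fin n, 1 ≤ s 12 ((v : ℕ) : ℤ) ↔ v ∉ G.attr n) (h31 : s 31 = fun _ => 0) :
    Runs dualize s (200 * ((n + 1) * (n + es.length + 1))) fun s' => HoldsGame G.dualGame es s' ∧
      ∀ u : Fin n, s' 30 ((u : ℕ) : ℤ) = G.activeTag u := by
  have hmul : (n + 1) * (n + es.length + 1) = n * es.length + n * n + 2 * n + es.length + 1 := by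
    ring
  refine Runs.seq (t₁ := n * 54 + 11) (t₂ := n * ((es.length * 44 + 11) + 14) + 11 +
      (es.length * 44 + 11) + 1)
    (P := fun s' => (∀ u : Fin n, s' 30 ((u : ℕ) : ℤ) = G.activeTag u) ∧
      ∀ u : Fin n, s' 4 ((u : ℕ) : ℤ) = if u ∈ G.dualGame.maxV then 1 else 0)
    (Runs.localLoop (t := 40) [30, 4] (fun a k => if h : k < n then (if a = 30 then
      G.activeTag ⟨k, h⟩ else if ⟨k, h⟩ ∈ G.dualGame.maxV then 1 else 0) else 0) rfl (by decide)
      (by decide) (by decide) (by decide) (by decide) hG.card ?_ ?_ le_rfl) ?_ ?_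
  · intro k hk s' hs hki hA a ha j
    have h4 : s' 4 (k : ℤ) = if ⟨k, hk⟩ ∈ G.maxV then 1 else 0 := by
      rw [hA 4 (by decide)]; exact hG.own ⟨k, hk⟩
    have h5 : s' 5 (k : ℤ) = if ⟨k, hk⟩ ∈ G.target then 1 else 0 := by
      rw [hs 5 (by decide) (by decide)]; exact hG.tgt ⟨k, hk⟩
    have h12 : s' 12 (k : ℤ) ≤ 0 ↔ ⟨k, hk⟩ ∈ G.attr n := by
      rw [hs 12 (by decide) (by decide), ← not_iff_not, ← hattr, not_le]
      exact Iff.rfl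
    have hm : (⟨k, hk⟩ : Fin n) ∈ G.dualGame.maxV ↔ ⟨k, hk⟩ ∉ G.maxV :=
      WeightedGraph.mem_dual_maxV
    have hact : (⟨k, hk⟩ : Fin n) ∈ G.activeSet ↔ ⟨k, hk⟩ ∈ G.attr n ∧ ⟨k, hk⟩ ∉ G.target := by
      rw [MCRGame.activeSet, Fintype.card_fin]; exact Iff.rfl
    simp only [List.mem_cons, List.not_mem_nil, or_false] at ha
    by_cases c1 : (⟨k, hk⟩ : Fin n) ∈ G.attr n <;> by_cases c2 : (⟨k, hk⟩ : Fin n) ∈ G.target <;>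
      by_cases c3 : (⟨k, hk⟩ : Fin n) ∈ G.maxV <;> rcases ha with rfl | rfl <;>
      simp [dualVertexBody, Cmd.run, Expr.eval, hki, h4, h5, h12, c1, c2, c3, hm, hact, hk,
        MCRGame.activeTag]
  · intro s' _ h
    refine ⟨fun u => ?_, fun u => ?_⟩
    · simpa using h 30 (by decide) u u.2
    · simpa using h 4 (by decide) u u.2
  · rintro s₁ ⟨h30, h4⟩ hs₁
    have h10 : s₁ 10 0 = es.length := by rw [hs₁ 10 (by decide), hG.size]
    have h9 : s₁ 9 0 = n := by rw [hs₁ 9 (by decide), hG.card]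
    have h8 : ∀ (k : ℕ) (h : k < es.length), s₁ 8 (k : ℤ) = G.weight es[k].1 es[k].2 := by
      rw [hs₁ 8 (by decide)]; exact hG.wt
    refine Runs.seq (t₁ := n * ((es.length * 44 + 11) + 14) + 11) (t₂ := es.length * 44 + 11)
      (P := fun s' => ∀ (k : ℕ) (h : k < es.length),
        s' 31 (k : ℤ) = (n : ℤ) * G.weight es[k].1 es[k].2)
      (Runs.forLoop (t := es.length * 44 + 11) (fun i s' => ∀ (k : ℕ) (h : k < es.length),
        s' 31 (k : ℤ) = (i : ℤ) * G.weight es[k].1 es[k].2) (by decide) (by decide) (by decide) h9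
        ?_ ?_ (fun _ _ h => h) le_rfl) ?_ le_rfl
    · intro k hk
      rw [State.set_of_ne (by decide), hs₁ 31 (by decide), h31]
      simp
    · intro i hi s' hs hki hInv
      refine Runs.localLoop (t := 30) [31] (fun _ k => s' 31 k + s' 8 k) rfl (by decide) (by decide)
        (by decide) (by decide) (by decide) (by rw [hs 10 (by decide) (by decide), h10]) ?_ ?_
        le_rfl
      · intro k hk s'' hs' hki' hA a ha j
        obtain rfl := List.mem_singleton.1 ha
        have := hA 31 (by decide)
        have h8' := hs' 8 (by decide) (by decide)
        simp [Cmd.run, Expr.eval, hki', this, h8']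
      · intro s'' hs' h k hk
        rw [State.set_of_ne (by decide), h 31 (by decide) k hk, hInv k hk,
          hs 8 (by decide) (by decide), h8 k hk]
        push_cast
        ring
    intro s₂ hw hs₂
    refine Runs.localLoop (t := 30) [8] (fun _ k => 0 - (s₂ 31 k + 1)) rfl (by decide) (by decide)
      (by decide) (by decide) (by decide) (by rw [hs₂ 10 (by decide), h10]) ?_ ?_ le_rfl
    · intro k hk s'' hs' hki' hA a ha j
      obtain rfl := List.mem_singleton.1 ha
      have h31' := hs' 31 (by decide) (by decide)
      simp [Cmd.run, Expr.eval, hki', h31']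
    · intro s₃ hs₃ h
      have hfr : ∀ a, a ≠ 8 → a ≠ 18 → s₃ a = s₂ a := fun a h8 h18 =>
        hs₃ a (by simp [Cmd.writes, h8]) h18
      have hall : ∀ a ∈ [5, 6, 7, 9, 10], s₃ a = s a := by
        intro a ha
        rw [hfr a (by revert ha; revert a; decide) (by revert ha; revert a; decide),
          hs₂ a (by revert ha; revert a; decide), hs₁ a (by revert ha; revert a; decide)]
      refine ⟨?_, fun u => ?_⟩
      · exact {
          own := fun u => by rw [hfr 4 (by decide) (by decide), hs₂ 4 (by decide), h4]
          tgt := by rw [hall 5 (by decide)]; exact hG.tgt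
          src := by rw [hall 6 (by decide)]; exact hG.src
          dst := by rw [hall 7 (by decide)]; exact hG.dst
          wt := fun k hk => by
            rw [h 8 (by decide) k hk, hw k hk, zero_sub]; rfl
          card := by rw [hall 9 (by decide), hG.card]
          size := by rw [hall 10 (by decide), hG.size] }
      · rw [hfr 30 (by decide) (by decide), hs₂ 30 (by decide), h30]
  · rw [hmul]
    have : n * (es.length * 44 + 11 + 14) = 44 * (n * es.length) + 25 * n := by ring
    rw [this]
    generalize n * es.length = q
    generalize n * n = r
    omega

/-- A potential of the dual game is a certificate for the value `-∞`. The attractor, on which it has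
to live, is computed by the verifier. -/
theorem np_valueNegInf : NP MCRInstance.code ValueNegInf := by
  refine ⟨.seq attractorCmd (.seq dualize verify), 2000 * Polynomial.X ^ 2,
    Polynomial.X * (3 * Polynomial.X + 1), fun a y => Accepts a.1.game.dualGame a.1.game.activeTag
      a.2 (y.getD 0 0) fun u => decodeVec y u, fun a y _ => ?_, fun a => ?_⟩
  · have hlen := length_le_bitSize a.code
    rw [length_instance_code] at hlen
    have hmul : (a.1.n + 1) * (a.1.n + a.1.edgeList.length + 1) ≤
        bitSize a.code * bitSize a.code := Nat.mul_le_mul (by omega) (by omega)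
    have hmul' : a.1.n + a.1.edgeList.length + 1 ≤
        (a.1.n + 1) * (a.1.n + a.1.edgeList.length + 1) :=
      Nat.le_mul_of_pos_left _ (Nat.succ_pos _)
    refine Runs.outputsWithin (t := 2000 * (bitSize a.code * bitSize a.code)) (Runs.seq
      (t₂ := 200 * ((a.1.n + 1) * (a.1.n + a.1.edgeList.length + 1)) +
        500 * (a.1.n + a.1.edgeList.length + 1) + 1)
      (attractorCmd_runs a y) ?_ (by omega)) (by simp [pow_two])
    rintro s ⟨hG, h11, h2, hzero, hattr⟩ -
    refine Runs.seq (dualize_runs hG hattr (hzero 31 (by decide))) ?_ le_rfl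
    rintro s₁ ⟨hG₁, h30⟩ hs₁
    refine verify_runs (G := a.1.game.dualGame) a.1.mem_edgeList hG₁ ?_ ?_ h30
    · rw [hs₁ 2 (by decide), h2]
    · rw [hs₁ 11 (by decide), h11]
  · change a.1.game.value a.2 = ⊥ ↔ _
    rw [MCRGame.value_eq_bot_iff]
    constructor
    · intro h
      obtain ⟨p, hp, hv, hsmall⟩ := WeightedGraph.negative_iff.1 h
      rw [Fintype.card_fin] at hp hsmall
      have hW := a.1.game.dual_maxWeight_le a.1.n
      refine ⟨certificate (-(a.1.n * (a.1.game.toWeightedGraph.dual a.1.n).maxWeight : ℤ)) p,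
        bitSize_certificate_le_of_instance a (Nat.mul_le_mul_left _ hW) ?_ fun u j hj => ?_, ?_⟩
      · rw [Int.natAbs_neg, Int.natAbs_mul, Int.natAbs_natCast, Int.natAbs_natCast]
      · obtain ⟨h1, h2⟩ := hsmall u j hj
        zify
        rw [abs_le]
        constructor
        · exact h2
        · exact h1.trans (by positivity)
      · simp only [decodeVec_certificate]
        exact accepts_of_potential hp hv fun u k hk => (hsmall u k hk).2
    · rintro ⟨y, -, h⟩
      exact potential_of_accepts h

end RAM

/-! ### Programs that write their output -/

namespace RAM

/-- Started in a memory with the property `I`, the program appends `z` to the output within `t`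
steps, and preserves `I`. -/
def Emits (I : State → Prop) (c : Cmd) (t : ℕ) (z : List ℤ) : Prop :=
  ∀ s out, I s → Holds 0 1 out s → Runs c s t fun s' => I s' ∧ Holds 0 1 (out ++ z) s'

/-- The property does not depend on the arrays of the list `A`. -/
def Stable (A : List ℕ) (I : State → Prop) : Prop :=
  ∀ s s' : State, I s → (∀ a ∉ A, s' a = s a) → I s'

/-- The memory differs from `s₀` only in the output and in the loop variables. -/
def Agree (s₀ s : State) : Prop := ∀ a ∉ [0, 1, 18, 19], s a = s₀ a

theorem stable_agree {A : List ℕ} (hA : A ⊆ [0, 1, 18, 19]) (s₀ : State) : Stable A (Agree s₀) :=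
  fun _ _ h hs a ha => (hs a fun h' => ha (hA h')).trans (h a ha)

theorem Stable.and_var {A : List ℕ} {I : State → Prop} (h : Stable A I) {i : ℕ} (hi : i ∉ A)
    (k : ℤ) : Stable A fun s => I s ∧ s i 0 = k :=
  fun s s' hI hs => ⟨h s s' hI.1 hs, by rw [hs i hi, hI.2]⟩

/-- Writes a triple. -/
def pushTriple (e₁ e₂ e₃ : Expr) : Cmd := .seq (push 0 1 e₁) (.seq (push 0 1 e₂) (push 0 1 e₃))

namespace Emits

variable {I : State → Prop} {c c₁ c₂ : Cmd} {t t₁ t₂ : ℕ} {z z₁ z₂ : List ℤ}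

theorem seq (h₁ : Emits I c₁ t₁ z₁) (h₂ : Emits I c₂ t₂ z₂) :
    Emits I (.seq c₁ c₂) (t₁ + t₂ + 1) (z₁ ++ z₂) := by
  intro s out hI hout
  refine Runs.seq (h₁ s out hI hout) ?_ le_rfl
  rintro s' ⟨hI', hout'⟩ -
  rw [← List.append_assoc]
  exact h₂ s' _ hI' hout'

theorem mono (h : Emits I c t₁ z) (ht : t₁ ≤ t₂) : Emits I c t₂ z :=
  fun s out hI hout => (h s out hI hout).mono ht fun _ h => h

theorem push (hI : Stable [0, 1] I) {e : Expr} {x : ℤ} (he : ∀ s, I s → e.eval s = x) :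
    Emits I (push 0 1 e) (e.cost + 10) [x] := by
  intro s out hs hout
  refine (Runs.push (by decide) hout le_rfl).frame.mono le_rfl fun s' h => ?_
  refine ⟨hI s s' hs fun a ha => h.2 a ?_, he s hs ▸ h.1⟩
  simpa [RAM.push, Cmd.writes] using ha

theorem skip : Emits I .skip 1 [] := by
  intro s out hs hout
  refine ⟨1, s, le_rfl, .skip s, hs, ?_⟩
  rwa [List.append_nil]

theorem ifLe {e₁ e₂ : Expr} {P : Prop} [Decidable P] (hP : ∀ s, I s → (e₁.eval s ≤ e₂.eval s ↔ P))
    (h₁ : Emits I c₁ t z₁) (h₂ : Emits I c₂ t z₂) :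
    Emits I (.ifLe e₁ e₂ c₁ c₂) (e₁.cost + e₂.cost + t + 1) (if P then z₁ else z₂) := by
  intro s out hs hout
  by_cases h : P
  · obtain ⟨t', s', ht, hex, hQ⟩ := h₁ s out hs hout
    rw [if_pos h]
    exact ⟨_, s', by omega, .ifTrue ((hP s hs).2 h) hex, hQ⟩
  · obtain ⟨t', s', ht, hex, hQ⟩ := h₂ s out hs hout
    rw [if_neg h]
    exact ⟨_, s', by omega, .ifFalse (fun h' => h ((hP s hs).1 h')) hex, hQ⟩

theorem forLoop {α : Type*} (l : List α) (f : α → List ℤ) {i b : ℕ} (hI : Stable [0, 1, i] I)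
    (h0 : i ≠ 0) (h1 : i ≠ 1) (hib : i ≠ b) (hi : i ∉ c.writes) (hb : b ∉ c.writes)
    (hN : ∀ s, I s → s b 0 = l.length)
    (hbody : ∀ (k : ℕ) (hk : k < l.length), Emits (fun s => I s ∧ s i 0 = k) c t (f l[k])) :
    Emits I (forLoop i b c) (l.length * (t + 14) + 11) (l.flatMap f) := by
  intro s out hs hout
  refine Runs.forLoop (fun k s' => I s' ∧ Holds 0 1 (out ++ (l.take k).flatMap f) s') hib hi hb
    (hN s hs) ?_ ?_ (fun s' _ h => by rwa [List.take_length] at h) le_rfl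
  · rw [List.take_zero, List.flatMap_nil, List.append_nil]
    refine ⟨hI s _ hs fun a ha => State.set_of_ne fun h => ha (by simp [h]), ?_⟩
    exact hout.congr (State.set_of_ne h0.symm) (State.set_of_ne h1.symm)
  · intro k hk s' _ hki hInv
    refine (hbody k hk s' _ ⟨hInv.1, hki⟩ hInv.2).mono le_rfl fun s'' h => ?_
    refine ⟨hI s'' _ h.1.1 fun a ha => State.set_of_ne fun h => ha (by simp [h]), ?_⟩
    rw [List.take_add_one, List.getElem?_eq_getElem hk, Option.toList_some, List.flatMap_append,
      List.flatMap_singleton, ← List.append_assoc]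
    exact h.2.congr (State.set_of_ne h0.symm) (State.set_of_ne h1.symm)

/-- Starts the output. -/
theorem outputs {s : State} (h : Emits (Agree s) c t z) :
    Runs (.seq (setVar 1 (.const 0)) c) s (t + 4) (Holds 0 1 z) := by
  refine Runs.seq (t₁ := 3) (P := fun s' => s' 1 0 = 0) (Runs.straight rfl (by decide) ?_) ?_
    (by omega : 3 + t + 1 ≤ t + 4)
  · simp [Cmd.run, Expr.eval]
  · intro s' h1 hs
    refine (h s' [] (fun a ha => hs a ?_) ⟨h1, fun i hi => by simp at hi⟩).mono le_rfl
      fun s'' h => by simpa using h.2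
    simp only [List.mem_cons, not_or] at ha
    simp [Cmd.writes, ha.2.1]

theorem push_triple (hI : Stable [0, 1] I) {e₁ e₂ e₃ : Expr} {x₁ x₂ x₃ : ℤ}
    (h₁ : ∀ s, I s → e₁.eval s = x₁) (h₂ : ∀ s, I s → e₂.eval s = x₂)
    (h₃ : ∀ s, I s → e₃.eval s = x₃) :
    Emits I (pushTriple e₁ e₂ e₃) (e₁.cost + e₂.cost + e₃.cost + 32) [x₁, x₂, x₃] :=
  ((push hI h₁).seq ((push hI h₂).seq (push hI h₃))).mono (by omega)

end Emits

end RAM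

/-! ### From mean-payoff games to values `-∞` -/

namespace WeightedGraph

variable {n : ℕ}

/-- The vertex through which a copy of the vertex `v` is entered. -/
def entry (v : Fin n) : Fin (n + n + 1) := Fin.castAdd 1 (Fin.castAdd n v)

/-- The copy of a vertex, with the same owner. -/
def inner (v : Fin n) : Fin (n + n + 1) := Fin.castAdd 1 (Fin.natAdd n v)

/-- The new target. -/
def goal : Fin (n + n + 1) := Fin.natAdd (n + n) 0

theorem val_entry (v : Fin n) : (entry v : ℕ) = v := rfl

theorem val_inner (v : Fin n) : (inner v : ℕ) = n + v := rfl

theorem val_goal : ((goal : Fin (n + n + 1)) : ℕ) = n + n := rfl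

@[simp] theorem entry_inj {v w : Fin n} : entry v = entry w ↔ v = w := by
  rw [Fin.ext_iff, Fin.ext_iff, val_entry, val_entry]

@[simp] theorem inner_inj {v w : Fin n} : inner v = inner w ↔ v = w := by
  rw [Fin.ext_iff, Fin.ext_iff, val_inner, val_inner, Nat.add_left_cancel_iff]

@[simp] theorem entry_ne_inner (v w : Fin n) : entry v ≠ inner w := by
  rw [ne_eq, Fin.ext_iff, val_entry, val_inner]
  omega

@[simp] theorem entry_ne_goal (v : Fin n) : entry v ≠ goal := by
  rw [ne_eq, Fin.ext_iff, val_entry, val_goal]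
  omega

@[simp] theorem inner_ne_goal (v : Fin n) : inner v ≠ goal := by
  rw [ne_eq, Fin.ext_iff, val_inner, val_goal]
  omega

@[simp] theorem inner_ne_entry (v w : Fin n) : inner v ≠ entry w := (entry_ne_inner w v).symm

@[simp] theorem goal_ne_inner (v : Fin n) : goal ≠ inner v := (inner_ne_goal v).symm

/-- A case distinction on the vertices of the game with a target. -/
def splitVertex {β : Type*} (f g : Fin n → β) (b : β) (i : Fin (n + n + 1)) : β :=
  Fin.addCases (fun j => Fin.addCases f g j) (fun _ => b) i

@[simp] theorem splitVertex_entry {β : Type*} (f g : Fin n → β) (b : β) (v : Fin n) :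
    splitVertex f g b (entry v) = f v := by simp [splitVertex, entry]

@[simp] theorem splitVertex_inner {β : Type*} (f g : Fin n → β) (b : β) (v : Fin n) :
    splitVertex f g b (inner v) = g v := by
  simp only [splitVertex, inner, Fin.addCases_left, Fin.addCases_right]

@[simp] theorem splitVertex_goal {β : Type*} (f g : Fin n → β) (b : β) :
    splitVertex f g b goal = b := by simp only [splitVertex, goal, Fin.addCases_right]

theorem vertex_cases (i : Fin (n + n + 1)) :
    (∃ v, i = entry v) ∨ (∃ v, i = inner v) ∨ i = goal := by
  refine Fin.addCases (fun j => ?_) (fun j => ?_) i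
  · refine Fin.addCases (fun v => ?_) (fun v => ?_) j
    · exact Or.inl ⟨v, rfl⟩
    · exact Or.inr (Or.inl ⟨v, rfl⟩)
  · rw [Subsingleton.elim j 0]
    exact Or.inr (Or.inr rfl)

/-- The edges of the game with a target. -/
def exitEdges (es : List (Fin n × Fin n)) : List (Fin (n + n + 1) × Fin (n + n + 1)) :=
  (List.finRange n).map (fun v => (entry v, inner v)) ++
    ((List.finRange n).map (fun v => (entry v, goal)) ++
      (es.map (fun e => (inner e.1, entry e.2)) ++ [(goal, goal)]))

theorem entry_mem_exitEdges {es : List (Fin n × Fin n)} {v : Fin n} {i : Fin (n + n + 1)} :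
    (entry v, i) ∈ exitEdges es ↔ i = inner v ∨ i = goal := by
  simp [exitEdges, eq_comm]

theorem inner_mem_exitEdges {es : List (Fin n × Fin n)} {v : Fin n} {i : Fin (n + n + 1)} :
    (inner v, i) ∈ exitEdges es ↔ ∃ u, i = entry u ∧ (v, u) ∈ es := by
  simp [exitEdges, eq_comm (a := i), and_comm]

theorem goal_mem_exitEdges {es : List (Fin n × Fin n)} {i : Fin (n + n + 1)} :
    (goal, i) ∈ exitEdges es ↔ i = goal := by
  simp [exitEdges]

theorem nodup_exitEdges {es : List (Fin n × Fin n)} (h : es.Nodup) : (exitEdges es).Nodup := by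
  unfold exitEdges
  rw [List.nodup_append, List.nodup_append, List.nodup_append]
  refine ⟨(List.nodup_finRange n).map fun u v h => ?_, ⟨(List.nodup_finRange n).map fun u v h => ?_,
    ⟨h.map fun e f h => ?_, List.nodup_singleton _, ?_⟩, ?_⟩, ?_⟩
  · exact entry_inj.1 (Prod.ext_iff.1 h).1
  · exact entry_inj.1 (Prod.ext_iff.1 h).1
  · exact Prod.ext (inner_inj.1 (Prod.ext_iff.1 h).1) (entry_inj.1 (Prod.ext_iff.1 h).2)
  · rintro a ha b hb rfl
    simp only [List.mem_map, List.mem_singleton] at ha hb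
    obtain ⟨e, -, rfl⟩ := ha
    simp at hb
  · rintro a ha b hb rfl
    simp only [List.mem_map] at ha
    obtain ⟨v, -, rfl⟩ := ha
    simp at hb
  · rintro a ha b hb rfl
    simp only [List.mem_map] at ha
    obtain ⟨v, -, rfl⟩ := ha
    simp at hb

/-- The min-cost reachability game of a mean-payoff game: before every move, Min may go to a new
target, with weight `0`. Thus all vertices are in the attractor, and Min can stop once the payoff is
low enough. -/
noncomputable def exitGame (G : WeightedGraph (Fin n)) (es : List (Fin n × Fin n))
    (hes : ∀ e, e ∈ es ↔ e ∈ G.edges) : MCRGame (Fin (n + n + 1)) where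
  maxV := Finset.univ.filter fun i => splitVertex (fun _ => False) (fun v => v ∈ G.maxV) False i
  edges := (exitEdges es).toFinset
  weight i j := splitVertex (fun _ => 0) (fun v => splitVertex (fun u => G.weight v u)
    (fun _ => 0) 0 j) 0 i
  deadlockFree i := by
    simp only [List.mem_toFinset]
    rcases vertex_cases i with ⟨v, rfl⟩ | ⟨v, rfl⟩ | rfl
    · exact ⟨goal, entry_mem_exitEdges.2 (Or.inr rfl)⟩
    · obtain ⟨u, hu⟩ := G.deadlockFree v
      exact ⟨entry u, inner_mem_exitEdges.2 ⟨u, rfl, (hes _).2 hu⟩⟩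
    · exact ⟨goal, goal_mem_exitEdges.2 rfl⟩
  target := {goal}

variable {G : WeightedGraph (Fin n)} {es : List (Fin n × Fin n)} {hes : ∀ e, e ∈ es ↔ e ∈ G.edges}

@[simp] theorem entry_notMem_exitGame_maxV (v : Fin n) : entry v ∉ (G.exitGame es hes).maxV := by
  simp [exitGame]

@[simp] theorem inner_mem_exitGame_maxV {v : Fin n} :
    inner v ∈ (G.exitGame es hes).maxV ↔ v ∈ G.maxV := by
  simp [exitGame]

theorem exitGame_edge_entry {v : Fin n} {i : Fin (n + n + 1)} :
    (entry v, i) ∈ (G.exitGame es hes).edges ↔ i = inner v ∨ i = goal := by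
  rw [← entry_mem_exitEdges (es := es)]
  exact List.mem_toFinset

theorem exitGame_edge_inner {v : Fin n} {i : Fin (n + n + 1)} :
    (inner v, i) ∈ (G.exitGame es hes).edges ↔ ∃ u, i = entry u ∧ (v, u) ∈ G.edges := by
  simp only [← hes]
  rw [← inner_mem_exitEdges (es := es)]
  exact List.mem_toFinset

@[simp] theorem exitGame_weight_entry (v : Fin n) (i : Fin (n + n + 1)) :
    (G.exitGame es hes).weight (entry v) i = 0 := by simp [exitGame]

@[simp] theorem exitGame_weight_inner (v u : Fin n) :
    (G.exitGame es hes).weight (inner v) (entry u) = G.weight v u := by simp [exitGame]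

theorem exitGame_activeSet (hn : 0 < n) : (G.exitGame es hes).activeSet = {i | i ≠ goal} := by
  set H := G.exitGame es hes with hH
  have h0 : goal ∈ H.target := Finset.mem_singleton_self goal
  have h1 : ∀ v, entry v ∈ H.attr 1 := fun v => H.mem_attr_succ.2 (Or.inr (Or.inl
    ⟨by simp [hH], goal, H.mem_succ.2 (exitGame_edge_entry.2 (Or.inr rfl)), h0⟩))
  have h2 : ∀ v, inner v ∈ H.attr 2 := by
    intro v
    refine H.mem_attr_succ.2 (Or.inr ?_)
    have hs : H.succ (inner v) ⊆ H.attr 1 := by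
      intro i hi
      obtain ⟨u, rfl, -⟩ := exitGame_edge_inner.1 (H.mem_succ.1 hi)
      exact h1 u
    by_cases hm : inner v ∈ H.maxV
    · exact Or.inr ⟨hm, hs⟩
    · obtain ⟨u, hu⟩ := H.deadlockFree (inner v)
      have hu' := H.mem_succ.2 hu
      exact Or.inl ⟨hm, u, hu', hs hu'⟩
  have hcard : 2 ≤ Fintype.card (Fin (n + n + 1)) := by rw [Fintype.card_fin]; omega
  ext i
  refine ⟨fun h hi => h.2 (hi ▸ h0), fun hi => ⟨?_, fun h => hi (Finset.mem_singleton.1 h)⟩⟩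
  rcases vertex_cases i with ⟨v, rfl⟩ | ⟨v, rfl⟩ | rfl
  · exact H.attr_mono (by omega) (h1 v)
  · exact H.attr_mono hcard (h2 v)
  · exact absurd rfl hi

/-- A potential for Max serves for both copies of the vertices. A potential for Min on the copies
has to be adjusted, as two moves take the place of one. -/
theorem negative_exitGame_iff {v : Fin n} :
    (G.exitGame es hes).Negative {i | i ≠ goal} (entry v) ↔ G.Negative Set.univ v := by
  constructor
  · contrapose
    intro h
    obtain ⟨x, hx, hv⟩ := (not_negative_iff (Set.mem_univ v)).1 h
    refine (not_negative_iff (entry_ne_goal v)).2 ⟨splitVertex x x ⊤, ⟨fun i hi => ?_,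
      fun i hi => ?_, fun i hi => ?_⟩, by simpa using hv⟩
    · rw [le_best_iff]
      rcases vertex_cases i with ⟨v, rfl⟩ | ⟨v, rfl⟩ | rfl
      · refine ⟨fun hm => absurd hm (entry_notMem_exitGame_maxV v), fun _ i hi => ?_⟩
        rcases exitGame_edge_entry.1 hi with rfl | rfl
        · simp [Zbar.ofInt_zero]
        · simp [Zbar.ofInt_zero]
      · have h := G.le_best_iff.1 (hx.isPotential v trivial)
        refine ⟨fun hm => ?_, fun hm i hi => ?_⟩
        · obtain ⟨u, hu, h'⟩ := h.1 (inner_mem_exitGame_maxV.1 hm)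
          exact ⟨entry u, exitGame_edge_inner.2 ⟨u, rfl, hu⟩, by simpa using h'⟩
        · obtain ⟨u, rfl, hu⟩ := exitGame_edge_inner.1 hi
          simpa using h.2 (fun h => hm (inner_mem_exitGame_maxV.2 h)) u hu
      · exact absurd rfl hi
    · obtain rfl : i = goal := by simpa using hi
      simp
    · rcases vertex_cases i with ⟨v, rfl⟩ | ⟨v, rfl⟩ | rfl
      · simpa using hx.ne_top v trivial
      · simpa using hx.ne_top v trivial
      · exact absurd rfl hi
  · -- One move of the mean-payoff game corresponds to two moves, which is why the potential and the
    -- scaling factor `N` are doubled; the potential loses `1` in each of the two moves.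
    rintro ⟨N, p, hp, hv⟩
    have hdouble : ∀ {w : ℤ} {a b : Zbar}, a ≤ ofInt (-(N * w + 1)) + b →
        ofInt 1 + (a + a) ≤ ofInt (-((2 * N : ℕ) * w + 1)) + (b + b) := by
      intro w a b h
      rcases Zbar.cases' a with rfl | rfl | ⟨j, rfl⟩
      · exact bot_le
      · rcases Zbar.cases' b with rfl | rfl | ⟨k, rfl⟩
        · exact absurd (le_bot_iff.1 h) Zbar.top_ne_bot
        · exact le_top
        · exact absurd (top_le_iff.1 h) (Zbar.ofInt_ne_top _)
      · rcases Zbar.cases' b with rfl | rfl | ⟨k, rfl⟩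
        · exact absurd (le_bot_iff.1 h) (Zbar.ofInt_ne_bot _)
        · exact le_top
        · simp only [Zbar.ofInt_add, Zbar.ofInt_le] at h ⊢
          push_cast
          linarith
    have htop : ∀ v, p v + p v ≠ ⊤ := by
      intro v
      have h := hp.ne_top v trivial
      rcases Zbar.cases' (p v) with h' | h' | ⟨k, h'⟩ <;> rw [h'] at h ⊢
      · exact Zbar.top_ne_bot.symm
      · exact absurd rfl h
      · exact Zbar.ofInt_ne_top _
    refine ⟨2 * N, splitVertex (fun v => p v + p v) (fun v => ofInt 1 + (p v + p v)) ⊥,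
      ⟨fun i hi => ?_, fun i hi => ?_, fun i hi => ?_⟩, ?_⟩
    · rw [le_best_iff]
      rcases vertex_cases i with ⟨v, rfl⟩ | ⟨v, rfl⟩ | rfl
      · refine ⟨fun _ => ⟨inner v, exitGame_edge_entry (hes := hes).2 (Or.inl rfl), ?_⟩,
          fun hm => ?_⟩
        · rw [splitVertex_entry, splitVertex_inner]
          change _ ≤ ofInt (-((2 * N : ℕ) * (G.exitGame es hes).weight (entry v) (inner v) + 1)) + _
          rw [exitGame_weight_entry, Zbar.ofInt_add_add]
          simp [Zbar.ofInt_zero]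
        · exact absurd (mem_dual_maxV.2 (entry_notMem_exitGame_maxV v)) hm
      · have h := (G.dual N).le_best_iff.1 (hp.isPotential v trivial)
        have hw : ∀ u, ((G.exitGame es hes).dual (2 * N)).weight (inner v) (entry u) =
            -((2 * N : ℕ) * G.weight v u + 1) := by
          intro u
          rw [← exitGame_weight_inner (hes := hes)]
          rfl
        refine ⟨fun hm => ?_, fun hm i hi => ?_⟩
        · obtain ⟨u, hu, h'⟩ := h.1 (mem_dual_maxV.2 fun h =>
            mem_dual_maxV.1 hm (inner_mem_exitGame_maxV.2 h))
          refine ⟨entry u, exitGame_edge_inner (hes := hes).2 ⟨u, rfl, hu⟩, ?_⟩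
          rw [splitVertex_entry, splitVertex_inner, hw]
          exact hdouble h'
        · obtain ⟨u, rfl, hu⟩ := exitGame_edge_inner (hes := hes).1 hi
          rw [splitVertex_entry, splitVertex_inner, hw]
          refine hdouble (h.2 (fun h => hm (mem_dual_maxV.2 fun h' => ?_)) u hu)
          exact mem_dual_maxV.1 h (inner_mem_exitGame_maxV.1 h')
      · exact absurd rfl hi
    · obtain rfl : i = goal := by simpa using hi
      simp
    · rcases vertex_cases i with ⟨v, rfl⟩ | ⟨v, rfl⟩ | rfl
      · rw [splitVertex_entry]
        exact htop v
      · rw [splitVertex_inner]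
        exact (Zbar.ofInt_add_lt_top_iff.2 (lt_top_iff_ne_top.2 (htop v))).ne
      · exact absurd rfl hi
    · rw [splitVertex_entry]
      have h := hp.ne_top v trivial
      rcases Zbar.cases' (p v) with h' | h' | ⟨k, h'⟩ <;> rw [h'] at h hv ⊢
      · exact absurd rfl hv
      · exact absurd rfl h
      · exact Zbar.ofInt_ne_bot _

end WeightedGraph

namespace RAM

open WeightedGraph

/-- The instance to which a mean-payoff game is reduced. -/
noncomputable def exitInstance (a : MPInstance) : MCRInstance :=
  ⟨{ n := a.1.n + a.1.n + 1
     game := a.1.graph.exitGame a.1.edgeList a.1.mem_edgeList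
     edgeList := exitEdges a.1.edgeList
     nodup := nodup_exitEdges a.1.nodup
     mem_edgeList := fun _ => List.mem_toFinset.symm }, entry a.2⟩

theorem exitInstance_mem_iff (a : MPInstance) :
    a ∈ MeanPayoffNeg ↔ exitInstance a ∈ ValueNegInf := by
  change a.1.graph.upperValue a.1.graph.meanPayoff a.2 < 0 ↔
    (a.1.graph.exitGame a.1.edgeList a.1.mem_edgeList).value (entry a.2) = ⊥
  rw [upperValue_meanPayoff_lt_zero_iff, MCRGame.value_eq_bot_iff,
    exitGame_activeSet (Fin.pos a.2), negative_exitGame_iff]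

theorem ofFn_eq_flatMap {n : ℕ} (f : Fin n → ℤ) :
    List.ofFn f = (List.finRange n).flatMap fun v => [f v] := by
  rw [List.ofFn_eq_map, List.map_eq_flatMap]

theorem ofFn_split {n : ℕ} (f : Fin (n + n + 1) → ℤ) : List.ofFn f =
    ((List.finRange n).flatMap fun v => [f (entry v)]) ++
      (((List.finRange n).flatMap fun v => [f (inner v)]) ++ [f goal]) := by
  rw [List.ofFn_add, List.ofFn_add, ofFn_eq_flatMap, ofFn_eq_flatMap, List.append_assoc]
  rfl

/-- Reads a mean-payoff game and a vertex. -/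
def readMPInstance : Cmd := .seq (setVar 11 (.read 0 (.const 0))) (parseMP 1)

theorem readMPInstance_runs (a : MPInstance) :
    Runs readMPInstance (startState a.code []) (200 * (a.1.n + a.1.edgeList.length + 1) + 10)
      fun s => HoldsGame a.1.graph.toGame a.1.edgeList s ∧ s 11 0 = ((a.2 : ℕ) : ℤ) := by
  refine Runs.seq (t₁ := 5) (t₂ := 200 * (a.1.n + a.1.edgeList.length + 1))
    (P := fun s => s 11 0 = ((a.2 : ℕ) : ℤ)) (Runs.straight rfl (by decide) ?_) ?_ (by omega)
  · simp [Cmd.run, Expr.eval, startState, MPInstance.code, listArray]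
  intro s h11 hs
  have hw : 11 ∉ (parseMP 1).writes := by decide
  refine (parseMP_runs (o := 1) (W := a.1.graph) (es := a.1.edgeList) (pre := [((a.2 : ℕ) : ℤ)]) rfl
    ?_ fun i => ?_).frame.mono le_rfl ?_
  · rw [hs 0 (by decide)]; rfl
  · rw [hs 5 (by decide)]; rfl
  · rintro s' ⟨h1, h2⟩
    exact ⟨h1, by rw [h2 11 hw, h11]⟩

/-- Writes a list of `n` zeros. -/
def pushZeros : Cmd := forLoop 18 9 (push 0 1 (.const 0))

/-- Writes the instance to which a mean-payoff game is reduced. -/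
def emitExit : Cmd :=
  .seq (push 0 1 (var 11)) (.seq (push 0 1 (.plus (.plus (var 9) (var 9)) (.const 1)))
    (.seq pushZeros (.seq (forLoop 18 9 (push 0 1 (.read 4 idx))) (.seq (push 0 1 (.const 0))
    (.seq pushZeros (.seq pushZeros (.seq (push 0 1 (.const 1))
    (.seq (push 0 1 (.plus (var 10) (.plus (.plus (var 9) (var 9)) (.const 1))))
    (.seq (forLoop 18 9 (pushTriple idx (.plus (var 9) idx) (.const 0)))
    (.seq (forLoop 18 9 (pushTriple idx (.plus (var 9) (var 9)) (.const 0)))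
    (.seq (forLoop 18 10 (pushTriple (.plus (var 9) (.read 6 idx)) (.read 7 idx) (.read 8 idx)))
      (pushTriple (.plus (var 9) (var 9)) (.plus (var 9) (var 9)) (.const 0)))))))))))))

variable {n : ℕ}

theorem emits_vertexLoop {s₀ : State} (h9 : s₀ 9 0 = n) (f : Fin n → List ℤ) {c : Cmd} {t : ℕ}
    (hc : ∀ a ∈ c.writes, a = 0 ∨ a = 1)
    (h : ∀ v : Fin n, Emits (fun s => Agree s₀ s ∧ s 18 0 = ((v : ℕ) : ℤ)) c t (f v)) :
    Emits (Agree s₀) (forLoop 18 9 c) (n * (t + 14) + 11) ((List.finRange n).flatMap f) := by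
  have := Emits.forLoop (I := Agree s₀) (c := c) (t := t) (List.finRange n) f (i := 18) (b := 9)
    (stable_agree (by decide) s₀) (by decide) (by decide) (by decide)
    (fun h => by have := hc _ h; omega) (fun h => by have := hc _ h; omega)
    (fun s hs => by rw [hs 9 (by decide), h9, List.length_finRange])
    (fun k hk => by
      have := h (List.finRange n)[k]
      simpa using this)
  rwa [List.length_finRange] at this

theorem emits_edgeLoop {s₀ : State} {es : List (Fin n × Fin n)} (h10 : s₀ 10 0 = es.length)
    (f : Fin n × Fin n → List ℤ) {c : Cmd} {t : ℕ} (hc : ∀ a ∈ c.writes, a = 0 ∨ a = 1)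
    (h : ∀ (k : ℕ) (hk : k < es.length),
      Emits (fun s => Agree s₀ s ∧ s 18 0 = (k : ℤ)) c t (f es[k])) :
    Emits (Agree s₀) (forLoop 18 10 c) (es.length * (t + 14) + 11) (es.flatMap f) :=
  Emits.forLoop es f (stable_agree (by decide) s₀) (by decide) (by decide) (by decide)
    (fun h => by have := hc _ h; omega) (fun h => by have := hc _ h; omega)
    (fun s hs => by rw [hs 10 (by decide), h10]) h

theorem stable_agreeAt (s₀ : State) (k : ℤ) : Stable [0, 1] fun s => Agree s₀ s ∧ s 18 0 = k :=
  (stable_agree (by decide) s₀).and_var (by decide) k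

theorem stable_agree_output (s₀ : State) : Stable [0, 1] (Agree s₀) := stable_agree (by decide) s₀

theorem pushZeros_emits {s₀ : State} (h9 : s₀ 9 0 = n) :
    Emits (Agree s₀) pushZeros (n * 34 + 11) ((List.finRange n).flatMap fun _ => [0]) :=
  emits_vertexLoop (t := 20) h9 _ (by decide) fun _ =>
    (Emits.push (stable_agreeAt _ _) fun _ _ => rfl).mono (by decide)

theorem setCode_exitGame_maxV {G : WeightedGraph (Fin n)} {es : List (Fin n × Fin n)}
    {hes : ∀ e, e ∈ es ↔ e ∈ G.edges} : setCode (G.exitGame es hes).maxV =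
      ((List.finRange n).flatMap fun _ => [0]) ++
        (((List.finRange n).flatMap fun v => [if v ∈ G.maxV then 1 else 0]) ++ [0]) := by
  rw [setCode, ofFn_split]
  simp [exitGame]

theorem setCode_exitGame_target {G : WeightedGraph (Fin n)} {es : List (Fin n × Fin n)}
    {hes : ∀ e, e ∈ es ↔ e ∈ G.edges} : setCode (G.exitGame es hes).target =
      ((List.finRange n).flatMap fun _ => [0]) ++
        (((List.finRange n).flatMap fun _ => [0]) ++ [1]) := by
  rw [setCode, ofFn_split]
  simp [exitGame]

theorem edgesCode_exitGame {G : WeightedGraph (Fin n)} {es : List (Fin n × Fin n)}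
    {hes : ∀ e, e ∈ es ↔ e ∈ G.edges} :
    edgesCode (G.exitGame es hes).toWeightedGraph (exitEdges es) =
      [(es.length : ℤ) + (n + n + 1)] ++
      (((List.finRange n).flatMap fun v : Fin n => [((v : ℕ) : ℤ), (n : ℤ) + (v : ℕ), 0]) ++
      (((List.finRange n).flatMap fun v : Fin n => [((v : ℕ) : ℤ), (n : ℤ) + n, 0]) ++
      ((es.flatMap fun e => [(n : ℤ) + (e.1 : ℕ), ((e.2 : ℕ) : ℤ), G.weight e.1 e.2]) ++
      [(n : ℤ) + n, (n : ℤ) + n, 0]))) := by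
  have hlen : ((exitEdges es).length : ℤ) = es.length + (n + n + 1) := by
    simp [exitEdges]
    ring
  have hwt : (G.exitGame es hes).weight goal goal = 0 := by simp [exitGame]
  rw [edgesCode, hlen, List.singleton_append]
  simp only [exitEdges, List.flatMap_append, List.flatMap_map, List.flatMap_singleton, hwt,
    exitGame_weight_entry, exitGame_weight_inner, val_entry, val_inner, val_goal, Nat.cast_add]

theorem exitInstance_code (a : MPInstance) : (exitInstance a).code =
      [((a.2 : ℕ) : ℤ)] ++ ([(a.1.n : ℤ) + a.1.n + 1] ++
      (((List.finRange a.1.n).flatMap fun _ => [0]) ++ (((List.finRange a.1.n).flatMap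
        fun v => [if v ∈ a.1.graph.maxV then 1 else 0]) ++ ([0] ++
      (((List.finRange a.1.n).flatMap fun _ => [0]) ++
      (((List.finRange a.1.n).flatMap fun _ => [0]) ++ ([1] ++
      ([(a.1.edgeList.length : ℤ) + (a.1.n + a.1.n + 1)] ++
      (((List.finRange a.1.n).flatMap fun v : Fin a.1.n =>
        [((v : ℕ) : ℤ), (a.1.n : ℤ) + (v : ℕ), 0]) ++
      (((List.finRange a.1.n).flatMap fun v : Fin a.1.n =>
        [((v : ℕ) : ℤ), (a.1.n : ℤ) + a.1.n, 0]) ++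
      ((a.1.edgeList.flatMap fun e => [(a.1.n : ℤ) + (e.1 : ℕ), ((e.2 : ℕ) : ℤ),
        a.1.graph.weight e.1 e.2]) ++
      [(a.1.n : ℤ) + a.1.n, (a.1.n : ℤ) + a.1.n, 0]))))))))))) := by
  have h : (exitInstance a).code = ((a.2 : ℕ) : ℤ) :: ((a.1.n + a.1.n + 1 : ℕ) : ℤ) ::
    (setCode (a.1.graph.exitGame a.1.edgeList a.1.mem_edgeList).maxV ++
      setCode (a.1.graph.exitGame a.1.edgeList a.1.mem_edgeList).target ++
      edgesCode (a.1.graph.exitGame a.1.edgeList a.1.mem_edgeList).toWeightedGraph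
        (exitEdges a.1.edgeList)) := rfl
  rw [h, setCode_exitGame_maxV, setCode_exitGame_target, edgesCode_exitGame]
  simp only [List.append_assoc, List.cons_append, List.nil_append,
    Nat.cast_add, Nat.cast_one]

theorem emitExit_emits (a : MPInstance) {s₀ : State}
    (hG : HoldsGame a.1.graph.toGame a.1.edgeList s₀) (h11 : s₀ 11 0 = ((a.2 : ℕ) : ℤ)) :
    Emits (Agree s₀) emitExit (700 * (a.1.n + a.1.edgeList.length + 1))
      (exitInstance a).code := by
  have e9 : ∀ s, Agree s₀ s → s 9 0 = a.1.n := fun s hs => by rw [hs 9 (by decide), hG.card]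
  have e10 : ∀ s, Agree s₀ s → s 10 0 = a.1.edgeList.length := fun s hs => by
    rw [hs 10 (by decide), hG.size]
  have h1 : Emits (Agree s₀) (push 0 1 (var 11)) 20 [((a.2 : ℕ) : ℤ)] :=
    (Emits.push (stable_agree_output _) fun s hs => by
      simp only [Expr.eval, hs 11 (by decide), h11]).mono (by decide)
  have h2 : Emits (Agree s₀) (push 0 1 (.plus (.plus (var 9) (var 9)) (.const 1))) 20
      [(a.1.n : ℤ) + a.1.n + 1] :=
    (Emits.push (stable_agree_output _) fun s hs => by
      simp only [Expr.eval, e9 s hs]).mono (by decide)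
  have h3 := pushZeros_emits hG.card
  have h4 : Emits (Agree s₀) (forLoop 18 9 (push 0 1 (.read 4 idx))) (a.1.n * 34 + 11)
      ((List.finRange a.1.n).flatMap fun v => [if v ∈ a.1.graph.maxV then 1 else 0]) :=
    emits_vertexLoop (t := 20) hG.card _ (by decide) fun v =>
      (Emits.push (stable_agreeAt _ _) fun s hs => by
        simp only [Expr.eval, hs.2, hs.1 4 (by decide)]; exact hG.own v).mono (by decide)
  have h5 : Emits (Agree s₀) (push 0 1 (.const 0)) 20 [0] :=
    (Emits.push (stable_agree_output _) fun s hs => rfl).mono (by decide)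
  have h8 : Emits (Agree s₀) (push 0 1 (.const 1)) 20 [1] :=
    (Emits.push (stable_agree_output _) fun s hs => rfl).mono (by decide)
  have h9 : Emits (Agree s₀) (push 0 1 (.plus (var 10) (.plus (.plus (var 9) (var 9)) (.const 1))))
      30 [(a.1.edgeList.length : ℤ) + (a.1.n + a.1.n + 1)] :=
    (Emits.push (stable_agree_output _) fun s hs => by
      simp only [Expr.eval, e9 s hs, e10 s hs]).mono (by decide)
  have h10 : Emits (Agree s₀) (forLoop 18 9 (pushTriple idx (.plus (var 9) idx) (.const 0)))
      (a.1.n * 64 + 11)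
      ((List.finRange a.1.n).flatMap fun v : Fin a.1.n =>
        [((v : ℕ) : ℤ), (a.1.n : ℤ) + (v : ℕ), 0]) := by
    refine emits_vertexLoop (t := 50) hG.card _ (by decide) fun v => ?_
    exact (Emits.push_triple (stable_agreeAt _ _) (fun s hs => by simp only [Expr.eval, hs.2])
        (fun s hs => by simp only [Expr.eval, hs.2, e9 s hs.1]) fun _ _ => rfl).mono (by decide)
  have h11' : Emits (Agree s₀) (forLoop 18 9 (pushTriple idx (.plus (var 9) (var 9)) (.const 0)))
      (a.1.n * 64 + 11)
      ((List.finRange a.1.n).flatMap fun v : Fin a.1.n =>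
        [((v : ℕ) : ℤ), (a.1.n : ℤ) + a.1.n, 0]) := by
    refine emits_vertexLoop (t := 50) hG.card _ (by decide) fun v => ?_
    exact (Emits.push_triple (stable_agreeAt _ _) (fun s hs => by simp only [Expr.eval, hs.2])
        (fun s hs => by simp only [Expr.eval, e9 s hs.1]) fun _ _ => rfl).mono (by decide)
  have h12 : Emits (Agree s₀) (forLoop 18 10 (pushTriple (.plus (var 9) (.read 6 idx))
      (.read 7 idx) (.read 8 idx))) (a.1.edgeList.length * 74 + 11)
      (a.1.edgeList.flatMap fun e => [(a.1.n : ℤ) + (e.1 : ℕ), ((e.2 : ℕ) : ℤ),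
        a.1.graph.weight e.1 e.2]) := by
    refine emits_edgeLoop (t := 60) hG.size _ (by decide) fun k hk => ?_
    exact (Emits.push_triple (stable_agreeAt _ _)
        (fun s hs => by
          simp only [Expr.eval, e9 s hs.1, hs.2, hs.1 6 (by decide), hG.src k hk])
        (fun s hs => by simp only [Expr.eval, hs.2, hs.1 7 (by decide), hG.dst k hk])
        (fun s hs => by
          simp only [Expr.eval, hs.2, hs.1 8 (by decide), hG.wt k hk]; rfl)).mono (by decide)
  have h13 : Emits (Agree s₀)
      (pushTriple (.plus (var 9) (var 9)) (.plus (var 9) (var 9)) (.const 0)) 50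
      [(a.1.n : ℤ) + a.1.n, (a.1.n : ℤ) + a.1.n, 0] :=
    (Emits.push_triple (stable_agree_output _) (fun s hs => by simp only [Expr.eval, e9 s hs])
      (fun s hs => by simp only [Expr.eval, e9 s hs]) fun _ _ => rfl).mono (by decide)
  have hall := h1.seq (h2.seq (h3.seq (h4.seq (h5.seq (h3.seq (h3.seq (h8.seq (h9.seq (h10.seq
    (h11'.seq (h12.seq h13)))))))))))
  rw [exitInstance_code]
  exact hall.mono (by omega)

theorem reducible_meanPayoffNeg :
    PolyReducible MPInstance.code MCRInstance.code MeanPayoffNeg ValueNegInf := by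
  refine ⟨exitInstance, exitInstance_mem_iff,
    .seq readMPInstance (.seq (setVar 1 (.const 0)) emitExit), 1000 * Polynomial.X, fun a => ?_⟩
  have hlen := length_le_bitSize a.code
  have hcode : a.code.length = 3 + a.1.n + 3 * a.1.edgeList.length := by
    simp [MPInstance.code, GraphInput.code, length_setCode, length_edgesCode]
    ring
  refine Runs.outputsWithin (t := 1000 * bitSize a.code) (Runs.seq
    (t₂ := 700 * (a.1.n + a.1.edgeList.length + 1) + 4) (readMPInstance_runs a) ?_ (by omega))
    (by simp)
  rintro s ⟨hG, h11⟩ -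
  exact (emitExit_emits a hG h11).outputs

end RAM

/-! ### From values `-∞` to mean-payoff games -/

namespace MCRGame

variable {n : ℕ} (G : MCRGame (Fin n))

/-- The edges that leave active vertices, and loops at the other vertices. -/
noncomputable def activeEdges (es : List (Fin n × Fin n)) : List (Fin n × Fin n) :=
  (es.filter fun e => e.1 ∈ G.activeSet) ++
    ((List.finRange n).filter fun v => v ∉ G.activeSet).map fun v => (v, v)

variable {G} {es : List (Fin n × Fin n)}

theorem mem_activeEdges {v u : Fin n} : (v, u) ∈ G.activeEdges es ↔
    v ∈ G.activeSet ∧ (v, u) ∈ es ∨ v ∉ G.activeSet ∧ u = v := by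
  simp only [activeEdges, List.mem_append, List.mem_filter, List.mem_map, List.mem_finRange,
    true_and, Prod.mk.injEq, decide_eq_true_eq]
  refine or_congr and_comm ⟨?_, ?_⟩
  · rintro ⟨w, hw, rfl, rfl⟩
    exact ⟨hw, rfl⟩
  · rintro ⟨hv, rfl⟩
    exact ⟨_, hv, rfl, rfl⟩

theorem nodup_activeEdges (h : es.Nodup) : (G.activeEdges es).Nodup := by
  refine List.nodup_append.2 ⟨h.filter _, ((List.nodup_finRange n).filter _).map fun u v h =>
    (Prod.ext_iff.1 h).1, ?_⟩
  rintro e he _ hf rfl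
  simp only [List.mem_map, List.mem_filter, decide_eq_true_eq] at he hf
  obtain ⟨v, hv, rfl⟩ := hf
  exact hv.2 he.2

/-- The mean-payoff game that is played on the active vertices. Leaving them ends in a loop of
weight `0`, so that Min gets a negative mean payoff only from plays that stay among the active
vertices, from which the target can still be reached. -/
noncomputable def activeGraph (G : MCRGame (Fin n)) (es : List (Fin n × Fin n))
    (hes : ∀ e, e ∈ es ↔ e ∈ G.edges) : WeightedGraph (Fin n) where
  maxV := G.maxV
  edges := (G.activeEdges es).toFinset
  weight v u := if v ∈ G.activeSet then G.weight v u else 0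
  deadlockFree v := by
    simp only [List.mem_toFinset, mem_activeEdges]
    by_cases hv : v ∈ G.activeSet
    · obtain ⟨u, hu⟩ := G.deadlockFree v
      exact ⟨u, Or.inl ⟨hv, (hes _).2 hu⟩⟩
    · exact ⟨v, Or.inr ⟨hv, rfl⟩⟩

variable {hes : ∀ e, e ∈ es ↔ e ∈ G.edges}

theorem edge_activeGraph {v u : Fin n} (hv : v ∈ G.activeSet) :
    (v, u) ∈ (G.activeGraph es hes).edges ↔ (v, u) ∈ G.edges := by
  rw [← hes]
  simp [activeGraph, mem_activeEdges, hv]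

theorem edge_activeGraph_of_notMem {v u : Fin n} (hv : v ∉ G.activeSet) :
    (v, u) ∈ (G.activeGraph es hes).edges ↔ u = v := by
  simp [activeGraph, mem_activeEdges, hv]

theorem negative_activeGraph_iff {v : Fin n} :
    (G.activeGraph es hes).Negative Set.univ v ↔ G.value v = ⊥ := by
  constructor
  · contrapose
    rw [value_eq_limitVec]
    intro hv
    -- The vector of values is a potential, when `+∞` is replaced by a large integer.
    refine (WeightedGraph.not_negative_iff (Set.mem_univ v)).2
      ⟨fun u => if G.limitVec u = ⊤ then ofInt ((n + 1) * G.maxWeight) else G.limitVec u,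
        ⟨fun u _ => ?_, fun u hu => absurd trivial hu, fun u _ => ?_⟩, ?_⟩
    · rw [WeightedGraph.le_best_iff]
      by_cases hu : u ∈ G.activeSet
      · have htop : G.limitVec u ≠ ⊤ := G.limitVec_ne_top_iff.2 hu.1
        have hw : ∀ w, (G.activeGraph es hes).weight u w = G.weight u w := fun w => if_pos hu
        have h : G.limitVec u ≤ G.best G.limitVec u := by
          rw [← G.op_not_target hu.2]; exact G.limitVec_le_op u
        obtain ⟨h1, h2⟩ := G.le_best_iff.1 h
        simp only [edge_activeGraph hu, hw, if_neg htop]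
        refine ⟨fun hm => ?_, fun hm w hwe => ?_⟩
        · -- A move of Max that leads to the value `+∞` would give `u` this value.
          have hne : ∀ w, (u, w) ∈ G.edges → G.limitVec w ≠ ⊤ := by
            intro w hwe hw
            have h3 := G.le_best_of_max (x := G.limitVec) hm hwe
            rw [hw, Zbar.ofInt_add_top, ← G.op_not_target hu.2, G.op_limitVec] at h3
            exact htop (top_le_iff.1 h3)
          obtain ⟨w, hwe, h'⟩ := h1 hm
          exact ⟨w, hwe, by rwa [if_neg (hne w hwe)]⟩
        · split_ifs with hw'
          · have h3 := (G.limitVec_le_iter _ u).trans (G.iter_le_of_mem_attr hu.1)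
            refine h3.trans ?_
            rw [Zbar.ofInt_add, Zbar.ofInt_le, Fintype.card_fin]
            have := G.neg_le_weight hwe
            linarith
          · exact h2 hm w hwe
      · have hw : ∀ w, (G.activeGraph es hes).weight u w = 0 := fun w => if_neg hu
        simp only [edge_activeGraph_of_notMem hu, hw, Zbar.ofInt_zero, zero_add]
        exact ⟨fun _ => ⟨u, rfl, le_rfl⟩, fun _ w hw => by rw [hw]⟩
    · split_ifs with h
      · exact Zbar.ofInt_ne_top _
      · exact h
    · dsimp only
      split_ifs with h
      · exact Zbar.ofInt_ne_bot _
      · exact hv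
  · rw [value_eq_bot_iff]
    rintro ⟨N, p, hp, hv⟩
    refine ⟨N, p, ⟨fun u _ => ?_, fun u hu => absurd trivial hu, fun u _ => hp.ne_top_of_bot u⟩, hv⟩
    by_cases hu : u ∈ G.activeSet
    · have h := (G.toWeightedGraph.dual N).le_best_iff.1 (hp.isPotential u hu)
      have hw : ∀ w, ((G.activeGraph es hes).dual N).weight u w =
          (G.toWeightedGraph.dual N).weight u w := fun w => by
        change -((N : ℤ) * (if _ then _ else _) + 1) = _
        rw [if_pos hu]
        rfl
      have hm : u ∈ ((G.activeGraph es hes).dual N).maxV ↔ u ∈ (G.toWeightedGraph.dual N).maxV := by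
        rw [WeightedGraph.mem_dual_maxV, WeightedGraph.mem_dual_maxV]
        exact Iff.rfl
      have he : ∀ w, (u, w) ∈ ((G.activeGraph es hes).dual N).edges ↔
          (u, w) ∈ (G.toWeightedGraph.dual N).edges := fun w => edge_activeGraph (hes := hes) hu
      rw [WeightedGraph.le_best_iff]
      simpa only [hw, hm, he] using h
    · rw [hp.eq_const u hu]
      exact bot_le

end MCRGame

namespace RAM

/-- The instance to which a min-cost reachability game is reduced. -/
noncomputable def activeInstance (a : MCRInstance) : MPInstance :=
  ⟨{ n := a.1.n
     graph := a.1.game.activeGraph a.1.edgeList a.1.mem_edgeList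
     edgeList := a.1.game.activeEdges a.1.edgeList
     nodup := MCRGame.nodup_activeEdges a.1.nodup
     mem_edgeList := fun _ => List.mem_toFinset.symm }, a.2⟩

theorem activeInstance_mem_iff (a : MCRInstance) :
    a ∈ ValueNegInf ↔ activeInstance a ∈ MeanPayoffNeg := by
  change a.1.game.value a.2 = ⊥ ↔
    (a.1.game.activeGraph a.1.edgeList a.1.mem_edgeList).upperValue
      (a.1.game.activeGraph a.1.edgeList a.1.mem_edgeList).meanPayoff a.2 < 0
  rw [WeightedGraph.upperValue_meanPayoff_lt_zero_iff, MCRGame.negative_activeGraph_iff]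

variable {n : ℕ} {G : MCRGame (Fin n)} {es : List (Fin n × Fin n)} {s : State}

/-- Marks the active vertices. -/
def markActive : Cmd :=
  forLoop 18 9 (.ifLe (.read 12 idx) (.const 0)
    (.ifLe (.read 5 idx) (.const 0) (.store 30 idx (.const 1)) (.store 30 idx (.const 0)))
    (.store 30 idx (.const 0)))

theorem markActive_runs (hG : HoldsGame G es s)
    (hattr : ∀ v : Fin n, 1 ≤ s 12 ((v : ℕ) : ℤ) ↔ v ∉ G.attr n) :
    Runs markActive s (n * 44 + 11) fun s' =>
      ∀ u : Fin n, s' 30 ((u : ℕ) : ℤ) = if u ∈ G.activeSet then 1 else 0 := by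
  refine Runs.localLoop (t := 30) [30] (fun _ k => if h : k < n then (if ⟨k, h⟩ ∈ G.activeSet then 1
    else 0) else 0) rfl (by decide) (by decide) (by decide) (by decide) (by decide) hG.card ?_ ?_
    le_rfl
  · intro k hk s' hs hki _ a ha j
    have h5 : s' 5 (k : ℤ) = if ⟨k, hk⟩ ∈ G.target then 1 else 0 := by
      rw [hs 5 (by decide) (by decide)]; exact hG.tgt ⟨k, hk⟩
    have h12 : s' 12 (k : ℤ) ≤ 0 ↔ ⟨k, hk⟩ ∈ G.attr n := by
      rw [hs 12 (by decide) (by decide), ← not_iff_not, ← hattr, not_le]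
      exact Iff.rfl
    have hact : (⟨k, hk⟩ : Fin n) ∈ G.activeSet ↔ ⟨k, hk⟩ ∈ G.attr n ∧ ⟨k, hk⟩ ∉ G.target := by
      rw [MCRGame.activeSet, Fintype.card_fin]; exact Iff.rfl
    obtain rfl := List.mem_singleton.1 ha
    by_cases c1 : (⟨k, hk⟩ : Fin n) ∈ G.attr n <;> by_cases c2 : (⟨k, hk⟩ : Fin n) ∈ G.target <;>
      simp [Cmd.run, Expr.eval, hki, h5, h12, c1, c2, hact, hk]
  · intro s' _ h u
    simpa using h 30 (by decide) u u.2

/-- A loop that counts the elements of a list with a property, in the variable `32`. -/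
theorem countLoop_runs {α : Type*} (l : List α) (P : α → Prop) [DecidablePred P] {b : ℕ}
    {e₁ e₂ : Expr} {s : State} {z : ℤ} (hb : b ∉ [18, 32]) (hN : s b 0 = l.length)
    (h32 : s 32 0 = z)
    (hcost : e₁.cost + e₂.cost ≤ 20)
    (h : ∀ (k : ℕ) (hk : k < l.length) (s' : State), (∀ a ∉ [18, 32], s' a = s a) → s' 18 0 = k →
      (e₁.eval s' ≤ e₂.eval s' ↔ P l[k])) :
    Runs (forLoop 18 b (.ifLe e₁ e₂ (setVar 32 (.plus (var 32) (.const 1))) .skip)) s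
      (l.length * 44 + 11) fun s' => s' 32 0 = z + (l.filter P).length := by
  simp only [List.mem_cons, List.not_mem_nil, or_false, not_or] at hb
  refine Runs.forLoop (t := 30) (fun k s' => s' 32 0 = z + ((l.take k).filter P).length)
    (Ne.symm hb.1) (by simp [Cmd.writes]) (by simp [Cmd.writes, hb.2]) hN (by simp [h32]) ?_
    (fun s' _ h => by rwa [List.take_length] at h) le_rfl
  intro k hk s' hs hki hInv
  refine Runs.straight rfl ?_ ?_
  · simp only [Cmd.cost, Expr.cost]; omega
  have hP := h k hk s' (fun a ha => hs a (by simpa [Cmd.writes] using fun h => ha (by simp [h]))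
    fun h => ha (by simp [h])) hki
  rw [List.take_add_one, List.getElem?_eq_getElem hk, Option.toList_some, List.filter_append]
  by_cases hp : P l[k]
  · have := hP.2 hp
    simp [Cmd.run, this, hp, Expr.eval, hInv, add_assoc]
  · have hle : ¬ e₁.eval s' ≤ e₂.eval s' := fun h => hp (hP.1 h)
    rw [Cmd.run, if_neg hle]
    simp [Cmd.run, hp, hInv]

/-- Counts the edges of the mean-payoff game. -/
def countEdges : Cmd :=
  .seq (forLoop 18 10 (.ifLe (.const 1) (.read 30 (.read 6 idx))
      (setVar 32 (.plus (var 32) (.const 1))) .skip))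
    (forLoop 18 9 (.ifLe (.read 30 idx) (.const 0)
      (setVar 32 (.plus (var 32) (.const 1))) .skip))

theorem countEdges_runs (hG : HoldsGame G es s) (h32 : s 32 0 = 0)
    (h30 : ∀ u : Fin n, s 30 ((u : ℕ) : ℤ) = if u ∈ G.activeSet then 1 else 0) :
    Runs countEdges s (44 * (n + es.length + 1)) fun s' =>
      s' 32 0 = (G.activeEdges es).length := by
  refine Runs.seq (t₂ := n * 44 + 11) (countLoop_runs es (fun e => e.1 ∈ G.activeSet) (by decide)
    hG.size h32 (by decide) ?_) ?_ (by omega)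
  · intro k hk s' hs hki
    simp only [Expr.eval, hs 30 (by decide), hs 6 (by decide), hki, hG.src k hk, h30]
    split_ifs with h <;> simp [h]
  intro s₁ h32₁ hs₁
  have := countLoop_runs (b := 9) (e₁ := .read 30 idx) (e₂ := .const 0) (List.finRange n)
    (fun v => v ∉ G.activeSet) (s := s₁) (by decide)
    (by rw [hs₁ 9 (by decide), hG.card, List.length_finRange]) h32₁ (by decide) (by
      intro k hk s' hs hki
      have hk' : k < n := by simpa using hk
      have h := h30 ⟨k, hk'⟩
      simp only [Expr.eval, hs 30 (by decide), hs₁ 30 (by decide), hki, h, List.getElem_finRange,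
        Fin.cast_mk]
      split_ifs with h <;> simp [h])
  rw [List.length_finRange] at this
  refine this.mono le_rfl fun s' h => ?_
  rw [h, MCRGame.activeEdges, List.length_append, List.length_map]
  push_cast
  ring

/-- Writes the instance to which a min-cost reachability game is reduced. -/
def emitActive : Cmd :=
  .seq (push 0 1 (var 11)) (.seq (push 0 1 (var 9)) (.seq (forLoop 18 9 (push 0 1 (.read 4 idx)))
    (.seq (push 0 1 (var 32))
    (.seq (forLoop 18 10 (.ifLe (.const 1) (.read 30 (.read 6 idx))
      (pushTriple (.read 6 idx) (.read 7 idx) (.read 8 idx)) .skip))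
    (forLoop 18 9 (.ifLe (.read 30 idx) (.const 0) (pushTriple idx idx (.const 0)) .skip))))))

theorem flatMap_filter {α β : Type*} (l : List α) (P : α → Prop) [DecidablePred P]
    (f : α → List β) :
    (l.filter P).flatMap f = l.flatMap fun a => if P a then f a else [] := by
  induction l with
  | nil => rfl
  | cons a l ih =>
    rw [List.flatMap_cons, ← ih, List.filter_cons]
    by_cases h : P a <;> simp [h]

theorem emitActive_emits (a : MCRInstance) {s₀ : State}
    (hG : HoldsGame a.1.game a.1.edgeList s₀) (h11 : s₀ 11 0 = ((a.2 : ℕ) : ℤ))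
    (h30 : ∀ u : Fin a.1.n, s₀ 30 ((u : ℕ) : ℤ) = if u ∈ a.1.game.activeSet then 1 else 0)
    (h32 : s₀ 32 0 = (a.1.game.activeEdges a.1.edgeList).length) :
    Emits (Agree s₀) emitActive (200 * (a.1.n + a.1.edgeList.length + 1))
      (activeInstance a).code := by
  have h1 : Emits (Agree s₀) (push 0 1 (var 11)) 20 [((a.2 : ℕ) : ℤ)] :=
    (Emits.push (stable_agree_output _) fun s hs => by
      simp only [Expr.eval, hs 11 (by decide), h11]).mono (by decide)
  have h2 : Emits (Agree s₀) (push 0 1 (var 9)) 20 [(a.1.n : ℤ)] :=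
    (Emits.push (stable_agree_output _) fun s hs => by
      simp only [Expr.eval, hs 9 (by decide), hG.card]).mono (by decide)
  have h3 : Emits (Agree s₀) (forLoop 18 9 (push 0 1 (.read 4 idx))) (a.1.n * 34 + 11)
      ((List.finRange a.1.n).flatMap fun v => [if v ∈ a.1.game.maxV then 1 else 0]) :=
    emits_vertexLoop (t := 20) hG.card _ (by decide) fun v =>
      (Emits.push (stable_agreeAt _ _) fun s hs => by
        simp only [Expr.eval, hs.2, hs.1 4 (by decide), hG.own]).mono (by decide)
  have h4 : Emits (Agree s₀) (push 0 1 (var 32)) 20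
      [((a.1.game.activeEdges a.1.edgeList).length : ℤ)] :=
    (Emits.push (stable_agree_output _) fun s hs => by
      simp only [Expr.eval, hs 32 (by decide), h32]).mono (by decide)
  have h5 : Emits (Agree s₀) (forLoop 18 10 (.ifLe (.const 1) (.read 30 (.read 6 idx))
      (pushTriple (.read 6 idx) (.read 7 idx) (.read 8 idx)) .skip)) (a.1.edgeList.length * 84 + 11)
      (a.1.edgeList.flatMap fun e => if e.1 ∈ a.1.game.activeSet then
        [((e.1 : ℕ) : ℤ), ((e.2 : ℕ) : ℤ), a.1.game.weight e.1 e.2] else []) := by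
    refine emits_edgeLoop (t := 70) hG.size _ (by decide) fun k hk => ?_
    refine (Emits.ifLe (t := 50) (fun s hs => ?_)
      ((Emits.push_triple (stable_agreeAt _ _)
        (fun s hs => by simp only [Expr.eval, hs.2, hs.1 6 (by decide), hG.src k hk])
        (fun s hs => by simp only [Expr.eval, hs.2, hs.1 7 (by decide), hG.dst k hk])
        (fun s hs => by simp only [Expr.eval, hs.2, hs.1 8 (by decide), hG.wt k hk])).mono
          (by decide)) (Emits.skip.mono (by decide))).mono (by decide)
    simp only [Expr.eval, hs.2, hs.1 6 (by decide), hs.1 30 (by decide), hG.src k hk, h30]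
    split_ifs with h <;> simp [h]
  have h6 : Emits (Agree s₀) (forLoop 18 9 (.ifLe (.read 30 idx) (.const 0)
      (pushTriple idx idx (.const 0)) .skip)) (a.1.n * 84 + 11)
      ((List.finRange a.1.n).flatMap fun v : Fin a.1.n => if v ∉ a.1.game.activeSet then
        [((v : ℕ) : ℤ), ((v : ℕ) : ℤ), 0] else []) := by
    refine emits_vertexLoop (t := 70) hG.card _ (by decide) fun v => ?_
    refine (Emits.ifLe (t := 50) (fun s hs => ?_)
      ((Emits.push_triple (stable_agreeAt _ _) (fun s hs => by simp only [Expr.eval, hs.2])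
        (fun s hs => by simp only [Expr.eval, hs.2]) (fun s hs => rfl)).mono
          (by decide)) (Emits.skip.mono (by decide))).mono (by decide)
    simp only [Expr.eval, hs.2, hs.1 30 (by decide), h30]
    split_ifs with h <;> simp [h]
  have hall := h1.seq (h2.seq (h3.seq (h4.seq (h5.seq h6))))
  have hcode : (activeInstance a).code = ((a.2 : ℕ) : ℤ) :: (a.1.n : ℤ) ::
      (setCode a.1.game.maxV ++ edgesCode (a.1.game.activeGraph a.1.edgeList a.1.mem_edgeList)
        (a.1.game.activeEdges a.1.edgeList)) := rfl
  have hedges : edgesCode (a.1.game.activeGraph a.1.edgeList a.1.mem_edgeList)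
      (a.1.game.activeEdges a.1.edgeList) = [((a.1.game.activeEdges a.1.edgeList).length : ℤ)] ++
      ((a.1.edgeList.flatMap fun e => if e.1 ∈ a.1.game.activeSet then
        [((e.1 : ℕ) : ℤ), ((e.2 : ℕ) : ℤ), a.1.game.weight e.1 e.2] else []) ++
      ((List.finRange a.1.n).flatMap fun v : Fin a.1.n => if v ∉ a.1.game.activeSet then
        [((v : ℕ) : ℤ), ((v : ℕ) : ℤ), 0] else [])) := by
    rw [edgesCode, List.singleton_append]
    congr 1
    rw [MCRGame.activeEdges, List.flatMap_append, List.flatMap_map, flatMap_filter, flatMap_filter]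
    congr 2 <;> funext v <;> split_ifs with h <;> simp [MCRGame.activeGraph, h]
  rw [hcode, hedges, setCode, ofFn_eq_flatMap]
  exact hall.mono (by omega)

theorem reducible_valueNegInf :
    PolyReducible MCRInstance.code MPInstance.code ValueNegInf MeanPayoffNeg := by
  refine ⟨activeInstance, activeInstance_mem_iff,
    .seq attractorCmd (.seq markActive (.seq countEdges (.seq (setVar 1 (.const 0)) emitActive))),
    2000 * Polynomial.X ^ 2, fun a => ?_⟩
  have hlen := length_le_bitSize a.code
  rw [length_instance_code] at hlen
  have hmul : (a.1.n + 1) * (a.1.n + a.1.edgeList.length + 1) ≤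
      bitSize a.code * bitSize a.code := Nat.mul_le_mul (by omega) (by omega)
  have hmul' : a.1.n + a.1.edgeList.length + 1 ≤
      (a.1.n + 1) * (a.1.n + a.1.edgeList.length + 1) :=
    Nat.le_mul_of_pos_left _ (Nat.succ_pos _)
  refine Runs.outputsWithin (t := 2000 * (bitSize a.code * bitSize a.code)) (Runs.seq
    (t₂ := 400 * (a.1.n + a.1.edgeList.length + 1)) (attractorCmd_runs a []) ?_ (by omega))
    (by simp [pow_two])
  rintro s ⟨hG, h11, -, hzero, hattr⟩ -
  refine Runs.seq (t₂ := 44 * (a.1.n + a.1.edgeList.length + 1) +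
    (200 * (a.1.n + a.1.edgeList.length + 1) + 4) + 1) (markActive_runs hG hattr) ?_ (by omega)
  intro s₁ h30 hs₁
  have hG₁ : HoldsGame a.1.game a.1.edgeList s₁ :=
    hG.congr fun a ha => hs₁ a (by revert ha; revert a; decide)
  refine Runs.seq (countEdges_runs hG₁ ?_ h30) ?_ le_rfl
  · rw [hs₁ 32 (by decide), hzero 32 (by decide)]
  intro s₂ h32 hs₂
  refine (emitActive_emits a (hG₁.congr fun a ha => hs₂ a (by revert ha; revert a; decide)) ?_ ?_
    h32).outputs
  · rw [hs₂ 11 (by decide), hs₁ 11 (by decide), h11]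
  · rw [hs₂ 30 (by decide)]; exact h30

end RAM

/-! ### Computing values and optimal strategies -/

namespace RAM

/-- Writes the values and the strategies after value iteration. The update table of the Moore
machine counts down, its decision table consists of the tables of best moves of all iterations. For
Max, the table of the last iteration is used, when the vector was already stable. -/
def emitSolution : Cmd :=
  .seq (forLoop 18 9 (.seq (push 0 1 (.read 12 idx)) (push 0 1 (.read 13 idx))))
    (.seq (forLoop 18 9 (push 0 1 (.read 16 idx)))
    (.seq (push 0 1 (var 24)) (.seq (push 0 1 (.minus (var 24) (.const 1)))
    (.seq (forLoop 19 24 (forLoop 18 9 (.ifLe (var 19) (.const 0) (push 0 1 (.const 0))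
      (push 0 1 (.minus (var 19) (.const 1))))))
    (forLoop 18 23 (push 0 1 (.read 22 idx)))))))

/-- Computes values and optimal strategies. As no test for stability is made, the number of
iterations is always the bound for it. -/
def solve : Cmd :=
  .seq (parseMCR 0) (.seq setup (.seq valueIteration (.seq (setVar 1 (.const 0)) emitSolution)))

theorem flatten_ofFn {K : ℕ} {α : Type*} (g : Fin K → List α) :
    (List.ofFn g).flatten = (List.finRange K).flatMap g := by
  rw [List.ofFn_eq_map, List.flatMap_def]

theorem emitSolution_emits {n : ℕ} {s₀ : State} {x : Fin n → Zbar} {f : Fin n → Fin n}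
    {log : List (Fin n → Fin n)} (hK : 0 < log.length) {ch : ℕ → Fin n → Fin n}
    (hch : ∀ (j : ℕ) (h : j < log.length), ch j = log[j]) (h9 : s₀ 9 0 = n)
    (hx : HoldsVec 12 13 x s₀) (hf : ∀ v : Fin n, s₀ 16 ((v : ℕ) : ℤ) = ((f v : ℕ) : ℤ))
    (h24 : s₀ 24 0 = log.length) (hlog : Holds 22 23 (log.flatMap tableCode) s₀) :
    Emits (Agree s₀) emitSolution (300 * ((log.length + 1) * (n + 1)))
      (solutionCode x f (MCRGame.countdown log.length hK ch)) := by
  have h1 : Emits (Agree s₀) (forLoop 18 9 (.seq (push 0 1 (.read 12 idx))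
      (push 0 1 (.read 13 idx)))) (n * 54 + 11)
      ((List.finRange n).flatMap fun v => (x v).code) := by
    refine emits_vertexLoop (t := 40) h9 _ (by decide) fun v => ?_
    rw [Zbar.code_eq]
    refine ((Emits.push (x := (x v).tag) (stable_agreeAt _ _) fun s hs => ?_).seq
      (Emits.push (x := (x v).toInt) (stable_agreeAt _ _) fun s hs => ?_)).mono (by decide)
    · simp only [Expr.eval, hs.2, hs.1 12 (by decide), (hx v).1]
    · simp only [Expr.eval, hs.2, hs.1 13 (by decide), (hx v).2]
  have h2 : Emits (Agree s₀) (forLoop 18 9 (push 0 1 (.read 16 idx))) (n * 34 + 11)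
      (tableCode f) := by
    rw [tableCode_eq]
    refine emits_vertexLoop (t := 20) h9 _ (by decide) fun v => ?_
    refine (Emits.push (stable_agreeAt _ _) fun s hs => ?_).mono (by decide)
    simp only [Expr.eval, hs.2, hs.1 16 (by decide), hf]
  have h3 : Emits (Agree s₀) (push 0 1 (var 24)) 20 [(log.length : ℤ)] :=
    (Emits.push (stable_agree_output _) fun s hs => by
      simp only [Expr.eval, hs 24 (by decide), h24]).mono (by decide)
  have h4 : Emits (Agree s₀) (push 0 1 (.minus (var 24) (.const 1))) 20
      [((log.length - 1 : ℕ) : ℤ)] :=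
    (Emits.push (stable_agree_output _) fun s hs => by
      simp only [Expr.eval, hs 24 (by decide), h24]; omega).mono (by decide)
  have h5 : Emits (Agree s₀) (forLoop 19 24 (forLoop 18 9 (.ifLe (var 19) (.const 0)
      (push 0 1 (.const 0)) (push 0 1 (.minus (var 19) (.const 1))))))
      (log.length * ((n * 64 + 11) + 14) + 11)
      ((List.finRange log.length).flatMap fun m => tableCode
        ((MCRGame.countdown log.length hK ch).update m)) := by
    have := Emits.forLoop (I := Agree s₀) (i := 19) (b := 24) (t := n * 64 + 11)
      (c := forLoop 18 9 (.ifLe (var 19) (.const 0) (push 0 1 (.const 0))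
        (push 0 1 (.minus (var 19) (.const 1))))) (List.finRange log.length)
      (fun m => tableCode ((MCRGame.countdown log.length hK ch).update m))
      (stable_agree (by decide) s₀) (by decide) (by decide) (by decide) (by decide) (by decide)
      (fun s hs => by rw [hs 24 (by decide), h24, List.length_finRange]) fun k hk => by
        have hst : ∀ {A : List ℕ}, A ⊆ [0, 1, 18] → 19 ∉ A →
            Stable A fun s => Agree s₀ s ∧ s 19 0 = (k : ℤ) := fun hA h19 =>
          (stable_agree (List.Subset.trans hA (by decide)) s₀).and_var h19 k
        rw [tableCode_eq]
        have hin := Emits.forLoop (i := 18) (b := 9) (t := 50)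
          (c := .ifLe (var 19) (.const 0) (push 0 1 (.const 0))
            (push 0 1 (.minus (var 19) (.const 1)))) (List.finRange n)
          (fun _ => [((k - 1 : ℕ) : ℤ)])
          (hst (A := [0, 1, 18]) (by decide) (by decide)) (by decide) (by decide) (by decide)
          (by decide) (by decide)
          (fun s hs => by rw [hs.1 9 (by decide), h9, List.length_finRange]) fun j hj => by
            have hst' := (hst (A := [0, 1]) (by decide) (by decide)).and_var (i := 18) (by decide) j
            have hif := Emits.ifLe (e₁ := var 19) (e₂ := .const 0) (P := k = 0) (t := 30)
              (fun s (hs : (Agree s₀ s ∧ s 19 0 = (k : ℤ)) ∧ s 18 0 = (j : ℤ)) => by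
                simp only [Expr.eval, hs.1.2]; omega)
              ((Emits.push (e := .const 0) hst' fun s hs => rfl).mono (by decide))
              ((Emits.push (e := .minus (var 19) (.const 1)) (x := (k : ℤ) - 1) hst' fun s hs => by
                simp only [Expr.eval, hs.1.2]).mono (by decide))
            have hval : (if k = 0 then [(0 : ℤ)] else [(k : ℤ) - 1]) = [((k - 1 : ℕ) : ℤ)] := by
              split_ifs with h
              · rw [h]; rfl
              · rw [Nat.cast_sub (by omega)]; rfl
            have := hif.mono (t₂ := 50) (by decide)
            change Emits _ _ _ (if k = 0 then [(0 : ℤ)] else [(k : ℤ) - 1]) at this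
            rwa [hval] at this
        rw [List.length_finRange] at hin
        simpa [MCRGame.countdown] using hin
    rwa [List.length_finRange] at this
  have h6 : Emits (Agree s₀) (forLoop 18 23 (push 0 1 (.read 22 idx)))
      ((log.length * n) * 34 + 11) (log.flatMap tableCode) := by
    have hlen : (log.flatMap tableCode).length = log.length * n := by
      simp [List.length_flatMap, tableCode]
    have := Emits.forLoop (I := Agree s₀) (i := 18) (b := 23) (t := 20)
      (c := push 0 1 (.read 22 idx)) (log.flatMap tableCode) (fun z => [z])
      (stable_agree (by decide) s₀) (by decide) (by decide) (by decide) (by decide) (by decide)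
      (fun s hs => by rw [hs 23 (by decide), hlog.1]) fun k hk => by
        refine (Emits.push (stable_agreeAt _ _) fun s hs => ?_).mono (by decide)
        simp only [Expr.eval, hs.2, hs.1 22 (by decide), hlog.2 k hk]
        rw [List.getD_eq_getElem?_getD, List.getElem?_eq_getElem hk, Option.getD_some]
    rw [hlen] at this
    simpa using this
  have hall := h1.seq (h2.seq (h3.seq (h4.seq (h5.seq h6))))
  have hdec : (List.finRange log.length).flatMap (fun m => tableCode
      ((MCRGame.countdown log.length hK ch).decision m)) = log.flatMap tableCode := by
    have : ∀ m : Fin log.length, (MCRGame.countdown log.length hK ch).decision m = log.get m :=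
      fun m => hch m m.2
    simp only [this]
    rw [← List.flatMap_map, List.map_get_finRange]
  have hcode : solutionCode x f (MCRGame.countdown log.length hK ch) =
      ((List.finRange n).flatMap fun v => (x v).code) ++ (tableCode f ++ ([(log.length : ℤ)] ++
        ([((log.length - 1 : ℕ) : ℤ)] ++ (((List.finRange log.length).flatMap fun m => tableCode
        ((MCRGame.countdown log.length hK ch).update m)) ++ log.flatMap tableCode)))) := by
    rw [solutionCode, Moore.code, flatten_ofFn, flatten_ofFn, flatten_ofFn, hdec]
    simp only [List.append_assoc, List.cons_append, List.nil_append]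
    rfl
  rw [hcode]
  refine hall.mono ?_
  have : (log.length + 1) * (n + 1) = log.length * n + log.length + n + 1 := by ring
  rw [this]
  have : log.length * ((n * 64 + 11) + 14) = 64 * (log.length * n) + 25 * log.length := by ring
  rw [this]
  omega

theorem solve_time {n m W : ℕ} (hn : 0 < n) (hm : n ≤ m) :
    (MCRGame.iterBound n W + 1) * (n + m + 1) ≤ 15 * (n ^ 2 * m * max 1 W) := by
  have h1 : 1 ≤ max 1 W := le_max_left _ _
  have h2 : W ≤ max 1 W := le_max_right _ _
  have hb := iterBound_le n W
  have h3 : 2 * n * W * n ≤ 2 * (n ^ 2 * max 1 W) := by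
    calc 2 * n * W * n = 2 * (n ^ 2 * W) := by ring
      _ ≤ _ := Nat.mul_le_mul_left _ (Nat.mul_le_mul_left _ h2)
  have h4 : n ≤ n ^ 2 * max 1 W := by
    calc n = n * 1 * 1 := by ring
      _ ≤ n * n * max 1 W := Nat.mul_le_mul (Nat.mul_le_mul_left _ hn) h1
      _ = _ := by ring
  calc (MCRGame.iterBound n W + 1) * (n + m + 1) ≤ (5 * (n ^ 2 * max 1 W)) * (3 * m) :=
        Nat.mul_le_mul (by omega) (by omega)
    _ = 15 * (n ^ 2 * m * max 1 W) := by ring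

theorem card_le_length (I : MCRInput) : I.n ≤ I.edgeList.length := by
  choose f hf using I.game.deadlockFree
  have := Finset.card_le_card_of_injOn (s := Finset.univ) (t := I.edgeList.toFinset)
    (fun v => (v, f v)) (fun v _ => by simpa using (I.mem_edgeList _).2 (hf v))
    (fun u _ v _ h => (Prod.ext_iff.1 h).1)
  rw [Finset.card_univ, Fintype.card_fin] at this
  exact this.trans I.edgeList.toFinset_card_le

theorem card_edges (I : MCRInput) : I.game.edges.card = I.edgeList.length := by
  rw [← List.toFinset_card_of_nodup I.nodup]
  congr 1
  ext e
  rw [List.mem_toFinset, I.mem_edgeList]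

theorem exists_solve : ∃ (c : Cmd) (C : ℕ), ∀ I : MCRInput, 0 < I.n →
    ∃ (f : Fin I.n → Fin I.n) (K : ℕ) (M : Moore (Fin I.n) K),
      OutputsWithin c I.code [] (C * (I.n ^ 2 * I.game.edges.card * max 1 I.game.maxWeight))
        (solutionCode I.game.value f M) ∧
      (∃ σ : I.game.MaxStrategy, σ.FollowsTable f ∧ I.game.OptimalMax σ) ∧
      ((∃ τ : I.game.MinStrategy, I.game.OptimalMin τ) →
        ∃ τ : I.game.MinStrategy, M.Encodes τ ∧ I.game.OptimalMin τ) := by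
  refine ⟨solve, 20000, fun I hn => ?_⟩
  have hne : Nonempty (Fin I.n) := ⟨⟨0, hn⟩⟩
  set N := MCRGame.iterBound I.n I.game.maxWeight with hN
  have hN2 : 2 ≤ N := by
    have : 2 * I.n ≤ N := Nat.le_add_left _ _
    omega
  have hiter : ∀ j, N ≤ j + 1 → I.game.iter j = I.game.limitVec := fun j hj =>
    I.game.iter_iterBound (by rwa [Fintype.card_fin])
  have hrun : Runs solve (startState I.code [])
      (20000 * (I.n ^ 2 * I.game.edges.card * max 1 I.game.maxWeight)) fun s =>
        ∃ (log : List (Fin I.n → Fin I.n)) (hK : 0 < log.length), log.length = N ∧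
          IsLog I.game I.game.bound log ∧ Holds 0 1 (solutionCode I.game.value log[log.length - 1]
            (MCRGame.countdown log.length hK fun j => log.getD j id)) s := by
    have hm := card_le_length I
    have htime : (N + 1) * (I.n + I.edgeList.length + 1) ≤ _ :=
      solve_time (W := I.game.maxWeight) hn hm
    rw [card_edges]
    have hmul : (N + 1) * (I.n + 1) ≤ (N + 1) * (I.n + I.edgeList.length + 1) :=
      Nat.mul_le_mul_left _ (by omega)
    have hmul' : I.n + I.edgeList.length + 1 ≤ (N + 1) * (I.n + I.edgeList.length + 1) :=
      Nat.le_mul_of_pos_left _ (Nat.succ_pos _)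
    refine Runs.seq (t₂ := 200 * (I.n + I.edgeList.length + 1) +
      (400 * ((N + 1) * (I.n + I.edgeList.length + 1)) + (300 * ((N + 1) * (I.n + 1)) + 4) + 1) + 1)
      (parseMCR_runs (o := 0) (G := I.game) (es := I.edgeList) (pre := []) rfl rfl) ?_ (by omega)
    intro s₁ hG₁ hs₁
    have hzero : ∀ b ∈ [22, 23, 24, 25, 26], s₁ b = fun _ => 0 := by
      intro b hb
      have hw : ∀ b ∈ [22, 23, 24, 25, 26], b ∉ (parseMCR 0).writes := by decide
      rw [hs₁ b (hw b hb)]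
      simp only [List.mem_cons, List.not_mem_nil, or_false] at hb
      rcases hb with rfl | rfl | rfl | rfl | rfl <;> rfl
    refine Runs.seq (setup_runs hn I.mem_edgeList hG₁ (by rw [hzero 24 (by decide)])
      (by rw [hzero 25 (by decide)]) (by rw [hzero 26 (by decide)])) ?_ le_rfl
    rintro s₂ ⟨h17, h24⟩ hs₂
    have hG₂ : HoldsGame I.game I.edgeList s₂ :=
      hG₁.congr fun a ha => hs₂ a (by revert ha; revert a; decide)
    refine Runs.seq (valueIteration_runs I.mem_edgeList hG₂ h17 h24
      (holds_nil (by rw [hs₂ 23 (by decide), hzero 23 (by decide)]))) ?_ le_rfl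
    rintro s₃ ⟨hx, log, hlen, hlog, hz, hlast⟩ hs₃
    have hK : 0 < log.length := by omega
    have hvec : HoldsVec 12 13 I.game.value s₃ := by
      rw [← MCRGame.iter_eq, hiter N (by omega)] at hx
      have : I.game.value = I.game.limitVec := I.game.value_eq_limitVec
      rwa [this]
    have hf := hlast log[log.length - 1] (by
      rw [List.getLast?_eq_getElem?, List.getElem?_eq_getElem]; rfl)
    have hem := emitSolution_emits (ch := fun j => log.getD j id) hK (fun j h => by
      simp [List.getD_eq_getElem?_getD, h]) (by rw [hs₃ 9 (by decide), hG₂.card]) hvec hf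
      (by rw [hs₃ 24 (by decide), h24, hlen]) hz
    refine hem.outputs.mono (by rw [hlen]) fun s h => ⟨log, hK, hlen, hlog, h⟩
  obtain ⟨t, s, ht, hexec, log, hK, hlen, hlog, hout⟩ := hrun
  refine ⟨log[log.length - 1], log.length, MCRGame.countdown log.length hK fun j => log.getD j id,
    ⟨t, s, ht, hexec, hout⟩, ?_, ?_⟩
  · have hstab := hiter (log.length - 1) (by omega)
    obtain ⟨σ, h1, -, h2⟩ := I.game.exists_table_strategy log[log.length - 1] fun v => by
      have := hlog (log.length - 1) (by omega) v
      rwa [← MCRGame.iter_eq, hstab] at this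
    exact ⟨σ, h1, I.game.optimalMax_of_le h2⟩
  · rintro ⟨τ, hτ⟩
    refine I.game.exists_optimal_countdown (fun v => ?_) hK (hiter _ (by omega)) _ fun i hi v => ?_
    · rw [← MCRGame.upper_eq_limitVec]
      exact I.game.upper_ne_bot_of_optimalMin hτ v
    · have := hlog i hi v
      rw [← MCRGame.iter_eq] at this
      simpa [List.getD_eq_getElem?_getD, hi] using this

end RAM

theorem theorem1 :
    -- min-cost reachability games are determined, so that the value is well defined
    (∀ (V : Type u) [Fintype V] (G : MCRGame V) (v : V), G.lower v = G.upper v) ∧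
    -- (1) value `+∞`: the complement of the attractor; polynomial time
    ((∀ (V : Type u) [Fintype V] (G : MCRGame V) (v : V),
        G.value v = ⊤ ↔ v ∉ G.attr (Fintype.card V)) ∧
      RAM.PolyTime MCRInstance.code ValuePosInf) ∧
    -- (2) value `-∞`: as hard as mean-payoff games, in NP and coNP, pseudo-polynomial time
    (RAM.PolyReducible MPInstance.code MCRInstance.code MeanPayoffNeg ValueNegInf ∧
      RAM.PolyReducible MCRInstance.code MPInstance.code ValueNegInf MeanPayoffNeg ∧
      RAM.NP MCRInstance.code ValueNegInf ∧
      RAM.CoNP MCRInstance.code ValueNegInf ∧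
      RAM.PseudoPolyTime MCRInstance.code ValueNegInf) ∧
    -- (3) optimal strategies: memoryless for Max, of pseudo-polynomial size for Min
    ((∃ p : Polynomial ℕ, ∀ (V : Type u) [Fintype V] (G : MCRGame V), (∀ v, G.value v ≠ ⊥) →
        (∃ σ : G.MaxStrategy, σ.Memoryless ∧ G.OptimalMax σ) ∧
        (∃ K ≤ p.eval (Fintype.card V + G.maxWeight), ∃ (M : Moore V K) (τ : G.MinStrategy),
          M.Encodes τ ∧ G.OptimalMin τ)) ∧
      -- Min may need memory, even of a size that is exponential in the binary size of `W`
      (∀ W : ℕ, 1 ≤ W → ∃ G : MCRGame (Fin 3), G.maxWeight = W ∧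
        (∀ v, G.value v ≠ ⊥ ∧ G.value v ≠ ⊤) ∧
        (∀ τ : G.MinStrategy, G.OptimalMin τ → ¬ τ.Memoryless) ∧
        (∀ (K : ℕ) (M : Moore (Fin 3) K) (τ : G.MinStrategy),
          M.Encodes τ → G.OptimalMin τ → W + 1 ≤ K))) ∧
    -- (4) value iteration, and the time that is needed for computing values and strategies
    ((∀ (V : Type u) [Fintype V] [Nonempty V] (G : MCRGame V),
        IsGreatest {x | G.op x = x} G.value ∧
        (∃ i, i + 1 ≤ (2 * Fintype.card V - 1) * G.maxWeight * Fintype.card V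
            + 2 * Fintype.card V ∧ G.iter (i + 1) = G.iter i) ∧
        (∀ i, G.iter (i + 1) = G.iter i → G.iter i = G.value)) ∧
      ∃ (c : RAM.Cmd) (C : ℕ), ∀ I : MCRInput, 0 < I.n →
        ∃ (f : Fin I.n → Fin I.n) (K : ℕ) (M : Moore (Fin I.n) K),
          RAM.OutputsWithin c I.code []
            (C * (I.n ^ 2 * I.game.edges.card * max 1 I.game.maxWeight))
            (solutionCode I.game.value f M) ∧
          (∃ σ : I.game.MaxStrategy, σ.FollowsTable f ∧ I.game.OptimalMax σ) ∧
          ((∃ τ : I.game.MinStrategy, I.game.OptimalMin τ) →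
            ∃ τ : I.game.MinStrategy, M.Encodes τ ∧ I.game.OptimalMin τ)) := by
  exact ⟨fun V _ G v => by rw [G.lower_eq_limitVec, G.upper_eq_limitVec],
    ⟨fun V _ G v => G.value_eq_top_iff, RAM.polyTime_valuePosInf⟩,
    ⟨RAM.reducible_meanPayoffNeg, RAM.reducible_valueNegInf, RAM.np_valueNegInf,
      RAM.coNP_valueNegInf, RAM.pseudoPolyTime_valueNegInf⟩,
    ⟨MCRGame.exists_optimal_strategies, MCRGame.exists_memory_lower_bound⟩,
    ⟨fun V _ _ G => ⟨G.value_isGreatest,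
      (G.exists_iter_stable).imp fun _ h => ⟨h.2.1, h.2.2⟩,
      fun i h => (G.iter_eq_limitVec h).trans G.value_eq_limitVec.symm⟩, RAM.exists_solve⟩⟩
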